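/- Let $\mathbb{B}=\mathrm{span}_{\mathbb{R}}(1,\mathbf i,\mathbf s,\mathbf t)$ be the split quaternions, $\mathbf i^2=-1$, $\mathbf s^2=\mathbf t^2=1$, $\mathbf i\mathbf s=\mathbf t=-\mathbf s\mathbf i$, with the inner product $\langle p,q\rangle=\mathrm{Re}(p\bar q)$, let $\mathrm{Sp}(1,\mathbb{B})=\{q\in\mathbb{B}: q\bar q=1\}\cong\mathrm{SU}(1,1)$, and let $\mathfrak{sp}(1,\mathbb{B})=\mathrm{Im}\,\mathbb{B}$ be its Lie algebra. Let $(M,g_M,I,S,T)$ be a non-empty hypersymplectic manifold of dimension $4n$: $g_M$ is a pseudo-Riemannian metric of signature $(2n,2n)$, $I,S,T$ are smooth endomorphism fields with $I^2=-1$, $S^2=T^2=1$, $IS=T=-SI$, $g_M(I\cdot,I\cdot)=g_M=-g_M(S\cdot,S\cdot)=-g_M(T\cdot,T\cdot)$, and the 2-forms $g_M(I\cdot,\cdot)$, $g_M(S\cdot,\cdot)$, $g_M(T\cdot,\cdot)$ are closed. For $\xi=\xi_1\mathbf i+\xi_2\mathbf s+\xi_3\mathbf t$ put $\mathbb{I}_\xi=\xi_1I+\xi_2S+\xi_3T$.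 Suppose that $\mathrm{Sp}(1,\mathbb{B})$ acts on $M$ smoothly, freely, isometrically and permuting, i.e. $q_*\,\mathbb{I}_\xi\,q_*^{-1}=\mathbb{I}_{q\xi\bar q}$ for all $q\in\mathrm{Sp}(1,\mathbb{B})$ and $\xi\in\mathfrak{sp}(1,\mathbb{B})$. Let $K_\xi$ denote the fundamental vector field of $\xi$. Put $(\iota\omega)(\xi,\xi')=g_M(\mathbb{I}_\xi K_{\xi'},\cdot)$, let $\gamma_1$ be the alternating part of $\iota\omega$, regarded as an $\mathfrak{sp}(1,\mathbb{B})^*$-valued 1-form, $$\gamma_1([\xi,\xi'])=\tfrac12\big(g_M(\mathbb{I}_\xi K_{\xi'},\cdot)-g_M(\mathbb{I}_{\xi'}K_\xi,\cdot)\big),$$ and let $\rho(\xi,\xi')=\gamma_1(\xi)(K_{\xi'})$. Let $\rho_0=\frac13\mathrm{tr}\,\rho$ (trace with respect to $\langle\cdot,\cdot\rangle$) and let $\rho_2$ be the trace-free symmetric part of $\rho$, so that $\rho_2(\xi,\xi')=\frac12(\rho(\xi,\xi')+\rho(\xi',\xi))-\rho_0\langle\xi,\xi'\rangle$. Assume $\rho_2=0$.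 Then $\rho_0$ is a hypersymplectic potential, i.e. it is smooth and $\frac12\,d(J\,d\rho_0)=g_M(J\cdot,\cdot)$ for $J=I,S,T$, where $(J\alpha)(v)=-\alpha(Jv)$. Let $\mathcal{E}$ be its gradient field, $g_M(\mathcal{E},\cdot)=d\rho_0$, and let $\nabla$ be the Levi-Civita connection of $g_M$. Then $\mathcal{E}$ is smooth and nowhere zero, and: 1. $\nabla\mathcal{E}=\mathrm{id}_{TM}$; equivalently, $\nabla^2\rho_0=g_M$. 2. The metric $g_M$ is (geodesically) incomplete. 3. The metrics on different level sets of $\rho_0$ are homothetic through the flow $\varphi_t$ of $\mathcal{E}$. Precisely, write $\mathcal{S}_c=\rho_0^{-1}(c)$ and let $D_t\subseteq M$ be the set of points at which $\varphi_t$ is defined. Every $x\in M$ lies in $D_t$ for all sufficiently small $|t|$; each $D_t$ is open; and for all $t,c\in\mathbb{R}$, $\varphi_t$ restricts to a diffeomorphism from $\mathcal{S}_c\cap D_t$ onto $\mathcal{S}_{e^{2t}c}\cap D_{-t}$ that multiplies the induced metrics by $e^{2t}$. In particular, if the flow of $\mathcal{E}$ is complete, then for any $c,c'$ with $cc'>0$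 there is a diffeomorphism from $\mathcal{S}_c$ onto $\mathcal{S}_{c'}$ that multiplies the induced metrics by $c'/c$. -/

import Mathlib

open Bundle Set
open scoped Manifold ContDiff Quaternion Topology

noncomputable section

namespace Hypersymplectic

/-! ### Split quaternions -/

/-- The split quaternions `p₀ + p₁ i + p₂ s + p₃ t`, with `i² = -1`, `s² = 1`, `i s = t = -s i`
(hence `t² = 1`); the fields `imI`, `imJ`, `imK` are the coordinates along `i`, `s`, `t`. -/
abbrev SplitQuaternion : Type := ℍ[ℝ,-1,1]

/-- The inner product `⟨p, q⟩ = Re (p q̄)` of signature `(2,2)`. -/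
def pairing (p q : SplitQuaternion) : ℝ := (p * star q).re

def unitI : SplitQuaternion := ⟨0, 1, 0, 0⟩
def unitS : SplitQuaternion := ⟨0, 0, 1, 0⟩
def unitT : SplitQuaternion := ⟨0, 0, 0, 1⟩

/-- The group `Sp(1, 𝔹) ≅ SU(1,1)` of split quaternions `q` with `q q̄ = q̄ q = 1`. Its Lie algebra is
the space of imaginary split quaternions, those with `ξ.re = 0`. -/
abbrev Sp1 : Type := unitary SplitQuaternion

theorem mul_star_eq (q : SplitQuaternion) :
    q * star q = ((pairing q q : ℝ) : SplitQuaternion) := by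
  ext <;> simp [pairing] <;> ring

theorem star_mul_eq (q : SplitQuaternion) :
    star q * q = ((pairing q q : ℝ) : SplitQuaternion) := by
  ext <;> simp [pairing] <;> ring

theorem normalize_mem {q : SplitQuaternion} (h : 0 < pairing q q) :
    (Real.sqrt (pairing q q))⁻¹ • q ∈ unitary SplitQuaternion := by
  have h1 : (Real.sqrt (pairing q q))⁻¹ * (Real.sqrt (pairing q q))⁻¹ * pairing q q = 1 := by
    rw [← mul_inv, Real.mul_self_sqrt h.le, inv_mul_cancel₀ h.ne']
  have h2 : star ((Real.sqrt (pairing q q))⁻¹ • q) = (Real.sqrt (pairing q q))⁻¹ • star q := by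
    ext <;> simp
  rw [Unitary.mem_iff, h2]
  constructor
  · rw [smul_mul_smul_comm, star_mul_eq, ← QuaternionAlgebra.coe_smul, smul_eq_mul, h1]
    rfl
  · rw [smul_mul_smul_comm, mul_star_eq, ← QuaternionAlgebra.coe_smul, smul_eq_mul, h1]
    rfl

open Classical in
/-- The radial retraction `q ↦ q / |q|` of the open set `{|q|² > 0}` of split quaternions onto
`Sp(1, 𝔹)` (with value `1` outside this open set). -/
def normalize (q : SplitQuaternion) : Sp1 :=
  if h : 0 < pairing q q then ⟨(Real.sqrt (pairing q q))⁻¹ • q, normalize_mem h⟩ else 1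

/-! ### Vector fields and differential forms on a manifold -/

section Manifold

variable {E : Type*} [NormedAddCommGroup E] [NormedSpace ℝ E]
  {M : Type*} [TopologicalSpace M] [ChartedSpace E M]

/-- The vector field `X` is smooth at `x`. -/
def SmoothFieldAt [IsManifold 𝓘(ℝ, E) ∞ M] (X : ∀ x : M, TangentSpace 𝓘(ℝ, E) x) (x : M) : Prop :=
  ContMDiffAt 𝓘(ℝ, E) 𝓘(ℝ, E).tangent ∞ (fun y => (⟨y, X y⟩ : TangentBundle 𝓘(ℝ, E) M)) x

/-- `dα (X, Y) = X (α Y) - Y (α X) - α [X, Y]` for a 1-form `α`. -/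
def dOne (α : ∀ x : M, TangentSpace 𝓘(ℝ, E) x → ℝ) (X Y : ∀ x : M, TangentSpace 𝓘(ℝ, E) x)
    (x : M) : ℝ :=
  mvfderiv 𝓘(ℝ, E) (fun y => α y (Y y)) x (X x) - mvfderiv 𝓘(ℝ, E) (fun y => α y (X y)) x (Y x)
    - α x (VectorField.mlieBracket 𝓘(ℝ, E) X Y x)

/-- `dβ (X, Y, Z) = X β(Y, Z) - Y β(X, Z) + Z β(X, Y) - β([X, Y], Z) + β([X, Z], Y) - β([Y, Z], X)`
for a 2-form `β`. -/
def dTwo (β : ∀ x : M, TangentSpace 𝓘(ℝ, E) x → TangentSpace 𝓘(ℝ, E) x → ℝ)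
    (X Y Z : ∀ x : M, TangentSpace 𝓘(ℝ, E) x) (x : M) : ℝ :=
  mvfderiv 𝓘(ℝ, E) (fun y => β y (Y y) (Z y)) x (X x)
    - mvfderiv 𝓘(ℝ, E) (fun y => β y (X y) (Z y)) x (Y x)
    + mvfderiv 𝓘(ℝ, E) (fun y => β y (X y) (Y y)) x (Z x)
    - β x (VectorField.mlieBracket 𝓘(ℝ, E) X Y x) (Z x)
    + β x (VectorField.mlieBracket 𝓘(ℝ, E) X Z x) (Y x)
    - β x (VectorField.mlieBracket 𝓘(ℝ, E) Y Z x) (X x)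

/-- The 2-form `β` is closed. -/
def IsClosedTwoForm [IsManifold 𝓘(ℝ, E) ∞ M]
    (β : ∀ x : M, TangentSpace 𝓘(ℝ, E) x → TangentSpace 𝓘(ℝ, E) x → ℝ) : Prop :=
  ∀ (x : M) (X Y Z : ∀ x : M, TangentSpace 𝓘(ℝ, E) x),
    SmoothFieldAt X x → SmoothFieldAt Y x → SmoothFieldAt Z x → dTwo β X Y Z x = 0

end Manifold

/-! ### Pseudo-Riemannian metrics, Levi-Civita connection, geodesics -/

section Metric

variable (E : Type*) [NormedAddCommGroup E] [NormedSpace ℝ E]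
  (M : Type*) [TopologicalSpace M] [ChartedSpace E M] [IsManifold 𝓘(ℝ, E) ∞ M]

/-- A smooth pseudo-Riemannian metric. -/
structure PseudoMetric where
  val : ∀ x : M, TangentSpace 𝓘(ℝ, E) x →L[ℝ] TangentSpace 𝓘(ℝ, E) x →L[ℝ] ℝ
  symm : ∀ x v w, val x v w = val x w v
  nondegenerate : ∀ x v, (∀ w, val x v w = 0) → v = 0
  smooth : ContMDiff 𝓘(ℝ, E) (𝓘(ℝ, E).prod 𝓘(ℝ, E →L[ℝ] E →L[ℝ] ℝ)) ∞
    (fun x => TotalSpace.mk' (E →L[ℝ] E →L[ℝ] ℝ) x (val x))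

/-- A smooth field of endomorphisms of the tangent bundle. -/
structure EndField where
  val : ∀ x : M, TangentSpace 𝓘(ℝ, E) x →L[ℝ] TangentSpace 𝓘(ℝ, E) x
  smooth : ContMDiff 𝓘(ℝ, E) (𝓘(ℝ, E).prod 𝓘(ℝ, E →L[ℝ] E)) ∞
    (fun x => TotalSpace.mk' (E →L[ℝ] E) x (val x))

variable {E M}

theorem PseudoMetric.exists_dual [FiniteDimensional ℝ E] (g : PseudoMetric E M) (x : M)
    (φ : TangentSpace 𝓘(ℝ, E) x →L[ℝ] ℝ) : ∃ v, ∀ w, g.val x v w = φ w := by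
  have : FiniteDimensional ℝ (TangentSpace 𝓘(ℝ, E) x) := inferInstanceAs (FiniteDimensional ℝ E)
  let L : TangentSpace 𝓘(ℝ, E) x →ₗ[ℝ] Module.Dual ℝ (TangentSpace 𝓘(ℝ, E) x) :=
    (ContinuousLinearMap.coeLM ℝ).comp (g.val x).toLinearMap
  have hinj : Function.Injective L := by
    rw [injective_iff_map_eq_zero]
    intro v hv
    exact g.nondegenerate x v fun w => congrArg (fun f => f w) hv
  have hsurj : Function.Surjective L :=
    (LinearMap.injective_iff_surjective_of_finrank_eq_finrank
      (Subspace.dual_finrank_eq).symm).1 hinj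
  obtain ⟨v, hv⟩ := hsurj φ.toLinearMap
  exact ⟨v, fun w => congrArg (fun f => f w) hv⟩

/-- The gradient of `f`, the unique vector field with `g (grad f, ·) = df`. -/
def gradient [FiniteDimensional ℝ E] (g : PseudoMetric E M) (f : M → ℝ) :
    ∀ x : M, TangentSpace 𝓘(ℝ, E) x :=
  fun x => (g.exists_dual x (mvfderiv 𝓘(ℝ, E) f x)).choose

theorem gradient_spec [FiniteDimensional ℝ E] (g : PseudoMetric E M) (f : M → ℝ) (x : M)
    (w : TangentSpace 𝓘(ℝ, E) x) :
    g.val x (gradient g f x) w = mvfderiv 𝓘(ℝ, E) f x w :=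
  (g.exists_dual x (mvfderiv 𝓘(ℝ, E) f x)).choose_spec w

/-- `∇` is the Levi-Civita connection of `g`: it is torsion free and `∇g = 0`.
Here `∇ Y x v` stands for `(∇_v Y)(x)`. -/
structure IsLeviCivita (g : PseudoMetric E M)
    (nabla : CovariantDerivative 𝓘(ℝ, E) E (TangentSpace 𝓘(ℝ, E) : M → Type _)) : Prop where
  torsion_free : ∀ (x : M) (X Y : ∀ x : M, TangentSpace 𝓘(ℝ, E) x),
    MDifferentiableAt 𝓘(ℝ, E) 𝓘(ℝ, E).tangent
      (fun y => (⟨y, X y⟩ : TangentBundle 𝓘(ℝ, E) M)) x →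
    MDifferentiableAt 𝓘(ℝ, E) 𝓘(ℝ, E).tangent
      (fun y => (⟨y, Y y⟩ : TangentBundle 𝓘(ℝ, E) M)) x →
    nabla Y x (X x) - nabla X x (Y x) = VectorField.mlieBracket 𝓘(ℝ, E) X Y x
  metric : ∀ (x : M) (v : TangentSpace 𝓘(ℝ, E) x) (Y Z : ∀ x : M, TangentSpace 𝓘(ℝ, E) x),
    MDifferentiableAt 𝓘(ℝ, E) 𝓘(ℝ, E).tangent
      (fun y => (⟨y, Y y⟩ : TangentBundle 𝓘(ℝ, E) M)) x →
    MDifferentiableAt 𝓘(ℝ, E) 𝓘(ℝ, E).tangent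
      (fun y => (⟨y, Z y⟩ : TangentBundle 𝓘(ℝ, E) M)) x →
    mvfderiv 𝓘(ℝ, E) (fun y => g.val y (Y y) (Z y)) x v
      = g.val x (nabla Y x v) (Z x) + g.val x (Y x) (nabla Z x v)

/-- `∇²f (v, Y) = v (Y f) - (∇_v Y) f`, for a tangent vector `v` at `x` and a vector field `Y`. -/
def hessian (nabla : CovariantDerivative 𝓘(ℝ, E) E (TangentSpace 𝓘(ℝ, E) : M → Type _))
    (f : M → ℝ) (x : M) (v : TangentSpace 𝓘(ℝ, E) x) (Y : ∀ x : M, TangentSpace 𝓘(ℝ, E) x) : ℝ :=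
  mvfderiv 𝓘(ℝ, E) (fun y => mvfderiv 𝓘(ℝ, E) f y (Y y)) x v
    - mvfderiv 𝓘(ℝ, E) f x (nabla Y x v)

/-- The vector field with constant coordinates `w` in the chart at `x₀` (only meaningful on the
source of this chart). -/
def coordField (x₀ : M) (w : E) : ∀ y : M, TangentSpace 𝓘(ℝ, E) y :=
  fun y => (mfderiv 𝓘(ℝ, E) 𝓘(ℝ, E) (extChartAt 𝓘(ℝ, E) x₀).symm (extChartAt 𝓘(ℝ, E) x₀ y) w : E)

/-- The coordinates, in the chart at `x₀`, of a tangent vector `v` at a point `y` of the source of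
this chart. -/
def coordVec (x₀ y : M) (v : TangentSpace 𝓘(ℝ, E) y) : E :=
  mfderiv 𝓘(ℝ, E) 𝓘(ℝ, E) (extChartAt 𝓘(ℝ, E) x₀) y v

/-- The smooth curve `γ : ℝ → M` is a geodesic: its coordinates `u` in each chart `chartAt x₀`
satisfy `u'' + Γ(u', u') = 0`, where `Γ(u', u')` is the coordinate expression of the derivative
`∇_{γ'} W` of the vector field `W` whose coordinates are constant, equal to `u'(t)`. -/
def IsGeodesic (nabla : CovariantDerivative 𝓘(ℝ, E) E (TangentSpace 𝓘(ℝ, E) : M → Type _))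
    (γ : ℝ → M) : Prop :=
  ContMDiff 𝓘(ℝ, ℝ) 𝓘(ℝ, E) ∞ γ ∧
  ∀ (x₀ : M) (t : ℝ), γ t ∈ (chartAt E x₀).source →
    deriv (deriv (fun τ => extChartAt 𝓘(ℝ, E) x₀ (γ τ))) t
      + coordVec x₀ (γ t)
          (nabla (coordField x₀ (deriv (fun τ => extChartAt 𝓘(ℝ, E) x₀ (γ τ)) t)) (γ t)
            (mfderiv 𝓘(ℝ, ℝ) 𝓘(ℝ, E) γ t (1 : ℝ))) = 0

/-- Every initial velocity is the initial velocity of a geodesic defined on the whole real line. -/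
def IsGeodesicallyComplete
    (nabla : CovariantDerivative 𝓘(ℝ, E) E (TangentSpace 𝓘(ℝ, E) : M → Type _)) : Prop :=
  ∀ (x : M) (v : E), ∃ γ : ℝ → M, IsGeodesic nabla γ ∧ γ 0 = x ∧
    (mfderiv 𝓘(ℝ, ℝ) 𝓘(ℝ, E) γ 0 (1 : ℝ) : E) = v

/-- The flow of the vector field `X` is defined at `(t, x)` and sends `x` to `y` at time `t`. -/
def FlowsTo (X : ∀ x : M, TangentSpace 𝓘(ℝ, E) x) (t : ℝ) (x y : M) : Prop :=
  ∃ γ : ℝ → M, γ 0 = x ∧ γ t = y ∧ IsMIntegralCurveOn γ X (uIcc 0 t)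

/-- The set of points at which the time `t` flow of `X` is defined. -/
def flowDomain (X : ∀ x : M, TangentSpace 𝓘(ℝ, E) x) (t : ℝ) : Set M := {x | ∃ y, FlowsTo X t x y}

/-- Let `A` and `B` be relatively open subsets of regular level sets of `f`, so that the tangent
space of `A` at `x` is `ker df_x`. This says that `φ` restricts to a diffeomorphism from `A` onto `B`
which multiplies the metrics induced by `g` by the factor `r`. (A map from `A` to `B` is smooth if it
is the restriction of a smooth map on an open neighbourhood of `A`.) -/
def IsHomothety (g : PseudoMetric E M) (f : M → ℝ) (A B : Set M) (r : ℝ) (φ : M → M) : Prop :=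
  ∃ (ψ : M → M) (U V : Set M), IsOpen U ∧ IsOpen V ∧ A ⊆ U ∧ B ⊆ V ∧
    ContMDiffOn 𝓘(ℝ, E) 𝓘(ℝ, E) ∞ φ U ∧ ContMDiffOn 𝓘(ℝ, E) 𝓘(ℝ, E) ∞ ψ V ∧
    MapsTo φ A B ∧ MapsTo ψ B A ∧ (∀ x ∈ A, ψ (φ x) = x) ∧ (∀ y ∈ B, φ (ψ y) = y) ∧
    ∀ x ∈ A, ∀ v w : TangentSpace 𝓘(ℝ, E) x,
      mvfderiv 𝓘(ℝ, E) f x v = 0 → mvfderiv 𝓘(ℝ, E) f x w = 0 →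
      g.val (φ x) (mfderiv 𝓘(ℝ, E) 𝓘(ℝ, E) φ x v) (mfderiv 𝓘(ℝ, E) 𝓘(ℝ, E) φ x w)
        = r * g.val x v w

end Metric

/-! ### Hypersymplectic manifolds and permuting actions -/

section Hyper

variable (n : ℕ) (E : Type*) [NormedAddCommGroup E] [NormedSpace ℝ E]
  (M : Type*) [TopologicalSpace M] [ChartedSpace E M] [IsManifold 𝓘(ℝ, E) ∞ M]

/-- A hypersymplectic structure `(g, I, S, T)` on a manifold `M` of dimension `4n`. -/
structure HypersymplecticStructure where
  g : PseudoMetric E M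
  I : EndField E M
  S : EndField E M
  T : EndField E M
  finrank_eq : Module.finrank ℝ E = 4 * n
  /-- The metric has signature `(2n, 2n)`. -/
  neutral : ∀ x : M, ∃ P N : Submodule ℝ (TangentSpace 𝓘(ℝ, E) x), IsCompl P N ∧
    Module.finrank ℝ P = 2 * n ∧ Module.finrank ℝ N = 2 * n ∧
    (∀ v ∈ P, v ≠ 0 → 0 < g.val x v v) ∧ (∀ v ∈ N, v ≠ 0 → g.val x v v < 0)
  I_sq : ∀ x v, I.val x (I.val x v) = -v
  S_sq : ∀ x v, S.val x (S.val x v) = v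
  T_sq : ∀ x v, T.val x (T.val x v) = v
  I_S : ∀ x v, I.val x (S.val x v) = T.val x v
  S_I : ∀ x v, S.val x (I.val x v) = -T.val x v
  g_I : ∀ x v w, g.val x (I.val x v) (I.val x w) = g.val x v w
  g_S : ∀ x v w, g.val x (S.val x v) (S.val x w) = -g.val x v w
  g_T : ∀ x v w, g.val x (T.val x v) (T.val x w) = -g.val x v w
  closed_I : IsClosedTwoForm fun x v w => g.val x (I.val x v) w
  closed_S : IsClosedTwoForm fun x v w => g.val x (S.val x v) w
  closed_T : IsClosedTwoForm fun x v w => g.val x (T.val x v) w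

variable {n E M}

/-- The endomorphism `𝕀_ξ = ξ₁ I + ξ₂ S + ξ₃ T`. -/
def HypersymplecticStructure.lam (H : HypersymplecticStructure n E M) (ξ : SplitQuaternion) (x : M) :
    TangentSpace 𝓘(ℝ, E) x →L[ℝ] TangentSpace 𝓘(ℝ, E) x :=
  ξ.imI • H.I.val x + ξ.imJ • H.S.val x + ξ.imK • H.T.val x

/-- The smooth function `f` is a potential for the endomorphism field `J`:
`½ d (J df) = g (J ·, ·)`, where `(J α)(v) = -α (J v)` for a 1-form `α`. -/
def IsPotentialFor (g : PseudoMetric E M) (J : EndField E M) (f : M → ℝ) : Prop :=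
  ∀ (x : M) (X Y : ∀ x : M, TangentSpace 𝓘(ℝ, E) x), SmoothFieldAt X x → SmoothFieldAt Y x →
    (1 / 2 : ℝ) * dOne (fun y v => -mvfderiv 𝓘(ℝ, E) f y (J.val y v)) X Y x
      = g.val x (J.val x (X x)) (Y x)

/-- A hypersymplectic potential is a smooth function which is simultaneously a potential for
`I`, `S` and `T`. -/
def IsHypersymplecticPotential (H : HypersymplecticStructure n E M) (f : M → ℝ) : Prop :=
  ContMDiff 𝓘(ℝ, E) 𝓘(ℝ, ℝ) ∞ f ∧
    IsPotentialFor H.g H.I f ∧ IsPotentialFor H.g H.S f ∧ IsPotentialFor H.g H.T f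

variable [MulAction Sp1 M]

variable (E M) in
/-- Smoothness of the action `Sp(1, 𝔹) × M → M`. Since `{|q|² > 0} ≅ Sp(1, 𝔹) × ℝ_{>0}` through
`q ↦ (q / |q|, |q|)`, it amounts to the smoothness of `(q, x) ↦ (q / |q|) • x` on
`{|q|² > 0} × M`, where `{|q|² > 0}` is an open set of `𝔹 = ℝ⁴`. -/
def IsSmoothAction : Prop :=
  ContMDiffOn (𝓘(ℝ, Fin 4 → ℝ).prod 𝓘(ℝ, E)) 𝓘(ℝ, E) ∞
    (fun p : (Fin 4 → ℝ) × M =>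
      normalize ((QuaternionAlgebra.equivTuple (-1 : ℝ) 0 1).symm p.1) • p.2)
    {p | 0 < pairing ((QuaternionAlgebra.equivTuple (-1 : ℝ) 0 1).symm p.1)
      ((QuaternionAlgebra.equivTuple (-1 : ℝ) 0 1).symm p.1)}

/-- The differential at `x` of the transformation `y ↦ q • y`. -/
def push (q : Sp1) (x : M) : TangentSpace 𝓘(ℝ, E) x →L[ℝ] TangentSpace 𝓘(ℝ, E) (q • x) :=
  mfderiv 𝓘(ℝ, E) 𝓘(ℝ, E) (fun y : M => q • y) x

/-- A smooth isometric action of `Sp(1, 𝔹)` is permuting if the induced action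
`q · J = q_* J q_*⁻¹` on the endomorphisms `𝕀_ξ` is the standard one: `q · 𝕀_ξ = 𝕀_{q ξ q⁻¹}`. -/
structure IsPermutingAction (H : HypersymplecticStructure n E M) : Prop where
  smooth : IsSmoothAction E M
  isometric : ∀ (q : Sp1) (x : M) (v w : TangentSpace 𝓘(ℝ, E) x),
    H.g.val (q • x) (push q x v) (push q x w) = H.g.val x v w
  permuting : ∀ (q : Sp1) (ξ : SplitQuaternion), ξ.re = 0 →
    ∀ (x : M) (v : TangentSpace 𝓘(ℝ, E) x),
      push q x (H.lam ξ x v)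
        = H.lam ((q : SplitQuaternion) * ξ * star (q : SplitQuaternion)) (q • x) (push q x v)

variable (E) in
/-- The fundamental vector field `K_ξ` of an imaginary split quaternion `ξ`: its value at `x` is the
velocity at `τ = 0` of `c(τ) • x`, where `c(τ) = (1 + τ ξ) / |1 + τ ξ|` is a curve in `Sp(1, 𝔹)`
through `1` with velocity `ξ`. -/
def fundamentalField (ξ : SplitQuaternion) : ∀ x : M, TangentSpace 𝓘(ℝ, E) x :=
  fun x => (mfderiv 𝓘(ℝ, ℝ) 𝓘(ℝ, E) (fun τ : ℝ => normalize (1 + τ • ξ) • x) 0 (1 : ℝ) : E)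

variable (H : HypersymplecticStructure n E M)

/-- `(ι ω)(ξ, ξ') = g (𝕀_ξ K_ξ', ·)`. -/
def iotaOmega (ξ ξ' : SplitQuaternion) (x : M) : TangentSpace 𝓘(ℝ, E) x →L[ℝ] ℝ :=
  H.g.val x (H.lam ξ x (fundamentalField E ξ' x))

/-- The alternating part of `ι ω`. -/
def altIotaOmega (ξ ξ' : SplitQuaternion) (x : M) : TangentSpace 𝓘(ℝ, E) x →L[ℝ] ℝ :=
  (1 / 2 : ℝ) • (iotaOmega H ξ ξ' x - iotaOmega H ξ' ξ x)

/-- The alternating part of `ι ω` seen as a 1-form with values in the dual of the Lie algebra, by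
`γ₁ [ξ, ξ'] = altIotaOmega ξ ξ'`; recall `[s, t] = -2 i`, `[t, i] = 2 s`, `[i, s] = 2 t`. -/
def gammaOne (ξ : SplitQuaternion) (x : M) : TangentSpace 𝓘(ℝ, E) x →L[ℝ] ℝ :=
  (-(ξ.imI / 2)) • altIotaOmega H unitS unitT x + (ξ.imJ / 2) • altIotaOmega H unitT unitI x
    + (ξ.imK / 2) • altIotaOmega H unitI unitS x

/-- `ρ = ι γ₁`. -/
def rho (ξ ξ' : SplitQuaternion) (x : M) : ℝ := gammaOne H ξ x (fundamentalField E ξ' x)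

/-- `ρ₀ = ⅓ tr ρ`, the trace being taken with respect to the inner product `⟨·,·⟩` of the
imaginary split quaternions, for which `i`, `s`, `t` are orthogonal of square norms `1, -1, -1`. -/
def rhoZero (x : M) : ℝ :=
  (1 / 3 : ℝ) * (rho H unitI unitI x - rho H unitS unitS x - rho H unitT unitT x)

/-- `ρ₂`, the trace free symmetric part of `ρ`. -/
def rhoTwo (ξ ξ' : SplitQuaternion) (x : M) : ℝ :=
  (1 / 2 : ℝ) * (rho H ξ ξ' x + rho H ξ' ξ x) - rhoZero H x * pairing ξ ξ'

end Hyper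

end Hypersymplectic

end

/-! Everything follows from the one-form `γ₁`. Because the action is permuting, pulling `ω_ξ = g(𝕀_ξ
·, ·)` back by `q` gives `ω_(q̄ξq)`, so `L_(K_ζ) ω_ξ = ω_[ξ,ζ]` (`lieForm_omega`). Cartan's formula
and the closedness of the forms then give `dγ₁(η) = ω_η` for `η = i, s, t` (`dOne_dualField`). As
`γ₁(η)` is invariant under the subgroup that fixes `η`, Cartan's formula also yields `dρ(η, η) =
-g(𝕀_η K_η, ·)` (`mvfderiv_rho`).

If `ρ₂ = 0`, then `ρ(η, η) = ⟨η, η⟩ ρ₀`, so the three fields `𝕀_η K_η` are all multiples of one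
gradient `𝓔`. Since `𝕀_η² = -⟨η, η⟩`, this says `𝕀_η 𝓔 = K_η` (`lam_euler`). Consequently `γ₁(η) = ½
g(𝕀_η 𝓔, ·)` and `ρ₀ = ½ g(𝓔, 𝓔)`, and `dγ₁(η) = ω_η` becomes the potential equation. A zero of `𝓔`
would be a zero of `K_i`, hence fixed by `-1`, which freeness forbids.

The same equation says `L_𝓔 ω_η = 2 ω_η`. The endomorphism `I` is a quotient of two of these forms,
so `L_𝓔 I = 0`, and then `L_𝓔 g = 2g` (`lieForm_metric_euler`). Since `𝓔` is a gradient, `g(∇𝓔, ·)`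
is symmetric, and `L_𝓔 g = 2g` forces `∇𝓔 = id`.

Incompleteness: along a geodesic with `γ'(0) = 𝓔`, the field `𝓔 - (1 + s) γ'` is parallel and
vanishes at `s = 0`, hence everywhere; at `s = -1` the field `𝓔` would have a zero. Homotheties:
integrating `L_𝓔 g = 2g` and `dρ₀(𝓔) = 2ρ₀` along the flow produces the factors `e^{2t}`.

The analytic groundwork consists of smooth dependence of flows on initial values, by the implicit
function theorem in a space of curves, and the identification of the Lie derivative with the
derivative of pull-backs (`IsFlowGerm.hasDerivAt_pullback`). -/

noncomputable section

namespace Hypersymplectic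

/-! ### Smooth dependence of solutions of an ordinary differential equation on the initial value -/

section Superposition

universe u

variable {K : Type*} [TopologicalSpace K] [CompactSpace K]
  {E : Type u} [NormedAddCommGroup E] [NormedSpace ℝ E]

set_option synthInstance.maxHeartbeats 100000 in
scoped instance normedAddCommGroupOperatorFamilies {F : Type u} [NormedAddCommGroup F] [NormedSpace ℝ F] :
    NormedAddCommGroup C(K, E →L[ℝ] F) := inferInstance

set_option synthInstance.maxHeartbeats 100000 in
scoped instance normedSpaceOperatorFamilies {F : Type u} [NormedAddCommGroup F] [NormedSpace ℝ F] :
    NormedSpace ℝ C(K, E →L[ℝ] F) := inferInstance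

variable (K) in
/-- Pointwise application of a family of operators, as a continuous linear map. -/
def pointwiseApply {F : Type u} [NormedAddCommGroup F] [NormedSpace ℝ F] :
    C(K, E →L[ℝ] F) →L[ℝ] C(K, E) →L[ℝ] C(K, F) :=
  LinearMap.mkContinuous₂
    (LinearMap.mk₂ ℝ (fun (A : C(K, E →L[ℝ] F)) (h : C(K, E)) =>
        (⟨fun k => A k (h k), by fun_prop⟩ : C(K, F)))
      (fun _ _ _ => by ext; simp) (fun _ _ _ => by ext; simp) (fun _ _ _ => by ext; simp)
      (fun _ _ _ => by ext; simp)) 1 (fun A h => by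
        rw [ContinuousMap.norm_le _ (by positivity), one_mul]
        intro k
        exact (A k).le_of_opNorm_le_of_le (A.norm_coe_le_norm k) (h.norm_coe_le_norm k))

variable (K) in
/-- The superposition operator `c ↦ f ∘ c`. -/
def superposition {F : Type u} [NormedAddCommGroup F] (f : C(E, F)) (c : C(K, E)) : C(K, F) :=
  f.comp c

/-- The mean value inequality is applied pointwise on the segment from `c k` to `c k + v k`.
Uniformity in `k` comes from continuity of the superposition operator of `f'` at `c`, so `E` need
not be locally compact. -/
theorem hasFDerivAt_superposition {F : Type u} [NormedAddCommGroup F] [NormedSpace ℝ F]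
    (f : C(E, F)) (f' : C(E, E →L[ℝ] F)) (hf : ∀ x, HasFDerivAt f (f' x) x) (c : C(K, E)) :
    HasFDerivAt (superposition K f) (pointwiseApply K (superposition K f' c)) c := by
  rw [hasFDerivAt_iff_isLittleO_nhds_zero, Asymptotics.isLittleO_iff]
  intro ε hε
  have hcont : Continuous (fun h : C(K, E) => superposition K f' (c + h)) :=
    (ContinuousMap.continuous_postcomp f').comp (continuous_const.add continuous_id)
  have h0 := Metric.continuousAt_iff.1 (hcont.continuousAt (x := 0)) ε hε
  obtain ⟨δ, hδ, h⟩ := h0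
  filter_upwards [Metric.ball_mem_nhds (0 : C(K, E)) hδ] with v hv
  rw [ContinuousMap.norm_le _ (by positivity)]
  intro k
  -- Perturbing `c` by the constant curve `w - c k`, of norm at most `‖v‖`, and evaluating the
  -- uniform estimate `h` at `k` bounds `f' w - f' (c k)`.
  have key : ∀ w ∈ segment ℝ (c k) (c k + v k), ‖f' w - f' (c k)‖ ≤ ε := by
    intro w hw
    have hw' : ‖w - c k‖ ≤ ‖v‖ := by
      have := norm_sub_le_of_mem_segment hw
      simp only [add_sub_cancel_left] at this
      exact this.trans (v.norm_coe_le_norm k)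
    have hlt : dist (ContinuousMap.const K (w - c k)) 0 < δ := by
      rw [dist_zero_right]
      refine lt_of_le_of_lt ?_ (mem_ball_zero_iff.1 hv)
      rw [ContinuousMap.norm_le _ (norm_nonneg _)]
      exact fun _ => hw'
    have h1 := h hlt
    rw [dist_eq_norm] at h1
    have h2 := (ContinuousMap.norm_coe_le_norm _ k).trans h1.le
    simpa [superposition] using h2
  have hm := (convex_segment (c k) (c k + v k)).norm_image_sub_le_of_norm_hasFDerivWithin_le'
    (f := f) (f' := fun w => f' w) (φ := f' (c k)) (C := ε) (x := c k) (y := c k + v k)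
    (fun w _ => (hf w).hasFDerivWithinAt) key (left_mem_segment ℝ _ _) (right_mem_segment ℝ _ _)
  simp only [add_sub_cancel_left] at hm
  change ‖f (c k + v k) - f (c k) - f' (c k) (v k)‖ ≤ ε * ‖v‖
  exact hm.trans (mul_le_mul_of_nonneg_left (v.norm_coe_le_norm k) hε.le)

/-- Up to a bounded linear map, the derivative is the superposition operator of `fderiv ℝ f`, so
smoothness climbs one order at a time. The induction runs over all targets `F` because that operator
has values in `C(K, E →L[ℝ] F)`. -/
theorem contDiff_superposition_nat (n : ℕ) : ∀ {F : Type u} [NormedAddCommGroup F]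
    [NormedSpace ℝ F] (f : C(E, F)), ContDiff ℝ ∞ f → ContDiff ℝ n (superposition K f) := by
  induction n with
  | zero =>
    intro F _ _ f _
    exact contDiff_zero.2 (ContinuousMap.continuous_postcomp f)
  | succ n ih =>
    intro F _ _ f hf
    have hf' : ContDiff ℝ ∞ (fderiv ℝ f) := hf.fderiv_right (by simp)
    refine contDiff_succ_iff_hasFDerivAt.2
      ⟨fun c => pointwiseApply K (superposition K ⟨fderiv ℝ f, hf'.continuous⟩ c), ?_, ?_⟩
    · exact (pointwiseApply K).contDiff.comp
        (ih (⟨fderiv ℝ f, hf'.continuous⟩ : C(E, E →L[ℝ] F)) hf')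
    · exact hasFDerivAt_superposition f _
        fun x => (hf.differentiable (by simp)).differentiableAt.hasFDerivAt

theorem contDiff_superposition {F : Type u} [NormedAddCommGroup F]
    [NormedSpace ℝ F] (f : C(E, F)) (hf : ContDiff ℝ ∞ f) : ContDiff ℝ ∞ (superposition K f) :=
  contDiff_infty.2 fun n => contDiff_superposition_nat n f hf

end Superposition

end Hypersymplectic
end

noncomputable section

namespace Hypersymplectic

/-! ### The local flow as an implicit function in a space of curves -/

section LocalFlow

variable {E : Type*} [NormedAddCommGroup E] [NormedSpace ℝ E]

variable (E) in
/-- The operator `c ↦ ∫₀ᵗ c` on `C([0,1], E)`. -/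
def primitive : C(Icc (0 : ℝ) 1, E) →L[ℝ] C(Icc (0 : ℝ) 1, E) :=
  LinearMap.mkContinuous
    { toFun := fun c => ⟨fun t => ∫ s in (0 : ℝ)..t, IccExtend zero_le_one c s,
        (intervalIntegral.continuous_primitive
          (fun a b => (c.continuous.Icc_extend' (h := zero_le_one)).intervalIntegrable a b) 0).comp
          continuous_subtype_val⟩
      map_add' := fun c d => by
        ext t
        have hc := (c.continuous.Icc_extend' (h := zero_le_one)).intervalIntegrable
          (μ := MeasureTheory.volume) 0 t
        have hd := (d.continuous.Icc_extend' (h := zero_le_one)).intervalIntegrable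
          (μ := MeasureTheory.volume) 0 t
        exact intervalIntegral.integral_add hc hd
      map_smul' := fun r c => by
        ext t
        exact intervalIntegral.integral_smul r _ } 1 (fun c => by
      rw [ContinuousMap.norm_le _ (by positivity), one_mul]
      intro t
      have h := intervalIntegral.norm_integral_le_of_norm_le_const (a := 0) (b := t) (C := ‖c‖)
        (f := IccExtend zero_le_one c) (fun s _ => c.norm_coe_le_norm _)
      refine h.trans ?_
      rw [sub_zero, abs_of_nonneg t.2.1]
      exact mul_le_of_le_one_right (norm_nonneg _) t.2.2)

theorem primitive_apply (c : C(Icc (0 : ℝ) 1, E)) (t : Icc (0 : ℝ) 1) :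
    primitive E c t = ∫ s in (0 : ℝ)..t, IccExtend zero_le_one c s := rfl

theorem norm_primitive_le : ‖primitive E‖ ≤ 1 := LinearMap.mkContinuous_norm_le _ (by simp) _

variable (E) in
/-- Constant curves. -/
def constCurve : E →L[ℝ] C(Icc (0 : ℝ) 1, E) :=
  LinearMap.mkContinuous
    { toFun := fun x => ContinuousMap.const _ x
      map_add' := fun _ _ => rfl
      map_smul' := fun _ _ => rfl } 1 (fun x => by
      rw [ContinuousMap.norm_le _ (by positivity), one_mul]
      exact fun _ => le_rfl)

/-- The integral equation, at `((x, τ), c)`, of curves `c` with `c 0 = x` and `c' = τ • f ∘ c`. -/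
def integralEquation (f : C(E, E)) (p : (E × ℝ) × C(Icc (0 : ℝ) 1, E)) : C(Icc (0 : ℝ) 1, E) :=
  p.2 - constCurve E p.1.1 - p.1.2 • primitive E (superposition _ f p.2)

theorem contDiff_integralEquation (f : C(E, E)) (hf : ContDiff ℝ ∞ f) :
    ContDiff ℝ ∞ (integralEquation f) := by
  have h1 : ContDiff ℝ ∞ (fun p : (E × ℝ) × C(Icc (0 : ℝ) 1, E) =>
      primitive E (superposition _ f p.2)) :=
    (primitive E).contDiff.comp ((contDiff_superposition f hf).comp contDiff_snd)
  have h2 : ContDiff ℝ ∞ (fun p : (E × ℝ) × C(Icc (0 : ℝ) 1, E) => constCurve E p.1.1) :=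
    (constCurve E).contDiff.comp (contDiff_fst.comp contDiff_fst)
  exact (contDiff_snd.sub h2).sub ((contDiff_snd.comp contDiff_fst).smul h1)

theorem isInvertible_id_sub [CompleteSpace E] (T : E →L[ℝ] E) (hT : ‖T‖ < 1) :
    (ContinuousLinearMap.id ℝ E - T).IsInvertible := by
  obtain ⟨u, hu⟩ := isUnit_one_sub_of_norm_lt_one hT
  exact ⟨ContinuousLinearEquiv.unitsEquiv ℝ E u, by rw [← ContinuousLinearMap.one_def, ← hu]; rfl⟩

/-- The partial derivative in the curve is `id - τ • (P ∘ S)`, where `P` is the primitive, of norm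
at most 1, and `S` is multiplication by `f'` along the curve. The condition `|τ| * C < 1` makes it
invertible by a Neumann series. -/
theorem isInvertible_fderiv_integralEquation [CompleteSpace E] (f : C(E, E))
    (hf : ContDiff ℝ ∞ f) (f' : C(E, E →L[ℝ] E)) (hf' : ∀ x, HasFDerivAt f (f' x) x)
    (p : (E × ℝ) × C(Icc (0 : ℝ) 1, E)) {C : ℝ} (hC : 0 ≤ C) (hb : ∀ s, ‖f' (p.2 s)‖ ≤ C)
    (hp : |p.1.2| * C < 1) :
    (fderiv ℝ (integralEquation f) p ∘L .inr ℝ (E × ℝ) C(Icc (0 : ℝ) 1, E)).IsInvertible := by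
  set S := pointwiseApply (Icc (0 : ℝ) 1) (superposition _ f' p.2) with hS
  have h1 : HasFDerivAt (fun c => integralEquation f (p.1, c))
      (fderiv ℝ (integralEquation f) p ∘L .inr ℝ (E × ℝ) C(Icc (0 : ℝ) 1, E)) p.2 :=
    HasFDerivAt.comp p.2 (((contDiff_integralEquation f hf).differentiable
      (by simp)).differentiableAt.hasFDerivAt) (hasFDerivAt_prodMk_right p.1 p.2)
  have h2 : HasFDerivAt (fun c => integralEquation f (p.1, c))
      (ContinuousLinearMap.id ℝ _ - p.1.2 • ((primitive E).comp S)) p.2 :=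
    ((hasFDerivAt_id p.2).sub_const (constCurve E p.1.1)).sub
      (((primitive E).hasFDerivAt.comp p.2 (hasFDerivAt_superposition f f' hf' p.2)).const_smul
        p.1.2)
  rw [h1.unique h2]
  apply isInvertible_id_sub
  refine lt_of_le_of_lt (ContinuousLinearMap.opNorm_le_bound _ (by positivity) fun h => ?_) hp
  have hSn : ‖S h‖ ≤ C * ‖h‖ := by
    rw [ContinuousMap.norm_le _ (by positivity)]
    exact fun k => (f' (p.2 k)).le_of_opNorm_le_of_le (hb k) (h.norm_coe_le_norm k)
  change ‖p.1.2 • primitive E (S h)‖ ≤ _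
  rw [norm_smul, Real.norm_eq_abs, mul_assoc]
  exact mul_le_mul_of_nonneg_left
    (((primitive E).le_of_opNorm_le norm_primitive_le _).trans (by rwa [one_mul])) (abs_nonneg _)

/-- A smooth vector field on a Banach space has a smooth local flow. -/
theorem exists_contDiffOn_localFlow [CompleteSpace E] {f : E → E} (hf : ContDiff ℝ ∞ f) (x₀ : E) :
    ∃ r > (0 : ℝ), ∃ ε > (0 : ℝ), ∃ α : E × ℝ → E,
      (∀ x ∈ Metric.ball x₀ r, α (x, 0) = x ∧
        ∀ t ∈ Ioo (-ε) ε, HasDerivAt (fun s => α (x, s)) (f (α (x, t))) t) ∧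
      ContDiffOn ℝ ∞ α (Metric.ball x₀ r ×ˢ Ioo (-ε) ε) := by
  obtain ⟨ε, hε, a, r, L, K, hr, hpl⟩ :=
    IsPicardLindelof.of_contDiffAt_one (hf.contDiffAt (x := x₀) |>.of_le (by simp))
  obtain ⟨α, hα, hcont⟩ := (hpl 0).exists_forall_mem_closedBall_eq_hasDerivWithinAt_continuousOn
  simp only [zero_sub, zero_add] at hα hcont
  have hd : ∀ x ∈ Metric.ball x₀ r, ∀ t ∈ Ioo (-ε) ε,
      HasDerivAt (fun s => α (x, s)) (f (α (x, t))) t := fun x hx t ht =>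
    ((hα x (Metric.ball_subset_closedBall hx)).2 t (Ioo_subset_Icc_self ht)).hasDerivAt
      (Icc_mem_nhds ht.1 ht.2)
  have hf' : ContDiff ℝ ∞ (fderiv ℝ f) := hf.fderiv_right (by simp)
  -- Any bound strictly above the value at `x₀` persists along the solutions near `(x₀, 0)`.
  set C := ‖fderiv ℝ f x₀‖ + 1 with hC
  have hCpos : 0 < C := by positivity
  have hO : IsOpen (Metric.ball x₀ (r : ℝ) ×ˢ Ioo (-ε) ε) := Metric.isOpen_ball.prod isOpen_Ioo
  have hmem : (x₀, (0 : ℝ)) ∈ Metric.ball x₀ (r : ℝ) ×ˢ Ioo (-ε) ε :=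
    ⟨Metric.mem_ball_self (by exact_mod_cast hr), by simp [hε]⟩
  have hcontO : ContinuousOn α (Metric.ball x₀ (r : ℝ) ×ˢ Ioo (-ε) ε) :=
    hcont.mono (prod_mono Metric.ball_subset_closedBall Ioo_subset_Icc_self)
  have hα0 : α (x₀, 0) = x₀ := (hα x₀ (by simp)).1
  have hev : ∀ᶠ p in 𝓝 (x₀, (0 : ℝ)), ‖fderiv ℝ f (α p)‖ < C := by
    have h1 : ContinuousAt (fun p => ‖fderiv ℝ f (α p)‖) (x₀, 0) :=
      (hf'.continuous.continuousAt.comp (hcontO.continuousAt (hO.mem_nhds hmem))).norm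
    exact h1.eventually_lt_const (by simp [hα0, hC])
  obtain ⟨δ, hδ, hball⟩ := Metric.eventually_nhds_iff_ball.1 (hev.and (hO.mem_nhds hmem))
  -- `δ` keeps the solutions in the region where `‖f'‖ < C`, and `C⁻¹` ensures `|τ| * C < 1`, which
  -- inverts the linearized equation.
  set η := min δ C⁻¹ with hη
  have hηpos : 0 < η := lt_min hδ (inv_pos.2 hCpos)
  set O : Set (E × ℝ) := Metric.ball x₀ δ ×ˢ Ioo (-η) η with hOdef
  have hOopen : IsOpen O := Metric.isOpen_ball.prod isOpen_Ioo
  have hin : ∀ p ∈ O, ∀ s ∈ Icc (0 : ℝ) 1, (p.1, p.2 * s) ∈ O := by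
    rintro ⟨x, τ⟩ ⟨hx, hτ⟩ s hs
    refine ⟨hx, ?_⟩
    have : |τ * s| < η := by
      rw [abs_mul, abs_of_nonneg hs.1]
      exact lt_of_le_of_lt (mul_le_of_le_one_right (abs_nonneg _) hs.2) (abs_lt.2 hτ)
    exact abs_lt.1 this
  have hOball : ∀ p ∈ O, p ∈ Metric.ball (x₀, (0 : ℝ)) δ := by
    rintro ⟨x, τ⟩ ⟨hx, hτ⟩
    rw [← ball_prod_same]
    refine ⟨hx, ?_⟩
    rw [Metric.mem_ball, dist_zero_right, Real.norm_eq_abs]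
    exact (abs_lt.2 hτ).trans_le (min_le_left _ _)
  have hOsub : O ⊆ Metric.ball x₀ (r : ℝ) ×ˢ Ioo (-ε) ε := fun p hp => (hball p (hOball p hp)).2
  -- the rescaled solutions form a continuous family of curves
  let G : C(O × Icc (0 : ℝ) 1, E) :=
    ⟨fun q => α (q.1.1.1, q.1.1.2 * q.2), (hcontO.mono hOsub).comp_continuous (by fun_prop)
      fun q => hin _ q.1.2 _ q.2.2⟩
  classical
  let c : E × ℝ → C(Icc (0 : ℝ) 1, E) := fun p => if h : p ∈ O then G.curry ⟨p, h⟩ else 0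
  have hc_apply : ∀ p ∈ O, ∀ s : Icc (0 : ℝ) 1, c p s = α (p.1, p.2 * s) := by
    intro p hp s
    simp only [c, dif_pos hp]
    rfl
  -- Currying turns joint continuity of the flow into continuity for the sup norm. This keeps `(q, c
  -- q)` near `(p, c p)`, where the implicit function is the only solution.
  have hc_cont : ContinuousOn c O := by
    rw [continuousOn_iff_continuous_domRestrict]
    convert G.curry.continuous using 1
    ext1 p
    simp [c, domRestrict, p.2]
  let F : C(E, E) := ⟨f, hf.continuous⟩
  have heq : ∀ p ∈ O, integralEquation F (p, c p) = 0 := by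
    intro p hp
    ext s
    have hint : ∀ σ ∈ uIcc (0 : ℝ) s, HasDerivAt (fun σ => α (p.1, p.2 * σ))
        (p.2 • f (α (p.1, p.2 * σ))) σ := by
      intro σ hσ
      rw [uIcc_of_le s.2.1] at hσ
      have h1 := hOsub (hin p hp σ ⟨hσ.1, hσ.2.trans s.2.2⟩)
      have h2 := hd p.1 h1.1 _ h1.2
      have h3 : HasDerivAt (fun σ : ℝ => p.2 * σ) p.2 σ := by
        simpa using (hasDerivAt_id σ).const_mul p.2
      exact h2.scomp σ h3
    have hco : ContinuousOn (fun σ => p.2 • f (α (p.1, p.2 * σ))) (uIcc (0 : ℝ) s) := by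
      refine (hf.continuous.comp_continuousOn ?_).const_smul _
      exact fun σ hσ => (hint σ hσ).continuousAt.continuousWithinAt
    have hI := intervalIntegral.integral_eq_sub_of_hasDerivAt hint hco.intervalIntegrable
    rw [intervalIntegral.integral_smul, mul_zero, (hα p.1
      (Metric.ball_subset_closedBall (hOsub hp).1)).1] at hI
    have hI2 : primitive E (superposition _ F (c p)) s
        = ∫ σ in (0 : ℝ)..s, f (α (p.1, p.2 * σ)) := by
      rw [primitive_apply]
      refine intervalIntegral.integral_congr fun σ hσ => ?_
      rw [uIcc_of_le s.2.1] at hσ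
      have hσ' : σ ∈ Icc (0 : ℝ) 1 := ⟨hσ.1, hσ.2.trans s.2.2⟩
      change IccExtend zero_le_one (superposition _ F (c p)) σ = _
      rw [IccExtend_of_mem _ _ hσ']
      exact congrArg f (hc_apply p hp ⟨σ, hσ'⟩)
    change c p s - p.1 - p.2 • primitive E (superposition _ F (c p)) s = 0
    rw [hI2, hI, hc_apply p hp]
    abel
  have hsmooth : ∀ p ∈ O, ContDiffAt ℝ ∞ α p := by
    intro p hp
    have cdf : ContDiffAt ℝ ∞ (integralEquation F) (p, c p) :=
      (contDiff_integralEquation F hf).contDiffAt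
    have hinv := isInvertible_fderiv_integralEquation F hf ⟨fderiv ℝ f, hf'.continuous⟩
      (fun x => (hf.differentiable (by simp)).differentiableAt.hasFDerivAt) (p, c p) hCpos.le
      (fun s => by
        change ‖fderiv ℝ f (c p s)‖ ≤ C
        rw [hc_apply p hp]
        exact (hball _ (hOball _ (hin p hp s s.2))).1.le)
      (by
        have h1 : |p.2| < C⁻¹ := (abs_lt.2 hp.2).trans_le (min_le_right _ _)
        calc |p.2| * C < C⁻¹ * C := mul_lt_mul_of_pos_right h1 hCpos
          _ = 1 := inv_mul_cancel₀ hCpos.ne')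
    have hψ := cdf.contDiffAt_implicitFunction (by simp) hinv
    have hun := cdf.eventually_apply_eq_iff_implicitFunction (by simp) hinv
    have htend : Filter.Tendsto (fun q => (q, c q)) (𝓝 p) (𝓝 (p, c p)) :=
      continuousAt_id.prodMk (hc_cont.continuousAt (hOopen.mem_nhds hp))
    -- Local uniqueness identifies `c` with the implicit function, and evaluating the rescaled curve
    -- at parameter 1 recovers `α (x, τ)`.
    have hevc : ∀ᶠ q in 𝓝 p, α q = cdf.implicitFunction (by simp) hinv q ⟨1, by simp⟩ := by
      filter_upwards [htend.eventually hun, hOopen.mem_nhds hp] with q hq hqO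
      rw [heq p hp, heq q hqO] at hq
      rw [hq.1 rfl, hc_apply q hqO]
      simp
    let ev : C(Icc (0 : ℝ) 1, E) →L[ℝ] E := ContinuousMap.evalCLM ℝ ⟨1, by simp⟩
    exact (ev.contDiff.contDiffAt.comp p hψ).congr_of_eventuallyEq hevc
  refine ⟨δ, hδ, η, hηpos, α, fun x hx => ⟨?_, fun t ht => ?_⟩,
    fun p hp => (hsmooth p hp).contDiffWithinAt⟩
  · exact (hα x (Metric.ball_subset_closedBall
      (hOsub (⟨hx, by simp [hηpos]⟩ : (x, (0 : ℝ)) ∈ O)).1)).1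
  · have := hOsub (⟨hx, ht⟩ : (x, t) ∈ O)
    exact hd x this.1 t this.2

end LocalFlow

end Hypersymplectic
end

noncomputable section

namespace Hypersymplectic

/-! ### Coordinates on the tangent bundle -/

section Coordinates

variable {E : Type*} [NormedAddCommGroup E] [NormedSpace ℝ E]
  {M : Type*} [TopologicalSpace M] [ChartedSpace E M] [IsManifold 𝓘(ℝ, E) ∞ M]

scoped instance isManifold_minSmoothness : IsManifold 𝓘(ℝ, E) (minSmoothness ℝ 2) M := by
  rw [minSmoothness_of_isRCLikeNormedField]
  infer_instance

omit [IsManifold 𝓘(ℝ, E) ∞ M] in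
theorem coordVec_smul (x₀ y : M) (r : ℝ) (v : TangentSpace 𝓘(ℝ, E) y) :
    coordVec x₀ y (r • v) = r • coordVec x₀ y v :=
  map_smul (mfderiv 𝓘(ℝ, E) 𝓘(ℝ, E) (extChartAt 𝓘(ℝ, E) x₀) y) r v

omit [IsManifold 𝓘(ℝ, E) ∞ M] in
theorem coordVec_zero (x₀ y : M) : coordVec x₀ y (0 : TangentSpace 𝓘(ℝ, E) y) = 0 :=
  map_zero (mfderiv 𝓘(ℝ, E) 𝓘(ℝ, E) (extChartAt 𝓘(ℝ, E) x₀) y)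

omit [IsManifold 𝓘(ℝ, E) ∞ M] in
theorem mfderiv_extChartAt_symm_eq {x₀ : M} {u : E} :
    mfderivWithin 𝓘(ℝ, E) 𝓘(ℝ, E) (extChartAt 𝓘(ℝ, E) x₀).symm (range 𝓘(ℝ, E)) u
      = mfderiv 𝓘(ℝ, E) 𝓘(ℝ, E) (extChartAt 𝓘(ℝ, E) x₀).symm u := by
  rw [modelWithCornersSelf_coe, range_id, mfderivWithin_univ]

theorem coordVec_coordField {x₀ y : M} (hy : y ∈ (chartAt E x₀).source) (w : E) :
    coordVec x₀ y (coordField x₀ w y) = w := by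
  have h := mfderiv_extChartAt_comp_mfderivWithin_extChartAt_symm' (I := 𝓘(ℝ, E)) (x := x₀)
    (y := y) (by simpa using hy)
  rw [mfderiv_extChartAt_symm_eq] at h
  exact congrArg (fun L : E →L[ℝ] E => L w) h

theorem coordField_coordVec {x₀ y : M} (hy : y ∈ (chartAt E x₀).source)
    (v : TangentSpace 𝓘(ℝ, E) y) : coordField x₀ (coordVec x₀ y v) y = v := by
  have h := mfderivWithin_extChartAt_symm_comp_mfderiv_extChartAt' (I := 𝓘(ℝ, E)) (x := x₀)
    (y := y) (by simpa using hy)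
  rw [mfderiv_extChartAt_symm_eq] at h
  exact congrArg (fun L : E →L[ℝ] E => L v) h

theorem coordVec_injective {x₀ y : M} (hy : y ∈ (chartAt E x₀).source)
    {v w : TangentSpace 𝓘(ℝ, E) y} (h : coordVec x₀ y v = coordVec x₀ y w) : v = w := by
  rw [← coordField_coordVec hy v, h, coordField_coordVec hy]

/-- Links the chart coordinates with the trivialization of the tangent bundle, through which
smoothness of sections is tested. -/
theorem coordVec_eq_trivializationAt {x₀ y : M} (hy : y ∈ (chartAt E x₀).source)
    (v : TangentSpace 𝓘(ℝ, E) y) :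
    (trivializationAt E (TangentSpace 𝓘(ℝ, E) : M → Type _) x₀ ⟨y, v⟩).2 = coordVec x₀ y v := by
  have h := TangentBundle.continuousLinearMapAt_trivializationAt (𝕜 := ℝ) (I := 𝓘(ℝ, E)) hy
  have h2 := congrArg (fun L : E →L[ℝ] E => L v) h
  refine Eq.trans ?_ h2
  exact (congrFun (Trivialization.coe_linearMapAt_of_mem (R := ℝ)
    (trivializationAt E (TangentSpace 𝓘(ℝ, E) : M → Type _) x₀) (b := y) (by simpa using hy)) v).symm

theorem smoothFieldAt_iff_coordVec {x₀ y : M} (hy : y ∈ (chartAt E x₀).source)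
    (X : ∀ x : M, TangentSpace 𝓘(ℝ, E) x) :
    SmoothFieldAt X y ↔ ContMDiffAt 𝓘(ℝ, E) 𝓘(ℝ, E) ∞ (fun z => coordVec x₀ z (X z)) y := by
  have h := (trivializationAt E (TangentSpace 𝓘(ℝ, E) : M → Type _) x₀).contMDiffAt_section_iff
    (IB := 𝓘(ℝ, E)) (n := ∞) (s := X) (x₀ := y) (by simpa using hy)
  refine h.trans (Filter.EventuallyEq.contMDiffAt_iff ?_)
  filter_upwards [(chartAt E x₀).open_source.mem_nhds hy] with z hz
  exact coordVec_eq_trivializationAt hz _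

theorem smoothFieldAt_coordField {x₀ y : M} (hy : y ∈ (chartAt E x₀).source) (w : E) :
    SmoothFieldAt (coordField x₀ w) y := by
  rw [smoothFieldAt_iff_coordVec hy]
  refine (contMDiffAt_const (c := w)).congr_of_eventuallyEq ?_
  filter_upwards [(chartAt E x₀).open_source.mem_nhds hy] with z hz
  exact coordVec_coordField hz w

theorem SmoothFieldAt.mdifferentiableAt {X : ∀ x : M, TangentSpace 𝓘(ℝ, E) x} {x : M}
    (h : SmoothFieldAt X x) : MDifferentiableAt 𝓘(ℝ, E) 𝓘(ℝ, E).tangent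
      (fun y => (⟨y, X y⟩ : TangentBundle 𝓘(ℝ, E) M)) x :=
  ContMDiffAt.mdifferentiableAt h (by simp)

theorem SmoothFieldAt.add {X Y : ∀ x : M, TangentSpace 𝓘(ℝ, E) x} {x : M}
    (hX : SmoothFieldAt X x) (hY : SmoothFieldAt Y x) : SmoothFieldAt (fun y => X y + Y y) x :=
  ContMDiffAt.add_section hX hY

theorem SmoothFieldAt.const_smul {X : ∀ x : M, TangentSpace 𝓘(ℝ, E) x} {x : M} (r : ℝ)
    (hX : SmoothFieldAt X x) : SmoothFieldAt (fun y => r • X y) x :=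
  ContMDiffAt.const_smul_section hX

theorem SmoothFieldAt.neg {X : ∀ x : M, TangentSpace 𝓘(ℝ, E) x} {x : M}
    (hX : SmoothFieldAt X x) : SmoothFieldAt (fun y => -X y) x :=
  ContMDiffAt.neg_section hX

theorem SmoothFieldAt.apply {X : ∀ x : M, TangentSpace 𝓘(ℝ, E) x} {x : M}
    (hX : SmoothFieldAt X x) (J : EndField E M) : SmoothFieldAt (fun y => J.val y (X y)) x :=
  ContMDiffAt.clm_bundle_apply (F₁ := E) (F₂ := E) (J.smooth x) hX

theorem SmoothFieldAt.contMDiffAt_metric {X Y : ∀ x : M, TangentSpace 𝓘(ℝ, E) x} {x : M}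
    (g : PseudoMetric E M) (hX : SmoothFieldAt X x) (hY : SmoothFieldAt Y x) :
    ContMDiffAt 𝓘(ℝ, E) 𝓘(ℝ, ℝ) ∞ (fun y => g.val y (X y) (Y y)) x := by
  have h := ContMDiffAt.clm_bundle_apply₂ (F₁ := E) (F₂ := E) (F₃ := ℝ)
    (E₃ := fun _ : M => ℝ) (b := fun y : M => y) (g.smooth x) hX hY
  rw [contMDiffAt_section] at h
  exact h

/-- Every tangent vector is the value of a smooth vector field. -/
theorem exists_smoothFieldAt {x : M} (v : TangentSpace 𝓘(ℝ, E) x) :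
    ∃ X : ∀ x : M, TangentSpace 𝓘(ℝ, E) x, SmoothFieldAt X x ∧ X x = v :=
  ⟨coordField x (coordVec x x v), smoothFieldAt_coordField (mem_chart_source E x) _,
    coordField_coordVec (mem_chart_source E x) v⟩

theorem coordVec_mfderiv {N : Type*} [TopologicalSpace N] {G : Type*} [NormedAddCommGroup G]
    [NormedSpace ℝ G] [ChartedSpace G N] {f : N → M} {p : N} {x₀ : M}
    (hf : MDifferentiableAt 𝓘(ℝ, G) 𝓘(ℝ, E) f p) (hp : f p ∈ (chartAt E x₀).source)
    (v : TangentSpace 𝓘(ℝ, G) p) :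
    coordVec x₀ (f p) (mfderiv 𝓘(ℝ, G) 𝓘(ℝ, E) f p v)
      = mvfderiv 𝓘(ℝ, G) (fun q => extChartAt 𝓘(ℝ, E) x₀ (f q)) p v :=
  (congrArg (fun L : G →L[ℝ] E => L v) (mfderiv_comp p
    (mdifferentiableAt_extChartAt (I := 𝓘(ℝ, E)) hp) hf)).symm

theorem mvfderiv_eq_fderiv {F G : Type*} [NormedAddCommGroup F] [NormedSpace ℝ F]
    [NormedAddCommGroup G] [NormedSpace ℝ G] (f : F → G) (x : F) :
    mvfderiv 𝓘(ℝ, F) f x = fderiv ℝ f x := by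
  ext v
  simp only [mvfderiv, mfderiv_eq_fderiv]
  rfl

/-- The coordinate expression of a vector field in the chart at `x₀`. -/
def inChart (x₀ : M) (X : ∀ x : M, TangentSpace 𝓘(ℝ, E) x) (u : E) : E :=
  coordVec x₀ ((extChartAt 𝓘(ℝ, E) x₀).symm u) (X ((extChartAt 𝓘(ℝ, E) x₀).symm u))

/-- The derivatives of a chart and of its inverse are mutually inverse, so the inverse occurring in
the pull-back is the derivative of the chart. -/
theorem mpullback_extChartAt_symm {x₀ : M} (X : ∀ x : M, TangentSpace 𝓘(ℝ, E) x) {u : E}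
    (hu : u ∈ (extChartAt 𝓘(ℝ, E) x₀).target) :
    VectorField.mpullback 𝓘(ℝ, E) 𝓘(ℝ, E) (extChartAt 𝓘(ℝ, E) x₀).symm X u = inChart x₀ X u := by
  have h1 := mfderiv_extChartAt_comp_mfderivWithin_extChartAt_symm (I := 𝓘(ℝ, E)) (x := x₀) hu
  have h2 := mfderivWithin_extChartAt_symm_comp_mfderiv_extChartAt (I := 𝓘(ℝ, E)) (x := x₀) hu
  rw [mfderiv_extChartAt_symm_eq] at h1 h2
  rw [VectorField.mpullback_apply, ContinuousLinearMap.inverse_eq h2 h1]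
  rfl

theorem contDiffAt_inChart {x₀ y : M} (hy : y ∈ (chartAt E x₀).source)
    {X : ∀ x : M, TangentSpace 𝓘(ℝ, E) x} (hX : SmoothFieldAt X y) :
    ContDiffAt ℝ ∞ (inChart x₀ X) (extChartAt 𝓘(ℝ, E) x₀ y) := by
  have h := (smoothFieldAt_iff_coordVec hy X).1 hX
  have hu : extChartAt 𝓘(ℝ, E) x₀ y ∈ (extChartAt 𝓘(ℝ, E) x₀).target :=
    (extChartAt 𝓘(ℝ, E) x₀).map_source (by simpa using hy)
  have hs : ContMDiffAt 𝓘(ℝ, E) 𝓘(ℝ, E) ∞ (extChartAt 𝓘(ℝ, E) x₀).symm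
      (extChartAt 𝓘(ℝ, E) x₀ y) :=
    (contMDiffOn_extChartAt_symm x₀).contMDiffAt ((isOpen_extChartAt_target x₀).mem_nhds hu)
  rw [← (extChartAt 𝓘(ℝ, E) x₀).left_inv (x := y) (by simpa using hy)] at h
  exact (h.comp (extChartAt 𝓘(ℝ, E) x₀ y) hs).contDiffAt

theorem mlieBracket_vectorSpace (V W : ∀ u : E, TangentSpace 𝓘(ℝ, E) u) :
    VectorField.mlieBracket 𝓘(ℝ, E) V W = VectorField.lieBracket ℝ V W := by
  rw [← VectorField.mlieBracketWithin_univ, VectorField.mlieBracketWithin_eq_lieBracketWithin]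
  exact VectorField.lieBracketWithin_univ

/-- Brackets are natural under pull-back by the inverse chart; this reduces them to derivatives of
coordinate expressions. -/
theorem coordVec_mlieBracket [CompleteSpace E] {x₀ y : M} (hy : y ∈ (chartAt E x₀).source)
    {X Y : ∀ x : M, TangentSpace 𝓘(ℝ, E) x} (hX : SmoothFieldAt X y) (hY : SmoothFieldAt Y y) :
    coordVec x₀ y (VectorField.mlieBracket 𝓘(ℝ, E) X Y y)
      = VectorField.lieBracket ℝ (inChart x₀ X) (inChart x₀ Y) (extChartAt 𝓘(ℝ, E) x₀ y) := by
  have hu : extChartAt 𝓘(ℝ, E) x₀ y ∈ (extChartAt 𝓘(ℝ, E) x₀).target :=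
    (extChartAt 𝓘(ℝ, E) x₀).map_source (by simpa using hy)
  have hinv : (extChartAt 𝓘(ℝ, E) x₀).symm (extChartAt 𝓘(ℝ, E) x₀ y) = y :=
    (extChartAt 𝓘(ℝ, E) x₀).left_inv (by simpa using hy)
  have hnhds := (isOpen_extChartAt_target (I := 𝓘(ℝ, E)) x₀).mem_nhds hu
  have hs : ContMDiffAt 𝓘(ℝ, E) 𝓘(ℝ, E) ∞ (extChartAt 𝓘(ℝ, E) x₀).symm
      (extChartAt 𝓘(ℝ, E) x₀ y) :=
    (contMDiffOn_extChartAt_symm x₀).contMDiffAt hnhds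
  have h := VectorField.mpullback_mlieBracket (𝕜 := ℝ) (I := 𝓘(ℝ, E)) (I' := 𝓘(ℝ, E))
    (f := (extChartAt 𝓘(ℝ, E) x₀).symm) (V := X) (W := Y) (x₀ := extChartAt 𝓘(ℝ, E) x₀ y) (n := 2)
    (by rw [hinv]; exact hX.mdifferentiableAt) (by rw [hinv]; exact hY.mdifferentiableAt)
    (hs.of_le (by norm_cast)) (by simp)
  rw [mpullback_extChartAt_symm _ hu] at h
  have e1 : ∀ Z : ∀ x : M, TangentSpace 𝓘(ℝ, E) x,
      VectorField.mpullback 𝓘(ℝ, E) 𝓘(ℝ, E) (extChartAt 𝓘(ℝ, E) x₀).symm Z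
        =ᶠ[𝓝 (extChartAt 𝓘(ℝ, E) x₀ y)] inChart x₀ Z := fun Z => by
    filter_upwards [hnhds] with u hu
    exact mpullback_extChartAt_symm _ hu
  rw [Filter.EventuallyEq.mlieBracket_vectorField_eq (e1 X) (e1 Y)] at h
  have e2 := congrFun (mlieBracket_vectorSpace (inChart x₀ X) (inChart x₀ Y))
    (extChartAt 𝓘(ℝ, E) x₀ y)
  refine Eq.trans ?_ (h.trans e2)
  rw [inChart, hinv]

end Coordinates

end Hypersymplectic
end

noncomputable section

namespace Hypersymplectic

/-! ### Lie derivatives along one-parameter families of maps -/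

section LieDerivative

variable {E : Type*} [NormedAddCommGroup E] [NormedSpace ℝ E]
  {M : Type*} [TopologicalSpace M] [ChartedSpace E M] [IsManifold 𝓘(ℝ, E) ∞ M]

/-- Symmetry of second derivatives exchanges the time derivative with the derivative in the
direction `w`. It is why differentiating the push-forward of a vector in time produces the
derivative of the velocity field. -/
theorem hasDerivAt_fderiv_swap {G : ℝ × E → E} {u₀ : E} (hG : ContDiffAt ℝ 2 G (0, u₀)) (w : E) :
    HasDerivAt (fun t : ℝ => fderiv ℝ G (t, u₀) (0, w))
      (fderiv ℝ (fun u => fderiv ℝ G (0, u) (1, 0)) u₀ w) 0 := by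
  have hsymm := hG.isSymmSndFDerivAt (by simp)
  have hd : HasFDerivAt (fderiv ℝ G) (fderiv ℝ (fderiv ℝ G) (0, u₀)) (0, u₀) :=
    ((hG.fderiv_right (m := 1) (by norm_num)).differentiableAt (by simp)).hasFDerivAt
  have h1 : HasDerivAt (fun t : ℝ => fderiv ℝ G (t, u₀))
      (fderiv ℝ (fderiv ℝ G) (0, u₀) (1, 0)) 0 :=
    hd.comp_hasDerivAt (0 : ℝ) ((hasDerivAt_id (0 : ℝ)).prodMk (hasDerivAt_const (0 : ℝ) u₀))
  have h2 : HasFDerivAt (fun u => fderiv ℝ G (0, u))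
      ((fderiv ℝ (fderiv ℝ G) (0, u₀)).comp (.inr ℝ ℝ E)) u₀ :=
    hd.comp u₀ (hasFDerivAt_prodMk_right (0 : ℝ) u₀)
  have h3 := h2.clm_apply (hasFDerivAt_const ((1, 0) : ℝ × E) u₀)
  have h4 := h1.clm_apply (hasDerivAt_const (0 : ℝ) ((0, w) : ℝ × E))
  rw [h3.fderiv]
  convert h4 using 1
  simpa using hsymm.eq (0, w) (1, 0)

theorem mvfderiv_eq_fderiv_extChartAt {F : Type*} [NormedAddCommGroup F] [NormedSpace ℝ F]
    {x₀ y : M} (hy : y ∈ (chartAt E x₀).source) {f : M → F}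
    (hf : MDifferentiableAt 𝓘(ℝ, E) 𝓘(ℝ, F) f y) (v : TangentSpace 𝓘(ℝ, E) y) :
    mvfderiv 𝓘(ℝ, E) f y v = fderiv ℝ (fun u => f ((extChartAt 𝓘(ℝ, E) x₀).symm u))
      (extChartAt 𝓘(ℝ, E) x₀ y) (coordVec x₀ y v) := by
  have hinv : (extChartAt 𝓘(ℝ, E) x₀).symm (extChartAt 𝓘(ℝ, E) x₀ y) = y :=
    (extChartAt 𝓘(ℝ, E) x₀).left_inv (by simpa using hy)
  have hu : extChartAt 𝓘(ℝ, E) x₀ y ∈ (extChartAt 𝓘(ℝ, E) x₀).target :=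
    (extChartAt 𝓘(ℝ, E) x₀).map_source (by simpa using hy)
  have hs : MDifferentiableAt 𝓘(ℝ, E) 𝓘(ℝ, E) (extChartAt 𝓘(ℝ, E) x₀).symm
      (extChartAt 𝓘(ℝ, E) x₀ y) :=
    ((contMDiffOn_extChartAt_symm (n := 1) x₀).contMDiffAt
      ((isOpen_extChartAt_target x₀).mem_nhds hu)).mdifferentiableAt (by simp)
  have h := congrArg (fun L : E →L[ℝ] F => L (coordVec x₀ y v))
    (mfderiv_comp_of_eq (I := 𝓘(ℝ, E)) hf hs hinv)
  rw [mfderiv_eq_fderiv] at h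
  refine Eq.trans ?_ h.symm
  have h2 : ∀ z, z = y → (mfderiv 𝓘(ℝ, E) 𝓘(ℝ, F) f z : E →L[ℝ] F)
      = (mfderiv 𝓘(ℝ, E) 𝓘(ℝ, F) f y : E →L[ℝ] F) := fun z hz => by rw [hz]
  refine Eq.trans ?_ (congrArg (fun L : E →L[ℝ] F => L (coordField x₀ (coordVec x₀ y v) y))
    (h2 _ hinv)).symm
  exact congrArg (fun w : E => (mfderiv 𝓘(ℝ, E) 𝓘(ℝ, F) f y : E →L[ℝ] F) w)
    (coordField_coordVec hy v).symm

theorem contDiffAt_comp_extChartAt_symm {F : Type*} [NormedAddCommGroup F] [NormedSpace ℝ F]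
    {x₀ y : M} (hy : y ∈ (chartAt E x₀).source) {f : M → F}
    (hf : ContMDiffAt 𝓘(ℝ, E) 𝓘(ℝ, F) ∞ f y) :
    ContDiffAt ℝ ∞ (fun u => f ((extChartAt 𝓘(ℝ, E) x₀).symm u)) (extChartAt 𝓘(ℝ, E) x₀ y) := by
  have hu : extChartAt 𝓘(ℝ, E) x₀ y ∈ (extChartAt 𝓘(ℝ, E) x₀).target :=
    (extChartAt 𝓘(ℝ, E) x₀).map_source (by simpa using hy)
  have hs : ContMDiffAt 𝓘(ℝ, E) 𝓘(ℝ, E) ∞ (extChartAt 𝓘(ℝ, E) x₀).symm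
      (extChartAt 𝓘(ℝ, E) x₀ y) :=
    (contMDiffOn_extChartAt_symm x₀).contMDiffAt ((isOpen_extChartAt_target x₀).mem_nhds hu)
  rw [← (extChartAt 𝓘(ℝ, E) x₀).left_inv (x := y) (by simpa using hy)] at hf
  exact (hf.comp (extChartAt 𝓘(ℝ, E) x₀ y) hs).contDiffAt

omit [IsManifold 𝓘(ℝ, E) ∞ M] in
theorem eventually_extChartAt_symm {x₀ y : M} (hy : y ∈ (chartAt E x₀).source) {p : M → Prop}
    (hp : ∀ᶠ z in 𝓝 y, p z) :
    ∀ᶠ u in 𝓝 (extChartAt 𝓘(ℝ, E) x₀ y), u ∈ (extChartAt 𝓘(ℝ, E) x₀).target ∧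
      p ((extChartAt 𝓘(ℝ, E) x₀).symm u) := by
  have hu : extChartAt 𝓘(ℝ, E) x₀ y ∈ (extChartAt 𝓘(ℝ, E) x₀).target :=
    (extChartAt 𝓘(ℝ, E) x₀).map_source (by simpa using hy)
  have hc : ContinuousAt (extChartAt 𝓘(ℝ, E) x₀).symm (extChartAt 𝓘(ℝ, E) x₀ y) :=
    continuousAt_extChartAt_symm'' hu
  rw [ContinuousAt, (extChartAt 𝓘(ℝ, E) x₀).left_inv (x := y) (by simpa using hy)] at hc
  exact Filter.Eventually.and ((isOpen_extChartAt_target x₀).mem_nhds hu) (hc.eventually hp)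

theorem mvfderiv_apply_eq_fderiv {x₀ y : M} (hy : y ∈ (chartAt E x₀).source) {f : M → ℝ}
    (hf : ContMDiffAt 𝓘(ℝ, E) 𝓘(ℝ, ℝ) ∞ f y) (Y : ∀ x : M, TangentSpace 𝓘(ℝ, E) x) :
    (fun u => mvfderiv 𝓘(ℝ, E) f ((extChartAt 𝓘(ℝ, E) x₀).symm u)
        (Y ((extChartAt 𝓘(ℝ, E) x₀).symm u))) =ᶠ[𝓝 (extChartAt 𝓘(ℝ, E) x₀ y)]
      fun u => fderiv ℝ (fun u => f ((extChartAt 𝓘(ℝ, E) x₀).symm u)) u (inChart x₀ Y u) := by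
  have h1 : ∀ᶠ z in 𝓝 y, ContMDiffAt 𝓘(ℝ, E) 𝓘(ℝ, ℝ) 1 f z :=
    (contMDiffAt_iff_contMDiffAt_nhds (by simp)).1 (hf.of_le (m := 1) (by simp))
  filter_upwards [eventually_extChartAt_symm hy h1] with u hu
  have hm : (extChartAt 𝓘(ℝ, E) x₀).symm u ∈ (chartAt E x₀).source := by
    simpa using (extChartAt 𝓘(ℝ, E) x₀).map_target hu.1
  rw [mvfderiv_eq_fderiv_extChartAt hm (hu.2.mdifferentiableAt (by simp)),
    (extChartAt 𝓘(ℝ, E) x₀).right_inv hu.1]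
  rfl

theorem SmoothFieldAt.contMDiffAt_mvfderiv {x : M} {f : M → ℝ}
    (hf : ContMDiffAt 𝓘(ℝ, E) 𝓘(ℝ, ℝ) ∞ f x) {Y : ∀ x : M, TangentSpace 𝓘(ℝ, E) x}
    (hY : SmoothFieldAt Y x) :
    ContMDiffAt 𝓘(ℝ, E) 𝓘(ℝ, ℝ) ∞ (fun y => mvfderiv 𝓘(ℝ, E) f y (Y y)) x := by
  have hx := mem_chart_source E x
  have h1 : ContDiffAt ℝ ∞ (fun u => fderiv ℝ (fun u => f ((extChartAt 𝓘(ℝ, E) x).symm u)) u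
      (inChart x Y u)) (extChartAt 𝓘(ℝ, E) x x) :=
    ((contDiffAt_comp_extChartAt_symm hx hf).fderiv_right (by simp)).clm_apply
      (contDiffAt_inChart hx hY)
  have h2 := h1.congr_of_eventuallyEq (mvfderiv_apply_eq_fderiv hx hf Y)
  have h3 := h2.contMDiffAt.comp x (contMDiffAt_extChartAt (I := 𝓘(ℝ, E)) (n := ∞) (x := x))
  refine h3.congr_of_eventuallyEq ?_
  filter_upwards [extChartAt_source_mem_nhds (I := 𝓘(ℝ, E)) x] with y hy
  exact congrArg (fun z => mvfderiv 𝓘(ℝ, E) f z (Y z)) ((extChartAt 𝓘(ℝ, E) x).left_inv hy).symm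

/-- In a chart the second derivatives of `f` cancel by symmetry, and the derivatives of the two
fields assemble into the bracket. -/
theorem mvfderiv_mvfderiv_sub [CompleteSpace E] {x : M} {f : M → ℝ}
    (hf : ContMDiffAt 𝓘(ℝ, E) 𝓘(ℝ, ℝ) ∞ f x) {X Y : ∀ x : M, TangentSpace 𝓘(ℝ, E) x}
    (hX : SmoothFieldAt X x) (hY : SmoothFieldAt Y x) :
    mvfderiv 𝓘(ℝ, E) (fun y => mvfderiv 𝓘(ℝ, E) f y (Y y)) x (X x)
      - mvfderiv 𝓘(ℝ, E) (fun y => mvfderiv 𝓘(ℝ, E) f y (X y)) x (Y x)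
      = mvfderiv 𝓘(ℝ, E) f x (VectorField.mlieBracket 𝓘(ℝ, E) X Y x) := by
  have hx := mem_chart_source E x
  set u₀ := extChartAt 𝓘(ℝ, E) x x with hu₀
  set f' := fun u => f ((extChartAt 𝓘(ℝ, E) x).symm u) with hf'
  have hfd : ContDiffAt ℝ ∞ f' u₀ := contDiffAt_comp_extChartAt_symm hx hf
  have hd : HasFDerivAt (fderiv ℝ f') (fderiv ℝ (fderiv ℝ f') u₀) u₀ :=
    ((hfd.fderiv_right (m := 1) (by norm_cast)).differentiableAt (by simp)).hasFDerivAt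
  have hsymm : IsSymmSndFDerivAt ℝ f' u₀ :=
    hfd.isSymmSndFDerivAt (by rw [minSmoothness_of_isRCLikeNormedField]; norm_cast)
  have hc : ∀ V : ∀ x : M, TangentSpace 𝓘(ℝ, E) x, coordVec x x (V x) = inChart x V u₀ :=
    fun V => congrArg (fun z => coordVec x z (V z)) (extChartAt_to_inv (I := 𝓘(ℝ, E)) x).symm
  have key : ∀ {V W : ∀ x : M, TangentSpace 𝓘(ℝ, E) x}, SmoothFieldAt V x → SmoothFieldAt W x →
      mvfderiv 𝓘(ℝ, E) (fun y => mvfderiv 𝓘(ℝ, E) f y (W y)) x (V x)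
        = fderiv ℝ f' u₀ (fderiv ℝ (inChart x W) u₀ (inChart x V u₀))
          + fderiv ℝ (fderiv ℝ f') u₀ (inChart x V u₀) (inChart x W u₀) := by
    intro V W hV hW
    rw [mvfderiv_eq_fderiv_extChartAt hx ((hW.contMDiffAt_mvfderiv hf).mdifferentiableAt (by simp)),
      (mvfderiv_apply_eq_fderiv hx hf W).fderiv_eq,
      (hd.clm_apply ((contDiffAt_inChart hx hW).differentiableAt (by simp)).hasFDerivAt).fderiv]
    rw [hc]
    simp
    rfl
  rw [key hX hY, key hY hX, mvfderiv_eq_fderiv_extChartAt hx (hf.mdifferentiableAt (by simp)),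
    coordVec_mlieBracket hx hX hY, VectorField.lieBracket, map_sub, hsymm.eq]
  abel

/-! ### Infinitesimal action of a family of maps on fields and bilinear forms -/

section Family

variable {F : ℝ → M → M} {x : M} {K X Y : ∀ x : M, TangentSpace 𝓘(ℝ, E) x}

/-- The family of maps `F` is smooth near `(0, x)`, with `F 0 = id` and velocity field `K`. -/
structure IsFlowGerm (F : ℝ → M → M) (K : ∀ x : M, TangentSpace 𝓘(ℝ, E) x) (x : M) : Prop where
  smooth : ContMDiffAt (𝓘(ℝ, ℝ).prod 𝓘(ℝ, E)) 𝓘(ℝ, E) ∞ (fun p : ℝ × M => F p.1 p.2) (0, x)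
  zero : ∀ᶠ y in 𝓝 x, F 0 y = y
  velocity : ∀ᶠ y in 𝓝 x, (mfderiv 𝓘(ℝ, ℝ) 𝓘(ℝ, E) (fun t => F t y) 0 (1 : ℝ) : E) = K y

/-- The coordinate expression of the family of maps `F` in the chart at `x`. -/
def familyInChart (F : ℝ → M → M) (x : M) (p : ℝ × E) : E :=
  extChartAt 𝓘(ℝ, E) x (F p.1 ((extChartAt 𝓘(ℝ, E) x).symm p.2))

theorem IsFlowGerm.contDiffAt_familyInChart (h : IsFlowGerm F K x) :
    ContDiffAt ℝ ∞ (familyInChart F x) (0, extChartAt 𝓘(ℝ, E) x x) := by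
  have h0 : F 0 x = x := h.zero.self_of_nhds
  have hs : ContMDiffAt 𝓘(ℝ, E) 𝓘(ℝ, E) ∞ (extChartAt 𝓘(ℝ, E) x).symm
      (extChartAt 𝓘(ℝ, E) x x) :=
    (contMDiffOn_extChartAt_symm x).contMDiffAt
      ((isOpen_extChartAt_target x).mem_nhds (mem_extChartAt_target x))
  have h1 : ContMDiffAt (𝓘(ℝ, ℝ).prod 𝓘(ℝ, E)) (𝓘(ℝ, ℝ).prod 𝓘(ℝ, E)) ∞
      (fun p : ℝ × E => (p.1, (extChartAt 𝓘(ℝ, E) x).symm p.2))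
      (0, extChartAt 𝓘(ℝ, E) x x) :=
    contMDiffAt_fst.prodMk (hs.comp (0, extChartAt 𝓘(ℝ, E) x x) contMDiffAt_snd)
  have h2 : ContMDiffAt (𝓘(ℝ, ℝ).prod 𝓘(ℝ, E)) 𝓘(ℝ, E) ∞
      (fun p : ℝ × E => F p.1 ((extChartAt 𝓘(ℝ, E) x).symm p.2)) (0, extChartAt 𝓘(ℝ, E) x x) :=
    ContMDiffAt.comp_of_eq h.smooth h1 (by simp)
  have h3 : ContMDiffAt (𝓘(ℝ, ℝ).prod 𝓘(ℝ, E)) 𝓘(ℝ, E) ∞ (familyInChart F x)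
      (0, extChartAt 𝓘(ℝ, E) x x) :=
    ContMDiffAt.comp_of_eq (contMDiffAt_extChartAt (I := 𝓘(ℝ, E)) (n := ∞) (x := x)) h2
      (by simp [h0])
  rw [← modelWithCornersSelf_prod, chartedSpaceSelf_prod] at h3
  exact h3.contDiffAt

omit [IsManifold 𝓘(ℝ, E) ∞ M] in
theorem IsFlowGerm.tendsto (h : IsFlowGerm F K x) :
    Filter.Tendsto (fun t => F t x) (𝓝 0) (𝓝 x) := by
  have h1 : ContinuousAt (fun p : ℝ × M => F p.1 p.2) (0, x) := h.smooth.continuousAt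
  have h2 : ContinuousAt (fun t : ℝ => F t x) 0 :=
    ContinuousAt.comp (f := fun t : ℝ => (t, x)) h1 (by fun_prop)
  have h0 : F 0 x = x := h.zero.self_of_nhds
  rwa [ContinuousAt, h0] at h2

omit [IsManifold 𝓘(ℝ, E) ∞ M] in
theorem IsFlowGerm.eventually_familyInChart_zero (h : IsFlowGerm F K x) :
    ∀ᶠ u in 𝓝 (extChartAt 𝓘(ℝ, E) x x), familyInChart F x (0, u) = u := by
  filter_upwards [eventually_extChartAt_symm (mem_chart_source E x) h.zero] with u hu
  rw [familyInChart, hu.2, (extChartAt 𝓘(ℝ, E) x).right_inv hu.1]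

theorem IsFlowGerm.eventually_mdifferentiableAt (h : IsFlowGerm F K x) :
    ∀ᶠ p in 𝓝 ((0 : ℝ), x), MDifferentiableAt (𝓘(ℝ, ℝ).prod 𝓘(ℝ, E)) 𝓘(ℝ, E)
      (fun p : ℝ × M => F p.1 p.2) p := by
  filter_upwards [(contMDiffAt_iff_contMDiffAt_nhds (by simp)).1
    (h.smooth.of_le (m := 1) (by simp))] with p hp
  exact hp.mdifferentiableAt (by simp)

theorem IsFlowGerm.eventually_fderiv_familyInChart (h : IsFlowGerm F K x) :
    ∀ᶠ u in 𝓝 (extChartAt 𝓘(ℝ, E) x x),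
      fderiv ℝ (familyInChart F x) (0, u) (1, 0) = inChart x K u := by
  have hd : ∀ᶠ u in 𝓝 (extChartAt 𝓘(ℝ, E) x x),
      DifferentiableAt ℝ (familyInChart F x) (0, u) := by
    have h1 := ((h.contDiffAt_familyInChart.of_le (m := 1) (by simp)).eventually (by simp))
    have h2 : ContinuousAt (fun u : E => ((0 : ℝ), u)) (extChartAt 𝓘(ℝ, E) x x) := by fun_prop
    filter_upwards [h2.eventually h1] with u hu
    exact hu.differentiableAt (by simp)
  have hm : ∀ᶠ y in 𝓝 x, MDifferentiableAt 𝓘(ℝ, ℝ) 𝓘(ℝ, E) (fun t => F t y) 0 := by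
    have h2 : ContinuousAt (fun y : M => ((0 : ℝ), y)) x := by fun_prop
    filter_upwards [h2.eventually h.eventually_mdifferentiableAt] with y hy
    exact MDifferentiableAt.comp (I' := 𝓘(ℝ, ℝ).prod 𝓘(ℝ, E)) (f := fun t : ℝ => (t, y)) 0 hy
      (mdifferentiableAt_id.prodMk mdifferentiableAt_const)
  filter_upwards [hd, eventually_extChartAt_symm (mem_chart_source E x)
    ((hm.and h.zero).and h.velocity)] with u hu ⟨hu1, ⟨hu2, hu3⟩, hu4⟩
  have hsrc : F 0 ((extChartAt 𝓘(ℝ, E) x).symm u) ∈ (chartAt E x).source := by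
    rw [hu3]
    simpa using (extChartAt 𝓘(ℝ, E) x).map_target hu1
  have e1 := coordVec_mfderiv hu2 hsrc (1 : ℝ)
  rw [mvfderiv_eq_fderiv] at e1
  have e2 : HasDerivAt (fun t : ℝ => familyInChart F x (t, u))
      (fderiv ℝ (familyInChart F x) (0, u) (1, 0)) 0 :=
    HasFDerivAt.comp_hasDerivAt (f := fun t : ℝ => (t, u)) (0 : ℝ) hu.hasFDerivAt
      ((hasDerivAt_id (0 : ℝ)).prodMk (hasDerivAt_const _ u))
  have e3 : fderiv ℝ (familyInChart F x) (0, u) (1, 0)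
      = fderiv ℝ (fun t : ℝ => familyInChart F x (t, u)) 0 1 := by
    rw [e2.hasFDerivAt.fderiv]; simp
  rw [e3]
  refine e1.symm.trans ?_
  have e4 : ∀ z (_ : z = (extChartAt 𝓘(ℝ, E) x).symm u) (w : E), coordVec x z w
      = coordVec x ((extChartAt 𝓘(ℝ, E) x).symm u) w := fun z hz w => by rw [hz]
  refine (e4 _ hu3 _).trans ?_
  exact congrArg (fun w : E => coordVec x ((extChartAt 𝓘(ℝ, E) x).symm u) w) hu4

/-- In a chart the velocity is a partial derivative of the smooth family. -/
theorem IsFlowGerm.smooth_velocity (h : IsFlowGerm F K x) : SmoothFieldAt K x := by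
  have hx := mem_chart_source E x
  have h1 : ContDiffAt ℝ ∞ (fun u => fderiv ℝ (familyInChart F x) (0, u) (1, 0))
      (extChartAt 𝓘(ℝ, E) x x) := by
    have h2 : ContDiffAt ℝ ∞ (fderiv ℝ (familyInChart F x)) (0, extChartAt 𝓘(ℝ, E) x x) :=
      h.contDiffAt_familyInChart.fderiv_right (by simp)
    exact (ContDiffAt.comp (f := fun u : E => ((0 : ℝ), u)) (extChartAt 𝓘(ℝ, E) x x) h2
      (contDiffAt_const.prodMk contDiffAt_id)).clm_apply contDiffAt_const
  have h3 : ContDiffAt ℝ ∞ (inChart x K) (extChartAt 𝓘(ℝ, E) x x) :=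
    h1.congr_of_eventuallyEq (h.eventually_fderiv_familyInChart.mono fun u hu => hu.symm)
  rw [smoothFieldAt_iff_coordVec hx]
  refine (h3.contMDiffAt.comp x
    (contMDiffAt_extChartAt (I := 𝓘(ℝ, E)) (n := ∞) (x := x))).congr_of_eventuallyEq ?_
  filter_upwards [extChartAt_source_mem_nhds (I := 𝓘(ℝ, E)) x] with y hy
  exact congrArg (fun z => coordVec x z (K z)) ((extChartAt 𝓘(ℝ, E) x).left_inv hy).symm

theorem IsFlowGerm.eventually_coordVec_mfderiv (h : IsFlowGerm F K x) :
    ∀ᶠ t in 𝓝 (0 : ℝ), F t x ∈ (chartAt E x).source ∧ ∀ v : TangentSpace 𝓘(ℝ, E) x,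
      coordVec x (F t x) (mfderiv 𝓘(ℝ, E) 𝓘(ℝ, E) (F t) x v)
        = fderiv ℝ (familyInChart F x) (t, extChartAt 𝓘(ℝ, E) x x) (0, coordVec x x v) := by
  have hx := mem_chart_source E x
  have hd : ∀ᶠ t in 𝓝 (0 : ℝ),
      DifferentiableAt ℝ (familyInChart F x) (t, extChartAt 𝓘(ℝ, E) x x) := by
    have h1 := ((h.contDiffAt_familyInChart.of_le (m := 1) (by simp)).eventually (by simp))
    have h2 : ContinuousAt (fun t : ℝ => (t, extChartAt 𝓘(ℝ, E) x x)) 0 := by fun_prop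
    filter_upwards [h2.eventually h1] with t ht
    exact ht.differentiableAt (by simp)
  have hm : ∀ᶠ t in 𝓝 (0 : ℝ), MDifferentiableAt 𝓘(ℝ, E) 𝓘(ℝ, E) (F t) x := by
    have h2 : ContinuousAt (fun t : ℝ => (t, x)) 0 := by fun_prop
    filter_upwards [h2.eventually h.eventually_mdifferentiableAt] with t ht
    exact MDifferentiableAt.comp (I' := 𝓘(ℝ, ℝ).prod 𝓘(ℝ, E)) (f := fun y : M => (t, y)) x ht
      (mdifferentiableAt_const.prodMk mdifferentiableAt_id)
  filter_upwards [hd, hm, h.tendsto.eventually ((chartAt E x).open_source.mem_nhds hx)]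
    with t ht1 ht2 ht3
  refine ⟨ht3, fun v => ?_⟩
  rw [coordVec_mfderiv ht2 ht3 v]
  have hm2 : MDifferentiableAt 𝓘(ℝ, E) 𝓘(ℝ, E) (fun q => extChartAt 𝓘(ℝ, E) x (F t q)) x :=
    MDifferentiableAt.comp x (mdifferentiableAt_extChartAt (I := 𝓘(ℝ, E)) ht3) ht2
  rw [mvfderiv_eq_fderiv_extChartAt hx hm2]
  have e2 : HasFDerivAt (fun u : E => familyInChart F x (t, u))
      ((fderiv ℝ (familyInChart F x) (t, extChartAt 𝓘(ℝ, E) x x)).comp (.inr ℝ ℝ E))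
      (extChartAt 𝓘(ℝ, E) x x) :=
    ht1.hasFDerivAt.comp _ (hasFDerivAt_prodMk_right t (extChartAt 𝓘(ℝ, E) x x))
  have e3 := congrArg (fun L : E →L[ℝ] E => L (coordVec x x v)) e2.fderiv
  exact e3.trans (by simp)

/-- The coordinates of `(F_t)_* X` form a curve whose derivative is that of the velocity field. -/
theorem IsFlowGerm.hasDerivAt_coordVec_mfderiv (h : IsFlowGerm F K x)
    (v : TangentSpace 𝓘(ℝ, E) x) :
    HasDerivAt (fun t => coordVec x (F t x) (mfderiv 𝓘(ℝ, E) 𝓘(ℝ, E) (F t) x v))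
      (fderiv ℝ (inChart x K) (extChartAt 𝓘(ℝ, E) x x) (coordVec x x v)) 0 := by
  have h1 := hasDerivAt_fderiv_swap (h.contDiffAt_familyInChart.of_le (m := 2) (by norm_cast))
    (coordVec x x v)
  have e : (fun u => fderiv ℝ (familyInChart F x) (0, u) (1, 0))
      =ᶠ[𝓝 (extChartAt 𝓘(ℝ, E) x x)] inChart x K := h.eventually_fderiv_familyInChart
  rw [e.fderiv_eq] at h1
  refine h1.congr_of_eventuallyEq ?_
  filter_upwards [h.eventually_coordVec_mfderiv] with t ht
  exact ht.2 v

theorem IsFlowGerm.hasDerivAt_extChartAt (h : IsFlowGerm F K x) :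
    HasDerivAt (fun t => extChartAt 𝓘(ℝ, E) x (F t x)) (coordVec x x (K x)) 0 := by
  have h1 := HasFDerivAt.comp_hasDerivAt (f := fun t : ℝ => (t, extChartAt 𝓘(ℝ, E) x x)) (0 : ℝ)
    (h.contDiffAt_familyInChart.differentiableAt (by simp)).hasFDerivAt ((hasDerivAt_id (0 : ℝ)).prodMk (hasDerivAt_const _ (extChartAt 𝓘(ℝ, E) x x)))
  have h2 := h.eventually_fderiv_familyInChart.self_of_nhds
  rw [inChart, extChartAt_to_inv] at h2
  have h3 := h2 ▸ h1
  refine h3.congr_of_eventuallyEq (Filter.Eventually.of_forall fun t => ?_)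
  simp [familyInChart]

/-- A field of bilinear forms, smooth when evaluated on smooth vector fields. -/
def IsSmoothForm (β : ∀ x : M, TangentSpace 𝓘(ℝ, E) x →L[ℝ] TangentSpace 𝓘(ℝ, E) x →L[ℝ] ℝ) :
    Prop :=
  ∀ (x : M) (X Y : ∀ x : M, TangentSpace 𝓘(ℝ, E) x), SmoothFieldAt X x → SmoothFieldAt Y x →
    ContMDiffAt 𝓘(ℝ, E) 𝓘(ℝ, ℝ) ∞ (fun y => β y (X y) (Y y)) x

/-- The coordinate expression of a field of bilinear forms. -/
def formInChart (β : ∀ x : M, TangentSpace 𝓘(ℝ, E) x →L[ℝ] TangentSpace 𝓘(ℝ, E) x →L[ℝ] ℝ)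
    (x₀ : M) (u : E) : E →L[ℝ] E →L[ℝ] ℝ :=
  let B : E →L[ℝ] E →L[ℝ] ℝ := β ((extChartAt 𝓘(ℝ, E) x₀).symm u)
  let D : E →L[ℝ] E := mfderiv 𝓘(ℝ, E) 𝓘(ℝ, E) (extChartAt 𝓘(ℝ, E) x₀).symm u
  B.bilinearComp D D

omit [IsManifold 𝓘(ℝ, E) ∞ M] in
theorem formInChart_apply
    (β : ∀ x : M, TangentSpace 𝓘(ℝ, E) x →L[ℝ] TangentSpace 𝓘(ℝ, E) x →L[ℝ] ℝ) {x₀ : M} {u : E}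
    (hu : u ∈ (extChartAt 𝓘(ℝ, E) x₀).target) (v w : E) :
    formInChart β x₀ u v w = β ((extChartAt 𝓘(ℝ, E) x₀).symm u)
      (coordField x₀ v ((extChartAt 𝓘(ℝ, E) x₀).symm u))
      (coordField x₀ w ((extChartAt 𝓘(ℝ, E) x₀).symm u)) := by
  have e : ∀ a : E, coordField x₀ a ((extChartAt 𝓘(ℝ, E) x₀).symm u)
      = (mfderiv 𝓘(ℝ, E) 𝓘(ℝ, E) (extChartAt 𝓘(ℝ, E) x₀).symm u : E →L[ℝ] E) a := fun a => by
    rw [coordField, (extChartAt 𝓘(ℝ, E) x₀).right_inv hu]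
  rw [e, e]
  rfl

theorem formInChart_coordVec
    (β : ∀ x : M, TangentSpace 𝓘(ℝ, E) x →L[ℝ] TangentSpace 𝓘(ℝ, E) x →L[ℝ] ℝ) {x₀ y : M}
    (hy : y ∈ (chartAt E x₀).source) (v w : TangentSpace 𝓘(ℝ, E) y) :
    formInChart β x₀ (extChartAt 𝓘(ℝ, E) x₀ y) (coordVec x₀ y v) (coordVec x₀ y w) = β y v w := by
  have hu : extChartAt 𝓘(ℝ, E) x₀ y ∈ (extChartAt 𝓘(ℝ, E) x₀).target :=
    (extChartAt 𝓘(ℝ, E) x₀).map_source (by simpa using hy)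
  rw [formInChart_apply β hu]
  refine (congrArg (fun z => β z (coordField x₀ (coordVec x₀ y v) z)
    (coordField x₀ (coordVec x₀ y w) z))
    ((extChartAt 𝓘(ℝ, E) x₀).left_inv (x := y) (by simpa using hy))).trans ?_
  simp only [coordField_coordVec hy]

theorem contDiffOn_formInChart [FiniteDimensional ℝ E]
    {β : ∀ x : M, TangentSpace 𝓘(ℝ, E) x →L[ℝ] TangentSpace 𝓘(ℝ, E) x →L[ℝ] ℝ}
    (hβ : IsSmoothForm β) (x₀ : M) :
    ContDiffOn ℝ ∞ (formInChart β x₀) (extChartAt 𝓘(ℝ, E) x₀).target := by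
  rw [contDiffOn_clm_apply]
  intro v
  rw [contDiffOn_clm_apply]
  intro w
  have h : ContDiffOn ℝ ∞ (fun u => β ((extChartAt 𝓘(ℝ, E) x₀).symm u)
      (coordField x₀ v ((extChartAt 𝓘(ℝ, E) x₀).symm u))
      (coordField x₀ w ((extChartAt 𝓘(ℝ, E) x₀).symm u))) (extChartAt 𝓘(ℝ, E) x₀).target := by
    intro u hu
    have hy : (extChartAt 𝓘(ℝ, E) x₀).symm u ∈ (chartAt E x₀).source := by
      simpa using (extChartAt 𝓘(ℝ, E) x₀).map_target hu
    have h1 := contDiffAt_comp_extChartAt_symm hy (hβ _ _ _ (smoothFieldAt_coordField hy v)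
      (smoothFieldAt_coordField hy w))
    rw [(extChartAt 𝓘(ℝ, E) x₀).right_inv hu] at h1
    exact h1.contDiffWithinAt
  exact h.congr fun u hu => formInChart_apply β hu v w

/-- The product rule in the chart at `x`. Its last two terms are those that the brackets in
`lieForm` cancel. -/
theorem mvfderiv_form [FiniteDimensional ℝ E]
    {β : ∀ x : M, TangentSpace 𝓘(ℝ, E) x →L[ℝ] TangentSpace 𝓘(ℝ, E) x →L[ℝ] ℝ}
    (hβ : IsSmoothForm β) (hX : SmoothFieldAt X x) (hY : SmoothFieldAt Y x)
    (v : TangentSpace 𝓘(ℝ, E) x) :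
    mvfderiv 𝓘(ℝ, E) (fun y => β y (X y) (Y y)) x v
      = fderiv ℝ (formInChart β x) (extChartAt 𝓘(ℝ, E) x x) (coordVec x x v)
          (coordVec x x (X x)) (coordVec x x (Y x))
        + formInChart β x (extChartAt 𝓘(ℝ, E) x x)
          (fderiv ℝ (inChart x X) (extChartAt 𝓘(ℝ, E) x x) (coordVec x x v)) (coordVec x x (Y x))
        + formInChart β x (extChartAt 𝓘(ℝ, E) x x) (coordVec x x (X x))
          (fderiv ℝ (inChart x Y) (extChartAt 𝓘(ℝ, E) x x) (coordVec x x v)) := by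
  have hx := mem_chart_source E x
  have hc : ∀ V : ∀ x : M, TangentSpace 𝓘(ℝ, E) x,
      coordVec x x (V x) = inChart x V (extChartAt 𝓘(ℝ, E) x x) :=
    fun V => congrArg (fun z => coordVec x z (V z)) (extChartAt_to_inv (I := 𝓘(ℝ, E)) x).symm
  have hB := (((contDiffOn_formInChart hβ x).contDiffAt ((isOpen_extChartAt_target x).mem_nhds
    (mem_extChartAt_target x))).differentiableAt (by simp)).hasFDerivAt
  have hX' := ((contDiffAt_inChart hx hX).differentiableAt (by simp)).hasFDerivAt
  have hY' := ((contDiffAt_inChart hx hY).differentiableAt (by simp)).hasFDerivAt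
  have e : (fun u => β ((extChartAt 𝓘(ℝ, E) x).symm u) (X ((extChartAt 𝓘(ℝ, E) x).symm u))
      (Y ((extChartAt 𝓘(ℝ, E) x).symm u))) =ᶠ[𝓝 (extChartAt 𝓘(ℝ, E) x x)]
      fun u => formInChart β x u (inChart x X u) (inChart x Y u) := by
    filter_upwards [(isOpen_extChartAt_target (I := 𝓘(ℝ, E)) x).mem_nhds
      (mem_extChartAt_target x)] with u hu
    have hy : (extChartAt 𝓘(ℝ, E) x).symm u ∈ (chartAt E x).source := by
      simpa using (extChartAt 𝓘(ℝ, E) x).map_target hu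
    have h := formInChart_coordVec β hy (X _) (Y _)
    rw [(extChartAt 𝓘(ℝ, E) x).right_inv hu] at h
    exact h.symm
  rw [mvfderiv_eq_fderiv_extChartAt hx ((hβ x X Y hX hY).mdifferentiableAt (by simp)), e.fderiv_eq,
    ((hB.clm_apply hX').clm_apply hY').fderiv, hc X, hc Y]
  simp only [add_apply, ContinuousLinearMap.coe_comp, Function.comp_apply,
    ContinuousLinearMap.flip_apply]
  ring

/-- The Lie derivative of a field of bilinear forms along a vector field. -/
def lieForm (β : ∀ x : M, TangentSpace 𝓘(ℝ, E) x →L[ℝ] TangentSpace 𝓘(ℝ, E) x →L[ℝ] ℝ)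
    (K X Y : ∀ x : M, TangentSpace 𝓘(ℝ, E) x) (x : M) : ℝ :=
  mvfderiv 𝓘(ℝ, E) (fun y => β y (X y) (Y y)) x (K x)
    - β x (VectorField.mlieBracket 𝓘(ℝ, E) K X x) (Y x)
    - β x (X x) (VectorField.mlieBracket 𝓘(ℝ, E) K Y x)

-- Only `F 0 = id` and the velocity at time zero matter, so the result serves both for flows and for
-- `rotation ξ`, which in general is not a one-parameter group. In a chart the derivative is
-- `Dβ(K)(X, Y) + β(DK X, Y) + β(X, DK Y)`; the terms in `DX K` and `DY K` drop out of `lieForm`.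
set_option synthInstance.maxHeartbeats 200000 in
theorem IsFlowGerm.hasDerivAt_pullback [FiniteDimensional ℝ E] (h : IsFlowGerm F K x)
    {β : ∀ x : M, TangentSpace 𝓘(ℝ, E) x →L[ℝ] TangentSpace 𝓘(ℝ, E) x →L[ℝ] ℝ}
    (hβ : IsSmoothForm β) (hX : SmoothFieldAt X x) (hY : SmoothFieldAt Y x) :
    HasDerivAt (fun t => β (F t x) (mfderiv 𝓘(ℝ, E) 𝓘(ℝ, E) (F t) x (X x))
      (mfderiv 𝓘(ℝ, E) 𝓘(ℝ, E) (F t) x (Y x))) (lieForm β K X Y x) 0 := by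
  have : CompleteSpace E := FiniteDimensional.complete ℝ E
  have hx := mem_chart_source E x
  have hc : ∀ V : ∀ x : M, TangentSpace 𝓘(ℝ, E) x,
      coordVec x x (V x) = inChart x V (extChartAt 𝓘(ℝ, E) x x) :=
    fun V => congrArg (fun z => coordVec x z (V z)) (extChartAt_to_inv (I := 𝓘(ℝ, E)) x).symm
  have h0 : F 0 x = x := h.zero.self_of_nhds
  have hm : ∀ v : TangentSpace 𝓘(ℝ, E) x,
      coordVec x (F 0 x) (mfderiv 𝓘(ℝ, E) 𝓘(ℝ, E) (F 0) x v) = coordVec x x v := fun v => by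
    rw [(h.eventually_coordVec_mfderiv.self_of_nhds).2 v]
    have h1 : HasFDerivAt (fun u : E => familyInChart F x (0, u))
        ((fderiv ℝ (familyInChart F x) (0, extChartAt 𝓘(ℝ, E) x x)).comp (.inr ℝ ℝ E))
        (extChartAt 𝓘(ℝ, E) x x) :=
      (h.contDiffAt_familyInChart.differentiableAt (by simp)).hasFDerivAt.comp _
        (hasFDerivAt_prodMk_right (0 : ℝ) (extChartAt 𝓘(ℝ, E) x x))
    have e : (fun u : E => familyInChart F x (0, u)) =ᶠ[𝓝 (extChartAt 𝓘(ℝ, E) x x)] id :=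
      h.eventually_familyInChart_zero
    have h2 := congrArg (fun L : E →L[ℝ] E => L (coordVec x x v))
      (h1.fderiv.symm.trans e.fderiv_eq)
    simpa using h2
  have hB := (((contDiffOn_formInChart hβ x).contDiffAt ((isOpen_extChartAt_target x).mem_nhds
    (mem_extChartAt_target x))).differentiableAt (by simp)).hasFDerivAt
  have hB1 : HasDerivAt (fun t => formInChart β x (extChartAt 𝓘(ℝ, E) x (F t x)))
      (fderiv ℝ (formInChart β x) (extChartAt 𝓘(ℝ, E) x x) (coordVec x x (K x))) 0 :=
    HasFDerivAt.comp_hasDerivAt_of_eq (0 : ℝ) hB h.hasDerivAt_extChartAt (by rw [h0])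
  have h1 := (hB1.clm_apply (h.hasDerivAt_coordVec_mfderiv (X x))).clm_apply
    (h.hasDerivAt_coordVec_mfderiv (Y x))
  have h2 := h1.congr_of_eventuallyEq (f₁ := fun t => β (F t x)
      (mfderiv 𝓘(ℝ, E) 𝓘(ℝ, E) (F t) x (X x)) (mfderiv 𝓘(ℝ, E) 𝓘(ℝ, E) (F t) x (Y x))) (by
    filter_upwards [h.eventually_coordVec_mfderiv] with t ht
    exact (formInChart_coordVec β ht.1 _ _).symm)
  refine HasDerivAt.congr_deriv h2 ?_
  rw [lieForm, mvfderiv_form hβ hX hY, ← formInChart_coordVec β hx, ← formInChart_coordVec β hx,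
    coordVec_mlieBracket hx h.smooth_velocity hX, coordVec_mlieBracket hx h.smooth_velocity hY,
    VectorField.lieBracket, VectorField.lieBracket, hm, hm, h0, ← hc, ← hc, ← hc]
  simp only [add_apply, map_sub, sub_apply]
  ring

/-- The coordinates of `X` along `F t x` are differentiated at 0 in two ways: as a pushed forward
vector they give `DK X`, by the chain rule `DX K`. The difference is the bracket. -/
theorem IsFlowGerm.mlieBracket_eq_zero [CompleteSpace E] (h : IsFlowGerm F K x)
    (hX : SmoothFieldAt X x)
    (hF : ∀ᶠ t in 𝓝 (0 : ℝ), mfderiv 𝓘(ℝ, E) 𝓘(ℝ, E) (F t) x (X x) = X (F t x)) :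
    VectorField.mlieBracket 𝓘(ℝ, E) K X x = 0 := by
  have hx := mem_chart_source E x
  have h0 : F 0 x = x := h.zero.self_of_nhds
  have h1 := h.hasDerivAt_coordVec_mfderiv (X x)
  have h2 : HasDerivAt (fun t => inChart x X (extChartAt 𝓘(ℝ, E) x (F t x)))
      (fderiv ℝ (inChart x X) (extChartAt 𝓘(ℝ, E) x x) (coordVec x x (K x))) 0 :=
    HasFDerivAt.comp_hasDerivAt_of_eq (0 : ℝ)
      ((contDiffAt_inChart hx hX).differentiableAt (by simp)).hasFDerivAt
      h.hasDerivAt_extChartAt (by rw [h0])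
  have e : (fun t => inChart x X (extChartAt 𝓘(ℝ, E) x (F t x))) =ᶠ[𝓝 0]
      (fun t => coordVec x (F t x) (mfderiv 𝓘(ℝ, E) 𝓘(ℝ, E) (F t) x (X x))) := by
    filter_upwards [hF, h.eventually_coordVec_mfderiv] with t ht1 ht2
    rw [ht1]
    exact congrArg (fun z => coordVec x z (X z))
      ((extChartAt 𝓘(ℝ, E) x).left_inv (x := F t x) (by simpa using ht2.1))
  have h3 := h1.unique (h2.congr_of_eventuallyEq e.symm)
  refine coordVec_injective hx ?_
  have hc : ∀ V : ∀ x : M, TangentSpace 𝓘(ℝ, E) x,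
      coordVec x x (V x) = inChart x V (extChartAt 𝓘(ℝ, E) x x) :=
    fun V => congrArg (fun z => coordVec x z (V z)) (extChartAt_to_inv (I := 𝓘(ℝ, E)) x).symm
  rw [coordVec_mlieBracket hx h.smooth_velocity hX, VectorField.lieBracket, ← hc, ← hc, h3,
    sub_self, coordVec_zero]

end Family
end LieDerivative

end Hypersymplectic
end

noncomputable section

set_option linter.unusedSectionVars false

namespace Hypersymplectic

/-! ### The flow of a smooth vector field -/

section Flow

variable {E : Type*} [NormedAddCommGroup E] [NormedSpace ℝ E]
  {M : Type*} [TopologicalSpace M] [ChartedSpace E M] [IsManifold 𝓘(ℝ, E) ∞ M]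
  {X : ∀ x : M, TangentSpace 𝓘(ℝ, E) x}

/-- Every smooth map on an open set agrees near each point with a globally defined smooth map. -/
theorem exists_contDiff_eqOn_ball [FiniteDimensional ℝ E] {f : E → E} {U : Set E} (hU : IsOpen U)
    (hf : ContDiffOn ℝ ∞ f U) {u₀ : E} (hu₀ : u₀ ∈ U) :
    ∃ f' : E → E, ContDiff ℝ ∞ f' ∧ ∃ r > 0, ∀ u ∈ Metric.ball u₀ r, u ∈ U ∧ f' u = f u := by
  obtain ⟨R, hR, hRU⟩ := Metric.isOpen_iff.1 hU u₀ hu₀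
  let χ : ContDiffBump u₀ := ⟨R / 4, R / 2, by positivity, by linarith⟩
  refine ⟨fun u => χ u • f u, ?_, R / 4, by positivity, fun u hu => ⟨hRU ?_, ?_⟩⟩
  · rw [contDiff_iff_contDiffAt]
    intro u
    by_cases hu : u ∈ Metric.ball u₀ R
    · exact χ.contDiff.contDiffAt.smul (hf.contDiffAt (hU.mem_nhds (hRU hu)))
    · have hu' : u ∈ (Metric.closedBall u₀ (R / 2))ᶜ := by
        simp only [Metric.mem_ball, not_lt] at hu
        simp only [mem_compl_iff, Metric.mem_closedBall, not_le]
        linarith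
      refine (contDiffAt_const (c := (0 : E))).congr_of_eventuallyEq ?_
      filter_upwards [Metric.isClosed_closedBall.isOpen_compl.mem_nhds hu'] with v hv
      rw [χ.zero_of_le_dist (by
        simp only [mem_compl_iff, Metric.mem_closedBall, not_le] at hv; exact hv.le), zero_smul]
  · exact Metric.ball_subset_ball (by linarith) hu
  · have h1 : χ u = 1 := χ.one_of_mem_closedBall (Metric.ball_subset_closedBall hu)
    simp [h1]

omit [NormedAddCommGroup E] [NormedSpace ℝ E] in
theorem comp_toSpanSingleton_eq {F G : Type*} [NormedAddCommGroup F] [NormedSpace ℝ F]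
    [NormedAddCommGroup G] [NormedSpace ℝ G] {A : F →L[ℝ] G} {a : F} {b : G} (h : A a = b) :
    A.comp (ContinuousLinearMap.toSpanSingleton ℝ a) = (1 : ℝ →L[ℝ] ℝ).smulRight b := by
  ext
  simp [h]

/-- Smooth vector fields have smooth local flows. -/
theorem exists_contMDiffOn_localFlow [FiniteDimensional ℝ E] (hX : ∀ x, SmoothFieldAt X x)
    (x₀ : M) :
    ∃ ε > 0, ∃ V : Set M, IsOpen V ∧ x₀ ∈ V ∧ ∃ F : ℝ → M → M,
      ContMDiffOn (𝓘(ℝ, ℝ).prod 𝓘(ℝ, E)) 𝓘(ℝ, E) ∞ (fun p : ℝ × M => F p.1 p.2)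
        (Ioo (-ε) ε ×ˢ V) ∧
      ∀ y ∈ V, F 0 y = y ∧ IsMIntegralCurveOn (fun t => F t y) X (Ioo (-ε) ε) := by
  have : CompleteSpace E := FiniteDimensional.complete ℝ E
  set φ := extChartAt 𝓘(ℝ, E) x₀ with hφ
  have hdiff : ContDiffOn ℝ ∞ (inChart x₀ X) φ.target := by
    intro u hu
    have hy : φ.symm u ∈ (chartAt E x₀).source := by simpa [hφ] using φ.map_target hu
    have h := contDiffAt_inChart hy (hX _)
    rw [← hφ, φ.right_inv hu] at h
    exact h.contDiffWithinAt
  -- The coordinate field is cut off to a global field on `E`; solutions that stay in the ball of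
  -- radius `r` do not see the change.
  obtain ⟨f, hf, r, hr, hfr⟩ := exists_contDiff_eqOn_ball (isOpen_extChartAt_target x₀) hdiff
    (mem_extChartAt_target (I := 𝓘(ℝ, E)) x₀)
  obtain ⟨r', hr', ε', hε', α, hα, hαs⟩ := exists_contDiffOn_localFlow hf (φ x₀)
  have hα0 : α (φ x₀, 0) = φ x₀ := (hα _ (Metric.mem_ball_self hr')).1
  have hαc : ContinuousAt α (φ x₀, 0) :=
    (hαs.contDiffAt ((Metric.isOpen_ball.prod isOpen_Ioo).mem_nhds
      ⟨Metric.mem_ball_self hr', by simp [hε']⟩)).continuousAt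
  have h1 : ∀ᶠ p in 𝓝 (φ x₀, (0 : ℝ)), α p ∈ Metric.ball (φ x₀) r :=
    hαc.eventually (by rw [hα0]; exact Metric.ball_mem_nhds _ hr)
  rw [nhds_prod_eq] at h1
  obtain ⟨δ, hδ, h2⟩ := (Filter.Eventually.exists_mem h1 :
    ∃ v ∈ 𝓝 (φ x₀) ×ˢ 𝓝 (0 : ℝ), _)
  obtain ⟨t1, ht1, t2, ht2, ht⟩ := Filter.mem_prod_iff.1 hδ
  obtain ⟨d, hd, hd1⟩ := Metric.mem_nhds_iff.1 ht1
  obtain ⟨e, he, he1⟩ := Metric.mem_nhds_iff.1 ht2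
  have hball : ∀ u ∈ Metric.ball (φ x₀) (min d r'), ∀ t ∈ Ioo (-(min e ε')) (min e ε'),
      u ∈ Metric.ball (φ x₀) r' ∧ t ∈ Ioo (-ε') ε' ∧ α (u, t) ∈ Metric.ball (φ x₀) r := by
    intro u hu t ht'
    refine ⟨Metric.ball_subset_ball (min_le_right _ _) hu,
      ⟨lt_of_le_of_lt (neg_le_neg (min_le_right _ _)) ht'.1, ht'.2.trans_le (min_le_right _ _)⟩,
      h2 _ (ht ⟨hd1 (Metric.ball_subset_ball (min_le_left _ _) hu), he1 ?_⟩)⟩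
    rw [Metric.mem_ball, Real.dist_eq, sub_zero, abs_lt]
    exact ⟨lt_of_le_of_lt (neg_le_neg (min_le_left _ _)) ht'.1, ht'.2.trans_le (min_le_left _ _)⟩
  refine ⟨min e ε', by positivity, φ.source ∩ φ ⁻¹' Metric.ball (φ x₀) (min d r'),
    (continuousOn_extChartAt x₀).isOpen_inter_preimage (isOpen_extChartAt_source x₀)
      Metric.isOpen_ball,
    ⟨mem_extChartAt_source x₀, Metric.mem_ball_self (by positivity)⟩,
    fun t y => φ.symm (α (φ y, t)), ?_, ?_⟩
  · have e1 : ContMDiffOn (𝓘(ℝ, ℝ).prod 𝓘(ℝ, E)) (𝓘(ℝ, E).prod 𝓘(ℝ, ℝ)) ∞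
        (fun p : ℝ × M => (φ p.2, p.1))
        (Ioo (-(min e ε')) (min e ε') ×ˢ (φ.source ∩ φ ⁻¹' Metric.ball (φ x₀) (min d r'))) := by
      refine ContMDiffOn.prodMk ?_ contMDiffOn_fst
      exact (contMDiffOn_extChartAt (I := 𝓘(ℝ, E)) (n := ∞) (x := x₀)).comp contMDiffOn_snd
        (fun p hp => by simpa [hφ] using hp.2.1)
    have e2 : ContMDiffOn (𝓘(ℝ, E).prod 𝓘(ℝ, ℝ)) 𝓘(ℝ, E) ∞ α
        (Metric.ball (φ x₀) r' ×ˢ Ioo (-ε') ε') := by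
      rw [← modelWithCornersSelf_prod, chartedSpaceSelf_prod]
      exact hαs.contMDiffOn
    refine (contMDiffOn_extChartAt_symm x₀).comp (e2.comp e1 ?_) ?_
    · intro p hp
      have := hball _ hp.2.2 _ hp.1
      exact ⟨this.1, this.2.1⟩
    · intro p hp
      exact (hfr _ (hball _ hp.2.2 _ hp.1).2.2).1
  · intro y hy
    have hyr : φ y ∈ Metric.ball (φ x₀) r' := Metric.ball_subset_ball (min_le_right _ _) hy.2
    refine ⟨?_, fun t ht => HasMFDerivAt.hasMFDerivWithinAt ?_⟩
    · simp only [(hα _ hyr).1, φ.left_inv hy.1]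
    · obtain ⟨_, k2, k3⟩ := hball _ hy.2 t ht
      obtain ⟨k4, k5⟩ := hfr _ k3
      have d1 := ((hα _ hyr).2 t k2).hasFDerivAt.hasMFDerivAt
      have d2 : HasMFDerivAt 𝓘(ℝ, E) 𝓘(ℝ, E) φ.symm (α (φ y, t))
          (mfderiv 𝓘(ℝ, E) 𝓘(ℝ, E) φ.symm (α (φ y, t))) :=
        (((contMDiffOn_extChartAt_symm (I := 𝓘(ℝ, E)) (n := 1) x₀).contMDiffAt
          ((isOpen_extChartAt_target x₀).mem_nhds k4)).mdifferentiableAt (by simp)).hasMFDerivAt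
      have d3 := HasMFDerivAt.comp t d2 d1
      refine d3.congr_mfderiv ?_
      have hz : φ.symm (α (φ y, t)) ∈ (chartAt E x₀).source := by
        simpa [hφ] using φ.map_target k4
      have key := coordField_coordVec hz (X (φ.symm (α (φ y, t))))
      rw [coordField, ← hφ, φ.right_inv k4] at key
      exact comp_toSpanSingleton_eq (F := E) (G := E) ((congrArg (fun e : E =>
        (mfderiv 𝓘(ℝ, E) 𝓘(ℝ, E) φ.symm (α (φ y, t)) : E →L[ℝ] E) e) k5).trans key)

theorem contMDiff_of_smoothFieldAt (hX : ∀ x, SmoothFieldAt X x) :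
    ContMDiff 𝓘(ℝ, E) 𝓘(ℝ, E).tangent 1 (fun x => (⟨x, X x⟩ : TangentBundle 𝓘(ℝ, E) M)) :=
  fun x => ContMDiffAt.of_le (hX x) (by norm_cast)

theorem flowsTo_of_isMIntegralCurveOn_Ioo {a b t : ℝ} {γ : ℝ → M}
    (hγ : IsMIntegralCurveOn γ X (Ioo a b)) (h0 : (0 : ℝ) ∈ Ioo a b) (ht : t ∈ Ioo a b) :
    FlowsTo X t (γ 0) (γ t) :=
  ⟨γ, rfl, rfl, hγ.mono (ordConnected_Ioo.uIcc_subset h0 ht)⟩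

/-- An integral curve on a compact interval extends to a neighbourhood of this interval. -/
theorem exists_extension_isMIntegralCurveOn [FiniteDimensional ℝ E]
    (hX : ∀ x, SmoothFieldAt X x) {a b : ℝ} (hab : a ≤ b) {γ : ℝ → M}
    (hγ : IsMIntegralCurveOn γ X (Icc a b)) :
    ∃ δ > 0, ∃ γ' : ℝ → M, IsMIntegralCurveOn γ' X (Ioo (a - δ) (b + δ)) ∧
      EqOn γ' γ (Icc a b) := by
  obtain ⟨ε₁, hε₁, V₁, -, hV₁, F₁, -, hF₁⟩ := exists_contMDiffOn_localFlow hX (γ a)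
  obtain ⟨ε₂, hε₂, V₂, -, hV₂, F₂, -, hF₂⟩ := exists_contMDiffOn_localFlow hX (γ b)
  obtain ⟨h₁, k₁⟩ := hF₁ _ hV₁
  obtain ⟨h₂, k₂⟩ := hF₂ _ hV₂
  set c₁ : ℝ → M := (fun t => F₁ t (γ a)) ∘ (· + -a) with hc₁
  set c₂ : ℝ → M := (fun t => F₂ t (γ b)) ∘ (· + -b) with hc₂
  have l₁ : IsMIntegralCurveOn c₁ X {t | t + -a ∈ Ioo (-ε₁) ε₁} := k₁.comp_add (-a)
  have l₂ : IsMIntegralCurveOn c₂ X {t | t + -b ∈ Ioo (-ε₂) ε₂} := k₂.comp_add (-b)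
  have e₁ : c₁ a = γ a := by simp [hc₁, h₁]
  have e₂ : c₂ b = γ b := by simp [hc₂, h₂]
  set δ := min ε₁ ε₂
  have hδ : 0 < δ := by positivity
  have hδ₁ : δ ≤ ε₁ := min_le_left _ _
  have hδ₂ : δ ≤ ε₂ := min_le_right _ _
  -- Local solutions through the two end points are attached outside `[a, b]`. At `a` and `b` the
  -- derivatives agree, both being the value of the field there.
  set γ' : ℝ → M := fun t => if t < a then c₁ t else if t ≤ b then γ t else c₂ t with hγ'
  have q₁ : ∀ t ≤ a, γ' t = c₁ t := by
    intro t ht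
    rcases ht.lt_or_eq with h | rfl
    · simp [hγ', h]
    · simp [hγ', hab, e₁]
  have q₂ : ∀ t ∈ Icc a b, γ' t = γ t := fun t ht => by
    simp [hγ', not_lt.2 ht.1, ht.2]
  have q₃ : ∀ t, b ≤ t → γ' t = c₂ t := by
    intro t ht
    rcases ht.lt_or_eq with h | rfl
    · simp [hγ', not_lt.2 (hab.trans ht), not_le.2 h]
    · simp [hγ', hab, e₂]
  have m₁ : IsMIntegralCurveOn γ' X (Ioc (a - δ) a) := fun t ht => by
    have := (l₁.mono (s' := Ioc (a - δ) a) fun s hs => ⟨by linarith [hs.1], by linarith [hs.2]⟩) t ht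
    rw [← q₁ t ht.2] at this
    exact this.congr_mono (fun s hs => q₁ s hs.2) (q₁ t ht.2) subset_rfl
  have m₂ : IsMIntegralCurveOn γ' X (Icc a b) := fun t ht => by
    have := hγ t ht
    rw [← q₂ t ht] at this
    exact this.congr_mono (fun s hs => q₂ s hs) (q₂ t ht) subset_rfl
  have m₃ : IsMIntegralCurveOn γ' X (Ico b (b + δ)) := fun t ht => by
    have := (l₂.mono (s' := Ico b (b + δ)) fun s hs => ⟨by linarith [hs.1], by linarith [hs.2]⟩) t ht
    rw [← q₃ t ht.1] at this
    exact this.congr_mono (fun s hs => q₃ s hs.1) (q₃ t ht.1) subset_rfl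
  -- At a point of only one of the two sets, the other one is absent nearby; at a common point the
  -- derivatives within the two sets combine.
  have glue : ∀ {A B : Set ℝ}, IsMIntegralCurveOn γ' X A → IsMIntegralCurveOn γ' X B →
      (∀ t ∈ A, t ∉ B → Bᶜ ∈ 𝓝 t) → (∀ t ∈ B, t ∉ A → Aᶜ ∈ 𝓝 t) →
      IsMIntegralCurveOn γ' X (A ∪ B) := by
    intro A B hA hB h1 h2 t ht
    have aux : ∀ {P Q : Set ℝ}, t ∈ P → IsMIntegralCurveOn γ' X P → Qᶜ ∈ 𝓝 t →
        HasMFDerivWithinAt 𝓘(ℝ, ℝ) 𝓘(ℝ, E) γ' (P ∪ Q) t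
          ((1 : ℝ →L[ℝ] ℝ).smulRight (X (γ' t))) := by
      intro P Q hP hPi hQ
      refine (hPi t hP).mono_of_mem_nhdsWithin ?_
      filter_upwards [self_mem_nhdsWithin, mem_nhdsWithin_of_mem_nhds hQ] with s hs hs'
      exact hs.resolve_right hs'
    by_cases htA : t ∈ A
    · by_cases htB : t ∈ B
      · exact (hA t htA).union (hB t htB)
      · exact aux htA hA (h1 t htA htB)
    · rw [union_comm]
      exact aux (ht.resolve_left htA) hB (h2 t (ht.resolve_left htA) htA)
  refine ⟨δ, hδ, γ', ?_, q₂⟩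
  have m₄ := glue m₂ m₃
    (fun t ht ht' => by
      have : t < b := by
        by_contra h
        exact ht' ⟨not_lt.1 h, by linarith [ht.2]⟩
      filter_upwards [Iio_mem_nhds this] with s hs hs'
      exact absurd hs'.1 (not_le.2 hs))
    (fun t ht ht' => by
      have : b < t := by
        by_contra h
        exact ht' ⟨hab.trans ht.1, not_lt.1 h⟩
      filter_upwards [Ioi_mem_nhds this] with s hs hs'
      exact absurd hs'.2 (not_le.2 hs))
  have m₅ := glue m₁ m₄
    (fun t ht ht' => by
      have : t < a := by
        by_contra h
        exact ht' (Or.inl ⟨not_lt.1 h, ht.2.trans hab⟩)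
      filter_upwards [Iio_mem_nhds this] with s hs hs'
      rcases hs' with hs' | hs'
      · exact absurd hs'.1 (not_le.2 hs)
      · exact absurd (hab.trans hs'.1) (not_le.2 hs))
    (fun t ht ht' => by
      have h1 : a ≤ t := by
        rcases ht with ht | ht
        · exact ht.1
        · exact hab.trans ht.1
      have : a < t := by
        by_contra h
        exact ht' ⟨by linarith, not_lt.1 h⟩
      filter_upwards [Ioi_mem_nhds this] with s hs hs'
      exact absurd hs'.2 (not_le.2 hs))
  refine m₅.mono fun t ht => ?_
  rcases le_or_gt t a with h | h
  · exact Or.inl ⟨ht.1, h⟩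
  · rcases le_or_gt t b with h' | h'
    · exact Or.inr (Or.inl ⟨h.le, h'⟩)
    · exact Or.inr (Or.inr ⟨h'.le, ht.2⟩)

/-- Passes from the closed interval in `FlowsTo` to an open one, where integral curves can be
compared and glued. -/
theorem FlowsTo.exists_Ioo [FiniteDimensional ℝ E] (hX : ∀ x, SmoothFieldAt X x) {t : ℝ} {x y : M}
    (h : FlowsTo X t x y) : ∃ a b, (0 : ℝ) ∈ Ioo a b ∧ t ∈ Ioo a b ∧ ∃ γ : ℝ → M,
      γ 0 = x ∧ γ t = y ∧ IsMIntegralCurveOn γ X (Ioo a b) := by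
  obtain ⟨γ, h0, ht, hγ⟩ := h
  obtain ⟨δ, hδ, γ', hγ', he⟩ := exists_extension_isMIntegralCurveOn hX (inf_le_sup (a := (0 : ℝ))
    (b := t)) hγ
  have hm : ∀ s ∈ uIcc 0 t, s ∈ Ioo (0 ⊓ t - δ) (0 ⊔ t + δ) := fun s hs =>
    ⟨by linarith [hs.1], by linarith [hs.2]⟩
  exact ⟨_, _, hm 0 left_mem_uIcc, hm t right_mem_uIcc, γ',
    (he left_mem_uIcc).trans h0, (he right_mem_uIcc).trans ht, hγ'⟩

theorem FlowsTo.trans [FiniteDimensional ℝ E] [T2Space M] (hX : ∀ x, SmoothFieldAt X x)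
    {t s : ℝ} {x y z : M} (h : FlowsTo X t x y) (h' : FlowsTo X s y z) :
    FlowsTo X (t + s) x z := by
  obtain ⟨a, b, h0, ht, γ, rfl, rfl, hγ⟩ := h.exists_Ioo hX
  obtain ⟨a', b', h0', hs, γ', he, rfl, hγ'⟩ := h'.exists_Ioo hX
  have h1 : IsMIntegralCurveOn (γ' ∘ (· + -t)) X (Ioo (a' + t) (b' + t)) :=
    (hγ'.comp_add (-t)).mono fun r hr => ⟨by linarith [hr.1], by linarith [hr.2]⟩
  have ht' : t ∈ Ioo (a' + t) (b' + t) := ⟨by linarith [h0'.1], by linarith [h0'.2]⟩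
  have hts : t + s ∈ Ioo (a' + t) (b' + t) := ⟨by linarith [hs.1], by linarith [hs.2]⟩
  have heq : γ t = (γ' ∘ (· + -t)) t := by simp [he]
  have h2 := isMIntegralCurveOn_piecewise (contMDiff_of_smoothFieldAt hX) hγ h1 ⟨ht, ht'⟩ heq
  have h3 := eqOn_piecewise_of_isMIntegralCurveOn_Ioo (contMDiff_of_smoothFieldAt hX) hγ h1
    ⟨ht, ht'⟩ heq
  refine ⟨_, piecewise_eqOn _ _ _ h0, (h3 hts).trans (by simp), h2.mono ?_⟩
  have hoc : OrdConnected (Ioo a b ∪ Ioo (a' + t) (b' + t)) :=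
    (isPreconnected_Ioo.union t ht ht' isPreconnected_Ioo).ordConnected
  exact hoc.uIcc_subset (Or.inl h0) (Or.inr hts)

theorem FlowsTo.symm {t : ℝ} {x y : M} (h : FlowsTo X t x y) : FlowsTo X (-t) y x := by
  obtain ⟨γ, h0, ht, hγ⟩ := h
  refine ⟨γ ∘ (· + t), by simpa using ht, by simpa using h0, (hγ.comp_add t).mono ?_⟩
  intro s hs
  have := mem_image_of_mem (· + t) hs
  rw [image_add_const_uIcc] at this
  rw [uIcc_comm]
  simpa using this

theorem FlowsTo.unique [FiniteDimensional ℝ E] [T2Space M] (hX : ∀ x, SmoothFieldAt X x)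
    {t : ℝ} {x y z : M} (h : FlowsTo X t x y) (h' : FlowsTo X t x z) : y = z := by
  obtain ⟨a, b, h0, ht, γ, rfl, rfl, hγ⟩ := h.exists_Ioo hX
  obtain ⟨a', b', h0', ht', γ', he, rfl, hγ'⟩ := h'.exists_Ioo hX
  have h3 := eqOn_piecewise_of_isMIntegralCurveOn_Ioo (contMDiff_of_smoothFieldAt hX) hγ hγ'
    ⟨h0, h0'⟩ he.symm
  exact (piecewise_eqOn _ _ _ ht).symm.trans (h3 ht')

/-- The flow of `X` is defined near `x` for the time `t`, is smooth there, and sends `x` to `y`. -/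
def LocalFlow (X : ∀ x : M, TangentSpace 𝓘(ℝ, E) x) (t : ℝ) (x y : M) : Prop :=
  ∃ V : Set M, IsOpen V ∧ x ∈ V ∧ ∃ Φ : M → M, ContMDiffOn 𝓘(ℝ, E) 𝓘(ℝ, E) ∞ Φ V ∧ Φ x = y ∧
    ∀ z ∈ V, FlowsTo X t z (Φ z)

theorem LocalFlow.trans [FiniteDimensional ℝ E] [T2Space M] (hX : ∀ x, SmoothFieldAt X x)
    {t s : ℝ} {x y z : M} (h : LocalFlow X t x y) (h' : LocalFlow X s y z) :
    LocalFlow X (t + s) x z := by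
  obtain ⟨V, hV, hx, Φ, hΦ, rfl, hf⟩ := h
  obtain ⟨V', hV', hx', Φ', hΦ', rfl, hf'⟩ := h'
  exact ⟨V ∩ Φ ⁻¹' V', hΦ.continuousOn.isOpen_inter_preimage hV hV', ⟨hx, hx'⟩, Φ' ∘ Φ,
    hΦ'.comp (hΦ.mono inter_subset_left) inter_subset_right, rfl,
    fun z hz => (hf z hz.1).trans hX (hf' _ hz.2)⟩

theorem eventually_localFlow [FiniteDimensional ℝ E] (hX : ∀ x, SmoothFieldAt X x) (x₀ : M) :
    ∃ ε > 0, ∃ V : Set M, IsOpen V ∧ x₀ ∈ V ∧ ∀ y ∈ V, ∀ t ∈ Ioo (-ε) ε, ∃ z, LocalFlow X t y z := by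
  obtain ⟨ε, hε, V, hV, hx₀, F, hF, h⟩ := exists_contMDiffOn_localFlow hX x₀
  refine ⟨ε, hε, V, hV, hx₀, fun y hy t ht => ⟨F t y, V, hV, hy, F t, ?_, rfl, fun z hz => ?_⟩⟩
  · exact hF.comp (contMDiffOn_const.prodMk contMDiffOn_id) fun z hz => ⟨ht, hz⟩
  · have := flowsTo_of_isMIntegralCurveOn_Ioo (h z hz).2 (by simp [hε]) ht
    simpa only [(h z hz).1] using this

theorem flowsTo_zero [FiniteDimensional ℝ E] (hX : ∀ x, SmoothFieldAt X x) (x : M) :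
    FlowsTo X 0 x x := by
  obtain ⟨ε, hε, V, -, hxV, h⟩ := eventually_localFlow hX x
  obtain ⟨z, V', -, hxV', Φ, -, -, h'⟩ := h x hxV 0 ⟨by linarith, hε⟩
  obtain ⟨γ, h0, -, hγ⟩ := h' x hxV'
  exact ⟨γ, h0, h0, hγ⟩

/-- Short-time local flows compose along the curve. Being joined by a local flow is a transitive
relation between points of `γ`, valid in both directions for nearby times, so connectedness of the
interval extends it to all times. -/
theorem FlowsTo.localFlow [FiniteDimensional ℝ E] [T2Space M] (hX : ∀ x, SmoothFieldAt X x)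
    {t : ℝ} {x y : M} (h : FlowsTo X t x y) : LocalFlow X t x y := by
  obtain ⟨a, b, h0, ht, γ, rfl, rfl, hγ⟩ := h.exists_Ioo hX
  have key : LocalFlow X (t - 0) (γ 0) (γ t) := by
    refine isPreconnected_Ioo.induction₂' (s := Ioo a b)
      (fun r s => LocalFlow X (s - r) (γ r) (γ s)) ?_ ?_ h0 ht
    · intro r hr
      obtain ⟨ε, hε, V, hV, hxV, hlf⟩ := eventually_localFlow hX (γ r)
      have hc : ContinuousAt γ r := (hγ.continuousOn).continuousAt (Ioo_mem_nhds hr.1 hr.2)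
      refine mem_nhdsWithin_of_mem_nhds ?_
      filter_upwards [hc.eventually (hV.mem_nhds hxV), Ioo_mem_nhds hr.1 hr.2,
        Ioo_mem_nhds (show r - ε < r by linarith) (show r < r + ε by linarith)] with s hs1 hs2 hs3
      have hft : ∀ {p q : ℝ}, p ∈ Ioo a b → q ∈ Ioo a b → FlowsTo X (q - p) (γ p) (γ q) := by
        intro p q hp hq
        have := flowsTo_of_isMIntegralCurveOn_Ioo (a := a - p) (b := b - p) (t := q - p)
          ((hγ.comp_add p).mono fun z hz => ⟨by linarith [hz.1], by linarith [hz.2]⟩)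
          ⟨by linarith [hp.1], by linarith [hp.2]⟩ ⟨by linarith [hq.1], by linarith [hq.2]⟩
        simpa using this
      -- Uniqueness of integral curves forces the end point of the local flow started at `γ p` to be
      -- `γ q`.
      have fin : ∀ {p q : ℝ} , p ∈ Ioo a b → q ∈ Ioo a b → (∃ z, LocalFlow X (q - p) (γ p) z) →
          LocalFlow X (q - p) (γ p) (γ q) := by
        rintro p q hp hq ⟨z, V', hV', hxV', Φ, hΦ, hz, hfl⟩
        exact ⟨V', hV', hxV', Φ, hΦ, (hfl _ hxV').unique hX (hft hp hq), hfl⟩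
      exact ⟨fin hr hs2 (hlf _ hxV _ ⟨by linarith [hs3.1], by linarith [hs3.2]⟩),
        fin hs2 hr (hlf _ hs1 _ ⟨by linarith [hs3.2], by linarith [hs3.1]⟩)⟩
    · intro r s q _ _ _ h1 h2
      have := h1.trans hX h2
      rwa [show s - r + (q - s) = q - r by ring] at this
  simpa using key

open Classical in
/-- The time `t` flow of `X` (with value `x` at the points `x` where it is not defined). -/
def flowMap (X : ∀ x : M, TangentSpace 𝓘(ℝ, E) x) (t : ℝ) (x : M) : M :=
  if h : x ∈ flowDomain X t then h.choose else x

theorem flowMap_spec {t : ℝ} {x : M} (h : x ∈ flowDomain X t) : FlowsTo X t x (flowMap X t x) := by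
  rw [flowMap, dif_pos h]
  exact h.choose_spec

/-! ### The time `t` map and pull-backs along it -/

variable [FiniteDimensional ℝ E] [T2Space M]

theorem FlowsTo.flowMap_eq (hX : ∀ x, SmoothFieldAt X x) {t : ℝ} {x y : M} (h : FlowsTo X t x y) :
    flowMap X t x = y :=
  (flowMap_spec ⟨y, h⟩).unique hX h

theorem isOpen_flowDomain (hX : ∀ x, SmoothFieldAt X x) (t : ℝ) : IsOpen (flowDomain X t) := by
  rw [isOpen_iff_mem_nhds]
  rintro x ⟨y, hy⟩
  obtain ⟨V, hV, hx, Φ, -, -, h⟩ := hy.localFlow hX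
  exact Filter.mem_of_superset (hV.mem_nhds hx) fun z hz => ⟨_, h z hz⟩

theorem contMDiffAt_flowMap (hX : ∀ x, SmoothFieldAt X x) {t : ℝ} {x : M}
    (hx : x ∈ flowDomain X t) : ContMDiffAt 𝓘(ℝ, E) 𝓘(ℝ, E) ∞ (flowMap X t) x := by
  obtain ⟨y, hy⟩ := hx
  obtain ⟨V, hV, hx, Φ, hΦ, -, h⟩ := hy.localFlow hX
  refine (hΦ.contMDiffAt (hV.mem_nhds hx)).congr_of_eventuallyEq ?_
  filter_upwards [hV.mem_nhds hx] with z hz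
  exact (h z hz).flowMap_eq hX

theorem eventually_mem_flowDomain (hX : ∀ x, SmoothFieldAt X x) (x : M) :
    ∀ᶠ t in 𝓝 (0 : ℝ), x ∈ flowDomain X t := by
  obtain ⟨ε, hε, V, hV, hxV, h⟩ := eventually_localFlow hX x
  filter_upwards [Ioo_mem_nhds (show -ε < 0 by linarith) hε] with t ht
  obtain ⟨z, V', -, hx', Φ, -, -, h'⟩ := h x hxV t ht
  exact ⟨_, h' x hx'⟩

theorem eventually_flowMap_eq (hX : ∀ x, SmoothFieldAt X x) (x : M) :
    ∃ ε > 0, ∃ V : Set M, IsOpen V ∧ x ∈ V ∧ (∀ y ∈ V, ∀ t ∈ Ioo (-ε) ε, y ∈ flowDomain X t) ∧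
      (∀ y ∈ V, IsMIntegralCurveOn (fun t => flowMap X t y) X (Ioo (-ε) ε)) ∧
      ContMDiffOn (𝓘(ℝ, ℝ).prod 𝓘(ℝ, E)) 𝓘(ℝ, E) ∞ (fun p : ℝ × M => flowMap X p.1 p.2)
        (Ioo (-ε) ε ×ˢ V) := by
  obtain ⟨ε, hε, V, hV, hx, F, hF, h⟩ := exists_contMDiffOn_localFlow hX x
  have hfl : ∀ y ∈ V, ∀ t ∈ Ioo (-ε) ε, FlowsTo X t y (F t y) := fun y hy t ht => by
    simpa only [(h y hy).1] using
      flowsTo_of_isMIntegralCurveOn_Ioo (h y hy).2 (by simp [hε]) ht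
  have he : ∀ y ∈ V, ∀ t ∈ Ioo (-ε) ε, flowMap X t y = F t y := fun y hy t ht =>
    (hfl y hy t ht).flowMap_eq hX
  refine ⟨ε, hε, V, hV, hx, fun y hy t ht => ⟨_, hfl y hy t ht⟩, fun y hy t ht => ?_,
    hF.congr fun p hp => he _ hp.2 _ hp.1⟩
  exact (((h y hy).2 t ht).congr_mono (fun s hs => he y hy s hs) (he y hy t ht)
    subset_rfl).congr_mfderiv
    (congrArg (fun z => (1 : ℝ →L[ℝ] ℝ).smulRight (X z : E)) (he y hy t ht).symm)

theorem isFlowGerm_flowMap (hX : ∀ x, SmoothFieldAt X x) (x : M) :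
    IsFlowGerm (flowMap X) X x := by
  obtain ⟨ε, hε, V, hV, hx, h1, h2, h3⟩ := eventually_flowMap_eq hX x
  have h0 : ∀ y, flowMap X 0 y = y := fun y => (flowsTo_zero hX y).flowMap_eq hX
  have hε0 : Ioo (-ε) ε ∈ 𝓝 (0 : ℝ) := Ioo_mem_nhds (by linarith) hε
  refine ⟨h3.contMDiffAt (prod_mem_nhds hε0 (hV.mem_nhds hx)), Filter.Eventually.of_forall h0,
    ?_⟩
  filter_upwards [hV.mem_nhds hx] with y hy
  have h4 := ((h2 y hy) 0 ⟨by linarith, hε⟩).hasMFDerivAt hε0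
  rw [h4.mfderiv]
  refine Eq.trans ?_ (congrArg (fun z => (X z : E)) (h0 y))
  exact one_smul ℝ (X (flowMap X 0 y) : E)

theorem flowMap_mem_flowDomain_neg {t : ℝ} {x : M}
    (hx : x ∈ flowDomain X t) : flowMap X t x ∈ flowDomain X (-t) :=
  ⟨x, (flowMap_spec hx).symm⟩

theorem flowMap_neg_flowMap (hX : ∀ x, SmoothFieldAt X x) {t : ℝ} {x : M}
    (hx : x ∈ flowDomain X t) : flowMap X (-t) (flowMap X t x) = x :=
  (flowMap_spec hx).symm.flowMap_eq hX

theorem flowMap_add (hX : ∀ x, SmoothFieldAt X x) {s t : ℝ} {x : M} (hx : x ∈ flowDomain X s)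
    (hx' : flowMap X s x ∈ flowDomain X t) :
    x ∈ flowDomain X (s + t) ∧ flowMap X (s + t) x = flowMap X t (flowMap X s x) :=
  have h := (flowMap_spec hx).trans hX (flowMap_spec hx')
  ⟨⟨_, h⟩, h.flowMap_eq hX⟩

theorem mem_flowDomain_of_mem_uIcc {t s : ℝ} {x : M} (hx : x ∈ flowDomain X t)
    (hs : s ∈ uIcc 0 t) : x ∈ flowDomain X s := by
  obtain ⟨y, γ, h0, -, hγ⟩ := hx
  exact ⟨γ s, γ, h0, rfl, hγ.mono (uIcc_subset_uIcc left_mem_uIcc hs)⟩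

/-- The pull-back of a field of bilinear forms by the flow is differentiated by the Lie
derivative. -/
theorem hasDerivAt_pullback_flowMap (hX : ∀ x, SmoothFieldAt X x)
    {β : ∀ x : M, TangentSpace 𝓘(ℝ, E) x →L[ℝ] TangentSpace 𝓘(ℝ, E) x →L[ℝ] ℝ}
    (hβ : IsSmoothForm β) {r : ℝ}
    (hr : ∀ (x : M) (Y Z : ∀ x : M, TangentSpace 𝓘(ℝ, E) x), SmoothFieldAt Y x →
      SmoothFieldAt Z x → lieForm β X Y Z x = r * β x (Y x) (Z x))
    {s : ℝ} {x : M} (hx : x ∈ flowDomain X s) (v w : TangentSpace 𝓘(ℝ, E) x) :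
    HasDerivAt (fun s => β (flowMap X s x) (mfderiv 𝓘(ℝ, E) 𝓘(ℝ, E) (flowMap X s) x v)
        (mfderiv 𝓘(ℝ, E) 𝓘(ℝ, E) (flowMap X s) x w))
      (r * β (flowMap X s x) (mfderiv 𝓘(ℝ, E) 𝓘(ℝ, E) (flowMap X s) x v)
        (mfderiv 𝓘(ℝ, E) 𝓘(ℝ, E) (flowMap X s) x w)) s := by
  set z := flowMap X s x with hz
  obtain ⟨Y, hY, hYv⟩ := exists_smoothFieldAt (mfderiv 𝓘(ℝ, E) 𝓘(ℝ, E) (flowMap X s) x v)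
  obtain ⟨Z, hZ, hZw⟩ := exists_smoothFieldAt (mfderiv 𝓘(ℝ, E) 𝓘(ℝ, E) (flowMap X s) x w)
  have h1 := (isFlowGerm_flowMap hX z).hasDerivAt_pullback hβ hY hZ
  rw [hr z Y Z hY hZ, hYv, hZw] at h1
  rw [← sub_self s] at h1
  have h2 := HasDerivAt.comp_sub_const s s h1
  refine h2.congr_of_eventuallyEq ?_
  obtain ⟨ε, hε, V, hV, hzV, hdom, -⟩ := eventually_flowMap_eq hX z
  filter_upwards [Ioo_mem_nhds (show s - ε < s by linarith) (show s < s + ε by linarith)] with q hq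
  have hq' : q - s ∈ Ioo (-ε) ε := ⟨by linarith [hq.1], by linarith [hq.2]⟩
  -- Near `x`, `φ_q = φ_(q-s) ∘ φ_s`. This moves the derivative at time `s` to a derivative at time
  -- 0 based at `φ_s x`, where the Lie derivative is available.
  have hloc : flowMap X q =ᶠ[𝓝 x] flowMap X (q - s) ∘ flowMap X s := by
    filter_upwards [(isOpen_flowDomain hX s).mem_nhds hx,
      (contMDiffAt_flowMap hX hx).continuousAt.eventually (hV.mem_nhds hzV)] with y hy1 hy2
    have := (flowMap_add hX hy1 (hdom _ hy2 _ hq')).2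
    rwa [add_sub_cancel] at this
  have hd := mfderiv_comp x
    ((contMDiffAt_flowMap hX (hdom z hzV _ hq')).mdifferentiableAt (by simp))
    ((contMDiffAt_flowMap hX hx).mdifferentiableAt (by simp))
  have hpt : flowMap X q x = flowMap X (q - s) z := hloc.self_of_nhds
  have hm := hloc.mfderiv_eq.trans hd
  -- All tangent spaces are `E` by definition, so base points and vectors can be replaced together
  -- by equal ones.
  have gen : ∀ (z' : M) (a b a' b' : E), z' = flowMap X (q - s) z → a = a' → b = b' →
      β z' a b = β (flowMap X (q - s) z) a' b' := by
    rintro z' a b a' b' rfl rfl rfl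
    rfl
  exact gen _ _ _ _ _ hpt (congrArg (fun L : E →L[ℝ] E => L v) hm)
    (congrArg (fun L : E →L[ℝ] E => L w) hm)

end Flow

end Hypersymplectic
end

noncomputable section

set_option linter.unusedSectionVars false

namespace Hypersymplectic

/-! ### The group `Sp(1, 𝔹)` -/

section Group

theorem pairing_self (q : SplitQuaternion) :
    pairing q q = q.re ^ 2 + q.imI ^ 2 - q.imJ ^ 2 - q.imK ^ 2 := by
  simp [pairing]; ring

theorem pairing_coe (q : Sp1) : pairing (q : SplitQuaternion) q = 1 := by
  have h : (q : SplitQuaternion) * star (q : SplitQuaternion) = 1 := Unitary.coe_mul_star_self q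
  rw [pairing, h]
  rfl

theorem normalize_coe (q : Sp1) : normalize (q : SplitQuaternion) = q := by
  have h := pairing_coe q
  rw [normalize, dif_pos (by rw [h]; exact one_pos)]
  ext1
  simp [h]

theorem pairing_mul_self (p q : SplitQuaternion) :
    pairing (p * q) (p * q) = pairing p p * pairing q q := by
  simp only [pairing_self, QuaternionAlgebra.re_mul, QuaternionAlgebra.imI_mul,
    QuaternionAlgebra.imJ_mul, QuaternionAlgebra.imK_mul]
  ring

/-- Conjugation by `q` preserves the norm, so it commutes with the radial retraction. The default
value `1` is also fixed by conjugation, and no positivity of `pairing p p` is needed. -/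
theorem normalize_conj (q : Sp1) (p : SplitQuaternion) :
    normalize ((q : SplitQuaternion) * p * star (q : SplitQuaternion)) = q * normalize p * q⁻¹ := by
  have h : pairing ((q : SplitQuaternion) * p * star (q : SplitQuaternion))
      ((q : SplitQuaternion) * p * star (q : SplitQuaternion)) = pairing p p := by
    have hs : pairing (star (q : SplitQuaternion)) (star (q : SplitQuaternion)) = 1 :=
      pairing_coe (star q)
    rw [pairing_mul_self, pairing_mul_self, pairing_coe, hs]
    ring
  unfold normalize
  by_cases hp : 0 < pairing p p
  · rw [dif_pos (by rw [h]; exact hp), dif_pos hp]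
    ext1
    rw [Submonoid.coe_mul, Submonoid.coe_mul]
    simp only [h]
    rw [mul_smul_comm, smul_mul_assoc]
    rfl
  · rw [dif_neg (by rw [h]; exact hp), dif_neg hp]
    simp

/-- The linear coordinates on the split quaternions. -/
def toTuple : SplitQuaternion ≃ₗ[ℝ] (Fin 4 → ℝ) := QuaternionAlgebra.linearEquivTuple (-1) 0 1

theorem toTuple_apply (q : SplitQuaternion) : toTuple q = ![q.re, q.imI, q.imJ, q.imK] := rfl

theorem isOpen_pairing_pos :
    IsOpen {p : Fin 4 → ℝ | 0 < pairing (toTuple.symm p) (toTuple.symm p)} := by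
  have h : ∀ p : Fin 4 → ℝ, pairing (toTuple.symm p) (toTuple.symm p)
      = p 0 ^ 2 + p 1 ^ 2 - p 2 ^ 2 - p 3 ^ 2 := fun p => pairing_self _
  simp only [h]
  exact isOpen_lt continuous_const (by fun_prop)

theorem contDiff_toTuple_line (ξ : SplitQuaternion) :
    ContDiff ℝ ∞ (fun τ : ℝ => toTuple (1 + τ • ξ)) := by
  simp only [map_add, map_smul]
  exact contDiff_const.add (contDiff_id.smul contDiff_const)

theorem hasDerivAt_toTuple_line (ξ : SplitQuaternion) (t : ℝ) :
    HasDerivAt (fun τ : ℝ => toTuple (1 + τ • ξ)) (toTuple ξ) t := by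
  simp only [map_add, map_smul]
  simpa using ((hasDerivAt_id t).smul_const (toTuple ξ)).const_add (toTuple 1)

theorem pairing_one : pairing 1 1 = 1 := by simp [pairing]

theorem normalize_one : normalize 1 = 1 := normalize_coe 1

variable {E : Type*} [NormedAddCommGroup E] [NormedSpace ℝ E]
  {M : Type*} [TopologicalSpace M] [ChartedSpace E M] [IsManifold 𝓘(ℝ, E) ∞ M]
  [MulAction Sp1 M]

theorem IsSmoothAction.contMDiffAt (h : IsSmoothAction E M) {p : Fin 4 → ℝ}
    (hp : 0 < pairing (toTuple.symm p) (toTuple.symm p)) (x : M) :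
    ContMDiffAt (𝓘(ℝ, Fin 4 → ℝ).prod 𝓘(ℝ, E)) 𝓘(ℝ, E) ∞
      (fun p : (Fin 4 → ℝ) × M => normalize (toTuple.symm p.1) • p.2) (p, x) :=
  ContMDiffOn.contMDiffAt h ((isOpen_pairing_pos.preimage continuous_fst).mem_nhds hp)

theorem IsSmoothAction.contMDiff_smul (h : IsSmoothAction E M) (q : Sp1) :
    ContMDiff 𝓘(ℝ, E) 𝓘(ℝ, E) ∞ (fun y : M => q • y) := fun x => by
  have hq : 0 < pairing (toTuple.symm (toTuple q)) (toTuple.symm (toTuple q)) := by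
    rw [LinearEquiv.symm_apply_apply, pairing_coe]; exact one_pos
  have h1 := ContMDiffAt.comp (f := fun y : M => (toTuple (q : SplitQuaternion), y)) x
    (h.contMDiffAt hq x) (contMDiffAt_const.prodMk contMDiffAt_id)
  have e : (fun y : M => q • y) = (fun p : (Fin 4 → ℝ) × M => normalize (toTuple.symm p.1) • p.2) ∘
      fun y : M => (toTuple (q : SplitQuaternion), y) := by
    funext y
    simp [normalize_coe]
  rw [e]
  exact h1

/-- The differential at `1` of the orbit map of `x`, extended to the split quaternions. -/
def orbitDifferential (x : M) : (Fin 4 → ℝ) →L[ℝ] E :=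
  mfderiv 𝓘(ℝ, Fin 4 → ℝ) 𝓘(ℝ, E) (fun p => normalize (toTuple.symm p) • x) (toTuple 1)

/-- The derivative of every curve through `1` factors through one linear map. Hence `K_ξ` is linear
in `ξ`, and the line `1 + τ ξ` may be exchanged for any curve with the same velocity, such as the
circle. -/
theorem IsSmoothAction.hasMFDerivAt_curve (h : IsSmoothAction E M) {c : ℝ → SplitQuaternion}
    {t : ℝ} {c' : SplitQuaternion} (hc : HasDerivAt (fun τ => toTuple (c τ)) (toTuple c') t)
    (h1 : c t = 1) (x : M) :
    HasMFDerivAt 𝓘(ℝ, ℝ) 𝓘(ℝ, E) (fun τ => normalize (c τ) • x) t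
      ((1 : ℝ →L[ℝ] ℝ).smulRight (orbitDifferential (E := E) x (toTuple c'))) := by
  have h2 : 0 < pairing (toTuple.symm (toTuple 1)) (toTuple.symm (toTuple 1)) := by
    rw [LinearEquiv.symm_apply_apply, pairing_one]; exact one_pos
  have h3 : MDifferentiableAt 𝓘(ℝ, Fin 4 → ℝ) 𝓘(ℝ, E)
      (fun p => normalize (toTuple.symm p) • x) (toTuple (c t)) := by
    rw [h1]
    exact ((ContMDiffAt.comp (f := fun p : Fin 4 → ℝ => (p, x)) (toTuple 1)
      (h.contMDiffAt h2 x) (contMDiffAt_id.prodMk contMDiffAt_const)).mdifferentiableAt (by simp))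
  have h4 := HasMFDerivAt.comp t h3.hasMFDerivAt hc.hasFDerivAt.hasMFDerivAt
  have e : ((fun p => normalize (toTuple.symm p) • x) ∘ fun τ => toTuple (c τ))
      = fun τ => normalize (c τ) • x := by
    funext τ
    simp
  rw [e] at h4
  refine h4.congr_mfderiv ?_
  refine comp_toSpanSingleton_eq (F := Fin 4 → ℝ) (G := E) ?_
  rw [orbitDifferential, ← h1]

theorem IsSmoothAction.fundamentalField_eq (h : IsSmoothAction E M) (ξ : SplitQuaternion) (x : M) :
    fundamentalField E ξ x = orbitDifferential (E := E) x (toTuple ξ) := by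
  have h1 := h.hasMFDerivAt_curve (hasDerivAt_toTuple_line ξ 0) (by simp) x
  rw [fundamentalField, h1.mfderiv]
  exact one_smul ℝ (orbitDifferential (E := E) x (toTuple ξ))

theorem IsSmoothAction.fundamentalField_add (h : IsSmoothAction E M) (ξ ζ : SplitQuaternion)
    (x : M) : fundamentalField E (ξ + ζ) x = fundamentalField E ξ x + fundamentalField E ζ x := by
  rw [h.fundamentalField_eq, h.fundamentalField_eq, h.fundamentalField_eq, map_add, map_add]
  rfl

theorem IsSmoothAction.fundamentalField_smul (h : IsSmoothAction E M) (r : ℝ) (ξ : SplitQuaternion)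
    (x : M) : fundamentalField E (r • ξ) x = r • fundamentalField E ξ x := by
  rw [h.fundamentalField_eq, h.fundamentalField_eq, map_smul, map_smul]
  rfl

theorem eq_sum_units {ξ : SplitQuaternion} (hξ : ξ.re = 0) :
    ξ = ξ.imI • unitI + ξ.imJ • unitS + ξ.imK • unitT := by
  ext <;> simp [unitI, unitS, unitT, hξ]

theorem IsSmoothAction.fundamentalField_eq_sum (h : IsSmoothAction E M) {ξ : SplitQuaternion}
    (hξ : ξ.re = 0) (x : M) : fundamentalField E ξ x = ξ.imI • fundamentalField E unitI x
      + ξ.imJ • fundamentalField E unitS x + ξ.imK • fundamentalField E unitT x := by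
  conv_lhs => rw [eq_sum_units hξ]
  simp only [h.fundamentalField_add, h.fundamentalField_smul]

/-- The one-parameter family of transformations `y ↦ (1 + τ ξ) / |1 + τ ξ| • y`. -/
def rotation (ξ : SplitQuaternion) (τ : ℝ) (y : M) : M := normalize (1 + τ • ξ) • y

theorem IsSmoothAction.isFlowGerm (h : IsSmoothAction E M) (ξ : SplitQuaternion) (x : M) :
    IsFlowGerm (rotation ξ) (fundamentalField E ξ) x := by
  refine ⟨?_, Filter.Eventually.of_forall fun y => ?_, Filter.Eventually.of_forall fun y => rfl⟩
  · have h2 : 0 < pairing (toTuple.symm (toTuple 1)) (toTuple.symm (toTuple 1)) := by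
      rw [LinearEquiv.symm_apply_apply, pairing_one]; exact one_pos
    have h1 : ContMDiffAt (𝓘(ℝ, ℝ).prod 𝓘(ℝ, E)) (𝓘(ℝ, Fin 4 → ℝ).prod 𝓘(ℝ, E)) ∞
        (fun p : ℝ × M => (toTuple (1 + p.1 • ξ), p.2)) (0, x) :=
      ((contDiff_toTuple_line ξ).contMDiff.contMDiffAt.comp _ contMDiffAt_fst).prodMk
        contMDiffAt_snd
    have h3 := ContMDiffAt.comp_of_eq (h.contMDiffAt h2 x) h1 (by simp)
    refine h3.congr_of_eventuallyEq (Filter.Eventually.of_forall fun p => ?_)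
    simp [rotation]
  · simp [rotation, normalize_one]

theorem IsSmoothAction.smooth_fundamentalField (h : IsSmoothAction E M) (ξ : SplitQuaternion)
    (x : M) : SmoothFieldAt (fundamentalField E ξ) x :=
  (h.isFlowGerm ξ x).smooth_velocity

/-- From `q (1 + τ ξ) q̄ = 1 + τ q ξ q̄`, the transformation `q` carries the curve defining `K_ξ` at
`x` to the one defining `K_(qξq̄)` at `q • x`. -/
theorem IsSmoothAction.push_fundamentalField (h : IsSmoothAction E M) (q : Sp1)
    (ξ : SplitQuaternion) (x : M) :
    push q x (fundamentalField E ξ x) = fundamentalField E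
      ((q : SplitQuaternion) * ξ * star (q : SplitQuaternion)) (q • x) := by
  have hq : (q : SplitQuaternion) * star (q : SplitQuaternion) = 1 := Unitary.coe_mul_star_self q
  have h1 := h.hasMFDerivAt_curve (hasDerivAt_toTuple_line ξ 0) (by simp) x
  have h2 : HasMFDerivAt 𝓘(ℝ, E) 𝓘(ℝ, E) (fun y : M => q • y) (normalize (1 + (0 : ℝ) • ξ) • x)
      (push q (normalize (1 + (0 : ℝ) • ξ) • x)) :=
    ((h.contMDiff_smul q _).mdifferentiableAt (by simp)).hasMFDerivAt
  have h3 := HasMFDerivAt.comp (0 : ℝ) h2 h1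
  have e : ((fun y : M => q • y) ∘ fun τ : ℝ => normalize (1 + τ • ξ) • x)
      = fun τ : ℝ => normalize (1 + τ • ((q : SplitQuaternion) * ξ * star (q : SplitQuaternion)))
        • (q • x) := by
    funext τ
    have : (1 : SplitQuaternion) + τ • ((q : SplitQuaternion) * ξ * star (q : SplitQuaternion))
        = (q : SplitQuaternion) * (1 + τ • ξ) * star (q : SplitQuaternion) := by
      rw [mul_add, add_mul, mul_one, hq, mul_smul_comm, smul_mul_assoc]
    rw [this, normalize_conj]
    simp only [Function.comp, mul_smul, inv_smul_smul]
  rw [e] at h3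
  have h0 : normalize (1 + (0 : ℝ) • ξ) • x = x := by simp [normalize_one]
  have h4 := congrArg (fun L : ℝ →L[ℝ] E => L 1) h3.mfderiv
  refine Eq.trans ?_ h4.symm
  have e2 : ∀ (z : M) (_ : z = x) (v : E), push q x v
      = ((push q z : E →L[ℝ] E) v : E) := fun z hz v => by rw [hz]
  rw [h.fundamentalField_eq]
  refine (e2 _ h0 _).trans ?_
  change _ = ((push q (normalize (1 + (0 : ℝ) • ξ) • x) : E →L[ℝ] E)
    ((1 : ℝ) • (orbitDifferential (E := E) x (toTuple ξ))) : E)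
  rw [one_smul]

end Group

end Hypersymplectic
end

noncomputable section

set_option linter.unusedSectionVars false

namespace Hypersymplectic

/-! ### The Kähler forms and the form `γ₁` -/

section Forms

variable {n : ℕ} {E : Type*} [NormedAddCommGroup E] [NormedSpace ℝ E]
  {M : Type*} [TopologicalSpace M] [ChartedSpace E M] [IsManifold 𝓘(ℝ, E) ∞ M]

/-- The 2-form `ω_ξ = g (𝕀_ξ ·, ·)`. -/
def omega (H : HypersymplecticStructure n E M) (ξ : SplitQuaternion) (x : M) :
    TangentSpace 𝓘(ℝ, E) x →L[ℝ] TangentSpace 𝓘(ℝ, E) x →L[ℝ] ℝ :=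
  (H.g.val x).comp (H.lam ξ x)

variable (H : HypersymplecticStructure n E M)

theorem omega_apply (ξ : SplitQuaternion) (x : M) (v w : TangentSpace 𝓘(ℝ, E) x) :
    omega H ξ x v w = H.g.val x (H.lam ξ x v) w := rfl

theorem lam_apply (ξ : SplitQuaternion) (x : M) (v : TangentSpace 𝓘(ℝ, E) x) :
    H.lam ξ x v = ξ.imI • H.I.val x v + ξ.imJ • H.S.val x v + ξ.imK • H.T.val x v := rfl

theorem lam_unitI (x : M) (v : TangentSpace 𝓘(ℝ, E) x) : H.lam unitI x v = H.I.val x v := by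
  simp [lam_apply, unitI]

theorem lam_unitS (x : M) (v : TangentSpace 𝓘(ℝ, E) x) : H.lam unitS x v = H.S.val x v := by
  simp [lam_apply, unitS]

theorem lam_unitT (x : M) (v : TangentSpace 𝓘(ℝ, E) x) : H.lam unitT x v = H.T.val x v := by
  simp [lam_apply, unitT]

theorem S_T (x : M) (v : TangentSpace 𝓘(ℝ, E) x) : H.S.val x (H.T.val x v) = -H.I.val x v := by
  rw [← H.I_S, H.S_I, ← H.I_S, H.S_sq]

theorem T_S (x : M) (v : TangentSpace 𝓘(ℝ, E) x) : H.T.val x (H.S.val x v) = H.I.val x v := by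
  rw [← H.I_S, H.S_sq]

theorem I_T (x : M) (v : TangentSpace 𝓘(ℝ, E) x) : H.I.val x (H.T.val x v) = -H.S.val x v := by
  rw [← H.I_S, H.I_sq]

theorem T_I (x : M) (v : TangentSpace 𝓘(ℝ, E) x) : H.T.val x (H.I.val x v) = H.S.val x v := by
  rw [← neg_eq_iff_eq_neg.2 (H.S_I x (H.I.val x v)), H.I_sq, map_neg, neg_neg]

theorem g_lam_left (ξ : SplitQuaternion) (x : M) (v w : TangentSpace 𝓘(ℝ, E) x) :
    H.g.val x (H.lam ξ x v) w = -H.g.val x v (H.lam ξ x w) := by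
  have hI : H.g.val x (H.I.val x v) w = -H.g.val x v (H.I.val x w) := by
    rw [← H.g_I x v (H.I.val x w), H.I_sq, map_neg, neg_neg]
  have hS : H.g.val x (H.S.val x v) w = -H.g.val x v (H.S.val x w) := by
    rw [← H.g_S x v (H.S.val x w), H.S_sq]
  have hT : H.g.val x (H.T.val x v) w = -H.g.val x v (H.T.val x w) := by
    rw [← H.g_T x v (H.T.val x w), H.T_sq]
  simp only [lam_apply, map_add, map_smul, add_apply, smul_apply, hI, hS, hT, smul_eq_mul]
  ring

theorem omega_antisymm (ξ : SplitQuaternion) (x : M) (v w : TangentSpace 𝓘(ℝ, E) x) :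
    omega H ξ x v w = -omega H ξ x w v := by
  rw [omega_apply, omega_apply, g_lam_left, H.g.symm]

theorem omega_add (ξ ζ : SplitQuaternion) (x : M) (v w : TangentSpace 𝓘(ℝ, E) x) :
    omega H (ξ + ζ) x v w = omega H ξ x v w + omega H ζ x v w := by
  simp only [omega_apply, lam_apply, QuaternionAlgebra.imI_add, QuaternionAlgebra.imJ_add,
    QuaternionAlgebra.imK_add, map_add, map_smul, add_apply, smul_apply, smul_eq_mul]
  ring

theorem omega_smul (r : ℝ) (ξ : SplitQuaternion) (x : M) (v w : TangentSpace 𝓘(ℝ, E) x) :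
    omega H (r • ξ) x v w = r * omega H ξ x v w := by
  simp only [omega_apply, lam_apply, QuaternionAlgebra.imI_smul, QuaternionAlgebra.imJ_smul,
    QuaternionAlgebra.imK_smul, map_add, map_smul, add_apply, smul_apply, smul_eq_mul]
  ring

theorem SmoothFieldAt.lam {X : ∀ x : M, TangentSpace 𝓘(ℝ, E) x} {x : M} (hX : SmoothFieldAt X x)
    (ξ : SplitQuaternion) : SmoothFieldAt (fun y => H.lam ξ y (X y)) x :=
  (((hX.apply H.I).const_smul _).add ((hX.apply H.S).const_smul _)).add
    ((hX.apply H.T).const_smul _)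

theorem isSmoothForm_omega (ξ : SplitQuaternion) : IsSmoothForm (omega H ξ) :=
  fun _ _ _ hX hY => (hX.lam H ξ).contMDiffAt_metric H.g hY

theorem isSmoothForm_metric (g : PseudoMetric E M) : IsSmoothForm g.val :=
  fun _ _ _ hX hY => hX.contMDiffAt_metric g hY

/-- Cartan's formula `L_K β = d (β (K, ·))` for a closed form. -/
theorem dOne_eq_lieForm
    {β : ∀ x : M, TangentSpace 𝓘(ℝ, E) x →L[ℝ] TangentSpace 𝓘(ℝ, E) x →L[ℝ] ℝ}
    (hβ : IsClosedTwoForm fun x v w => β x v w) (hanti : ∀ x v w, β x v w = -β x w v) {x : M}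
    {K X Y : ∀ x : M, TangentSpace 𝓘(ℝ, E) x} (hK : SmoothFieldAt K x) (hX : SmoothFieldAt X x)
    (hY : SmoothFieldAt Y x) :
    dOne (fun y v => β y (K y) v) X Y x = lieForm β K X Y x := by
  have h := hβ x K X Y hK hX hY
  rw [dTwo] at h
  rw [dOne, lieForm]
  rw [hanti x (VectorField.mlieBracket 𝓘(ℝ, E) K Y x),
    hanti x (VectorField.mlieBracket 𝓘(ℝ, E) X Y x)] at h
  linarith

theorem dOne_metric_add {P Q X Y : ∀ x : M, TangentSpace 𝓘(ℝ, E) x} {x : M} (g : PseudoMetric E M)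
    (hP : SmoothFieldAt P x) (hQ : SmoothFieldAt Q x) (hX : SmoothFieldAt X x)
    (hY : SmoothFieldAt Y x) :
    dOne (fun y v => g.val y (P y + Q y) v) X Y x
      = dOne (fun y v => g.val y (P y) v) X Y x + dOne (fun y v => g.val y (Q y) v) X Y x := by
  have d : ∀ {U V : ∀ x : M, TangentSpace 𝓘(ℝ, E) x}, SmoothFieldAt U x → SmoothFieldAt V x →
      MDifferentiableAt 𝓘(ℝ, E) 𝓘(ℝ, ℝ) (fun y => g.val y (U y) (V y)) x := fun hU hV =>
    (hU.contMDiffAt_metric g hV).mdifferentiableAt (by simp)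
  simp only [dOne, map_add, add_apply]
  rw [mvfderiv_fun_add (d hP hY) (d hQ hY), mvfderiv_fun_add (d hP hX) (d hQ hX)]
  simp only [add_apply]
  ring

theorem mvfderiv_const_mul (r : ℝ) {f : M → ℝ} {x : M} (hf : MDifferentiableAt 𝓘(ℝ, E) 𝓘(ℝ, ℝ) f x)
    (w : TangentSpace 𝓘(ℝ, E) x) :
    mvfderiv 𝓘(ℝ, E) (fun y => r * f y) x w = r * mvfderiv 𝓘(ℝ, E) f x w := by
  rw [mvfderiv_fun_mul mdifferentiableAt_const hf, mvfderiv_const]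
  simp

theorem dOne_metric_smul {P X Y : ∀ x : M, TangentSpace 𝓘(ℝ, E) x} {x : M} (g : PseudoMetric E M)
    (r : ℝ) (hP : SmoothFieldAt P x) (hX : SmoothFieldAt X x) (hY : SmoothFieldAt Y x) :
    dOne (fun y v => g.val y (r • P y) v) X Y x = r * dOne (fun y v => g.val y (P y) v) X Y x := by
  have d : ∀ {U V : ∀ x : M, TangentSpace 𝓘(ℝ, E) x}, SmoothFieldAt U x → SmoothFieldAt V x →
      MDifferentiableAt 𝓘(ℝ, E) 𝓘(ℝ, ℝ) (fun y => g.val y (U y) (V y)) x := fun hU hV =>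
    (hU.contMDiffAt_metric g hV).mdifferentiableAt (by simp)
  simp only [dOne, map_smul, smul_apply, smul_eq_mul]
  rw [mvfderiv_const_mul r (d hP hY), mvfderiv_const_mul r (d hP hX)]
  ring

/-! ### Equivariance of the metric and of the Kähler forms -/

variable [MulAction Sp1 M] {H}

theorem IsPermutingAction.push_lam (h : IsPermutingAction H) (q : Sp1) {ξ : SplitQuaternion}
    (hξ : ξ.re = 0) (x : M) (v : TangentSpace 𝓘(ℝ, E) x) :
    H.lam ξ (q • x) (push q x v)
      = push q x (H.lam (star (q : SplitQuaternion) * ξ * (q : SplitQuaternion)) x v) := by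
  have hq : (q : SplitQuaternion) * star (q : SplitQuaternion) = 1 := Unitary.coe_mul_star_self q
  have hre : (star (q : SplitQuaternion) * ξ * (q : SplitQuaternion)).re = 0 := by
    simp [hξ]; ring
  rw [h.permuting q _ hre]
  congr 2
  calc ξ = ((q : SplitQuaternion) * star (q : SplitQuaternion)) * ξ
        * ((q : SplitQuaternion) * star (q : SplitQuaternion)) := by rw [hq, one_mul, mul_one]
    _ = _ := by simp only [mul_assoc]

theorem IsPermutingAction.omega_push (h : IsPermutingAction H) (q : Sp1) {ξ : SplitQuaternion}
    (hξ : ξ.re = 0) (x : M) (v w : TangentSpace 𝓘(ℝ, E) x) :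
    omega H ξ (q • x) (push q x v) (push q x w)
      = omega H (star (q : SplitQuaternion) * ξ * (q : SplitQuaternion)) x v w := by
  rw [omega_apply, h.push_lam q hξ, h.isometric, omega_apply]

/-- The commutator of split quaternions. -/
def comm (ξ ζ : SplitQuaternion) : SplitQuaternion := ξ * ζ - ζ * ξ

theorem coe_normalize {q : SplitQuaternion} (h : 0 < pairing q q) :
    (normalize q : SplitQuaternion) = (Real.sqrt (pairing q q))⁻¹ • q := by
  rw [normalize, dif_pos h]

theorem star_normalize_mul_mul {ξ ζ : SplitQuaternion} (hζ : ζ.re = 0) {τ : ℝ}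
    (hp : 0 < pairing (1 + τ • ζ) (1 + τ • ζ)) :
    star (normalize (1 + τ • ζ) : SplitQuaternion) * ξ * (normalize (1 + τ • ζ) : SplitQuaternion)
      = (pairing (1 + τ • ζ) (1 + τ • ζ))⁻¹ • (ξ + τ • comm ξ ζ - τ ^ 2 • (ζ * ξ * ζ)) := by
  have hs : star ((1 : SplitQuaternion) + τ • ζ) = 1 - τ • ζ := by
    ext <;> simp [hζ]
  have h1 : (Real.sqrt (pairing (1 + τ • ζ) (1 + τ • ζ)))⁻¹
      * (Real.sqrt (pairing (1 + τ • ζ) (1 + τ • ζ)))⁻¹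
      = (pairing (1 + τ • ζ) (1 + τ • ζ))⁻¹ := by
    rw [← mul_inv, Real.mul_self_sqrt hp.le]
  have hss : ∀ (r : ℝ) (q : SplitQuaternion), star (r • q) = r • star q := fun r q => by
    ext <;> simp
  rw [coe_normalize hp, hss, hs, smul_mul_assoc, smul_mul_smul_comm, h1, comm]
  congr 1
  simp only [sub_mul, mul_add, one_mul, mul_one, smul_mul_assoc, mul_smul_comm, smul_sub]
  module

theorem eventually_pairing_pos (ζ : SplitQuaternion) :
    ∀ᶠ τ : ℝ in 𝓝 0, 0 < pairing (1 + τ • ζ) (1 + τ • ζ) := by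
  have h : ContinuousAt (fun τ : ℝ => toTuple (1 + τ • ζ)) 0 :=
    (contDiff_toTuple_line ζ).continuous.continuousAt
  have h2 := h.eventually (isOpen_pairing_pos.mem_nhds (x := toTuple (1 + (0 : ℝ) • ζ))
    (by simp [pairing_one]))
  filter_upwards [h2] with τ hτ
  simpa using hτ

theorem hasDerivAt_quotient (a b c d : ℝ) :
    HasDerivAt (fun τ : ℝ => (1 + τ ^ 2 * d)⁻¹ * (a + τ * b - τ ^ 2 * c)) b 0 := by
  have d1 : HasDerivAt (fun τ : ℝ => 1 + τ ^ 2 * d) (2 * 0 * d) 0 := by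
    simpa using (((hasDerivAt_pow 2 (0 : ℝ)).mul_const d).const_add 1)
  have d2 := d1.fun_inv (by simp)
  have d3 := (((hasDerivAt_id' (0 : ℝ)).mul_const b).const_add a).fun_sub
    ((hasDerivAt_pow 2 (0 : ℝ)).mul_const c)
  exact (d2.fun_mul d3).congr_deriv (by simp)

/-- Pull-back by `q` turns `ω_ξ` into `ω_(q̄ξq)`. For `q = (1 + τζ)/|1 + τζ|` this is `(1 + τ²⟨ζ,
ζ⟩)⁻¹` times a quadratic polynomial in `τ`, whose linear coefficient `ω_[ξ,ζ]` is the derivative at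
0. -/
theorem IsPermutingAction.lieForm_omega [FiniteDimensional ℝ E] (h : IsPermutingAction H)
    {ξ ζ : SplitQuaternion} (hξ : ξ.re = 0) (hζ : ζ.re = 0) {x : M}
    {X Y : ∀ x : M, TangentSpace 𝓘(ℝ, E) x} (hX : SmoothFieldAt X x) (hY : SmoothFieldAt Y x) :
    lieForm (omega H ξ) (fundamentalField E ζ) X Y x = omega H (comm ξ ζ) x (X x) (Y x) := by
  have h1 := (h.smooth.isFlowGerm ζ x).hasDerivAt_pullback (isSmoothForm_omega H ξ) hX hY
  refine h1.unique ?_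
  have hsub : ∀ a b : SplitQuaternion, omega H (a - b) x (X x) (Y x)
      = omega H a x (X x) (Y x) - omega H b x (X x) (Y x) := fun a b => by
    rw [sub_eq_add_neg, ← neg_one_smul ℝ b, omega_add, omega_smul]; ring
  have e : (fun τ => omega H ξ (rotation ζ τ x) (mfderiv 𝓘(ℝ, E) 𝓘(ℝ, E) (rotation ζ τ) x (X x))
      (mfderiv 𝓘(ℝ, E) 𝓘(ℝ, E) (rotation ζ τ) x (Y x))) =ᶠ[𝓝 0]
      fun τ => (1 + τ ^ 2 * pairing ζ ζ)⁻¹ * (omega H ξ x (X x) (Y x)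
        + τ * omega H (comm ξ ζ) x (X x) (Y x) - τ ^ 2 * omega H (ζ * ξ * ζ) x (X x) (Y x)) := by
    filter_upwards [eventually_pairing_pos ζ] with τ hτ
    have hp : pairing (1 + τ • ζ) (1 + τ • ζ) = 1 + τ ^ 2 * pairing ζ ζ := by
      simp [pairing_self, hζ]; ring
    refine (h.omega_push (normalize (1 + τ • ζ)) hξ x (X x) (Y x)).trans ?_
    rw [star_normalize_mul_mul hζ hτ, omega_smul, hsub, omega_add, omega_smul, omega_smul, hp]
  exact (hasDerivAt_quotient _ _ _ _).congr_of_eventuallyEq e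

theorem IsPermutingAction.lieForm_metric [FiniteDimensional ℝ E] (h : IsPermutingAction H)
    (ζ : SplitQuaternion) {x : M}
    {X Y : ∀ x : M, TangentSpace 𝓘(ℝ, E) x} (hX : SmoothFieldAt X x) (hY : SmoothFieldAt Y x) :
    lieForm H.g.val (fundamentalField E ζ) X Y x = 0 := by
  have h1 := (h.smooth.isFlowGerm ζ x).hasDerivAt_pullback (isSmoothForm_metric H.g) hX hY
  refine h1.unique ((hasDerivAt_const (0 : ℝ) (H.g.val x (X x) (Y x))).congr_of_eventuallyEq
    (Filter.Eventually.of_forall fun τ => ?_))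
  exact h.isometric (normalize (1 + τ • ζ)) x (X x) (Y x)

/-! ### The field dual to `γ₁`, and the differentials of `γ₁` and `ρ` -/

variable (H)

/-- The vector field `½ (𝕀_ξ K_ζ - 𝕀_ζ K_ξ)` dual to the alternating part of `ι ω`. -/
def altField (ξ ζ : SplitQuaternion) : ∀ x : M, TangentSpace 𝓘(ℝ, E) x := fun x =>
  (1 / 2 : ℝ) • (H.lam ξ x (fundamentalField E ζ x) - H.lam ζ x (fundamentalField E ξ x))

/-- The vector field dual to `γ₁ (ξ)`. -/
def dualField (ξ : SplitQuaternion) : ∀ x : M, TangentSpace 𝓘(ℝ, E) x := fun x =>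
  (-(ξ.imI / 2)) • altField H unitS unitT x + (ξ.imJ / 2) • altField H unitT unitI x
    + (ξ.imK / 2) • altField H unitI unitS x

theorem gammaOne_eq (ξ : SplitQuaternion) (x : M) (v : TangentSpace 𝓘(ℝ, E) x) :
    gammaOne H ξ x v = H.g.val x (dualField H ξ x) v := by
  simp only [gammaOne, altIotaOmega, iotaOmega, dualField, altField, map_add, map_smul, map_sub,
    add_apply, smul_apply, sub_apply]

variable {H}

theorem IsPermutingAction.smooth_altField (h : IsPermutingAction H) (ξ ζ : SplitQuaternion)
    (x : M) : SmoothFieldAt (altField H ξ ζ) x := by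
  have hk := fun ξ => h.smooth.smooth_fundamentalField ξ x
  have := (((hk ζ).lam H ξ).add ((hk ξ).lam H ζ).neg).const_smul (1 / 2 : ℝ)
  refine (Iff.of_eq (congrArg (fun X => SmoothFieldAt X x) ?_)).1 this
  funext y
  rw [altField, sub_eq_add_neg]

theorem IsPermutingAction.smooth_dualField (h : IsPermutingAction H) (ξ : SplitQuaternion)
    (x : M) : SmoothFieldAt (dualField H ξ) x :=
  (((h.smooth_altField _ _ x).const_smul _).add ((h.smooth_altField _ _ x).const_smul _)).add
    ((h.smooth_altField _ _ x).const_smul _)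

/-- Both sides are bilinear and alternating in `ξ, ζ`, hence determined by the three pairs of units
that define `dualField`. -/
theorem IsPermutingAction.altField_eq (h : IsPermutingAction H) {ξ ζ : SplitQuaternion}
    (hξ : ξ.re = 0) (hζ : ζ.re = 0) (x : M) : altField H ξ ζ x = dualField H (comm ξ ζ) x := by
  simp only [dualField, altField, lam_unitI, lam_unitS, lam_unitT]
  simp only [h.smooth.fundamentalField_eq_sum hξ, h.smooth.fundamentalField_eq_sum hζ, map_add,
    map_smul, lam_apply]
  simp only [comm, QuaternionAlgebra.imI_sub, QuaternionAlgebra.imJ_sub,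
    QuaternionAlgebra.imK_sub, QuaternionAlgebra.imI_mul, QuaternionAlgebra.imJ_mul,
    QuaternionAlgebra.imK_mul, hξ, hζ]
  module

theorem IsPermutingAction.push_altField (h : IsPermutingAction H) (q : Sp1)
    {ξ ζ : SplitQuaternion} (hξ : ξ.re = 0) (hζ : ζ.re = 0) (x : M) :
    push q x (altField H ξ ζ x)
      = altField H ((q : SplitQuaternion) * ξ * star (q : SplitQuaternion))
          ((q : SplitQuaternion) * ζ * star (q : SplitQuaternion)) (q • x) := by
  rw [altField, map_smul, map_sub, h.permuting q ξ hξ, h.permuting q ζ hζ,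
    h.smooth.push_fundamentalField, h.smooth.push_fundamentalField, altField]

theorem conj_re {q ξ : SplitQuaternion} (hξ : ξ.re = 0) : (q * ξ * star q).re = 0 := by
  simp [hξ]; ring

theorem conj_comm (q : Sp1) (ξ ζ : SplitQuaternion) :
    comm ((q : SplitQuaternion) * ξ * star (q : SplitQuaternion))
        ((q : SplitQuaternion) * ζ * star (q : SplitQuaternion))
      = (q : SplitQuaternion) * comm ξ ζ * star (q : SplitQuaternion) := by
  have hq : star (q : SplitQuaternion) * (q : SplitQuaternion) = 1 := Unitary.coe_star_mul_self q
  have e : ∀ a b : SplitQuaternion, (q : SplitQuaternion) * a * star (q : SplitQuaternion)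
      * ((q : SplitQuaternion) * b * star (q : SplitQuaternion))
      = (q : SplitQuaternion) * (a * b) * star (q : SplitQuaternion) := fun a b => by
    calc _ = (q : SplitQuaternion) * a * (star (q : SplitQuaternion) * (q : SplitQuaternion)) * b
          * star (q : SplitQuaternion) := by simp only [mul_assoc]
      _ = _ := by rw [hq]; simp only [mul_assoc, mul_one]
  rw [comm, comm, e, e, mul_sub, sub_mul]

theorem IsPermutingAction.push_dualField (h : IsPermutingAction H) (q : Sp1)
    {ξ ζ : SplitQuaternion} (hξ : ξ.re = 0) (hζ : ζ.re = 0) (x : M) :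
    push q x (dualField H (comm ξ ζ) x)
      = dualField H ((q : SplitQuaternion) * comm ξ ζ * star (q : SplitQuaternion)) (q • x) := by
  rw [← h.altField_eq hξ hζ, h.push_altField q hξ hζ, h.altField_eq (conj_re hξ) (conj_re hζ),
    conj_comm]

theorem normalize_conj_self {η : SplitQuaternion} {τ : ℝ}
    (hp : 0 < pairing (1 + τ • η) (1 + τ • η)) :
    (normalize (1 + τ • η) : SplitQuaternion) * η * star (normalize (1 + τ • η) : SplitQuaternion)
      = η := by
  have hq : (normalize (1 + τ • η) : SplitQuaternion)
      * star (normalize (1 + τ • η) : SplitQuaternion) = 1 := Unitary.coe_mul_star_self _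
  have hc : (normalize (1 + τ • η) : SplitQuaternion) * η
      = η * (normalize (1 + τ • η) : SplitQuaternion) := by
    rw [coe_normalize hp, smul_mul_assoc, mul_smul_comm, add_mul, mul_add, smul_mul_assoc,
      mul_smul_comm, one_mul, mul_one]
  rw [hc, mul_assoc, hq, mul_one]

/-- Conjugation by `normalize (1 + τ • η)` fixes `η`, so the family generating `K_η` preserves the
dual field of `η`. Here `η` is a commutator because equivariance of `dualField` is obtained from
that of `altField`. -/
theorem IsPermutingAction.mlieBracket_dualField [FiniteDimensional ℝ E] (h : IsPermutingAction H)
    {ξ ζ : SplitQuaternion} (hξ : ξ.re = 0) (hζ : ζ.re = 0) (x : M) :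
    VectorField.mlieBracket 𝓘(ℝ, E) (fundamentalField E (comm ξ ζ)) (dualField H (comm ξ ζ)) x
      = 0 := by
  have : CompleteSpace E := FiniteDimensional.complete ℝ E
  refine (h.smooth.isFlowGerm (comm ξ ζ) x).mlieBracket_eq_zero (h.smooth_dualField _ x) ?_
  filter_upwards [eventually_pairing_pos (comm ξ ζ)] with τ hτ
  refine (h.push_dualField (normalize (1 + τ • comm ξ ζ)) hξ hζ x).trans ?_
  rw [normalize_conj_self hτ]
  rfl

theorem comm_unitS_unitT : comm unitS unitT = (-2 : ℝ) • unitI := by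
  ext <;> simp [comm, unitI, unitS, unitT]; norm_num

theorem comm_unitT_unitI : comm unitT unitI = (2 : ℝ) • unitS := by
  ext <;> simp [comm, unitI, unitS, unitT]; norm_num

theorem comm_unitI_unitS : comm unitI unitS = (2 : ℝ) • unitT := by
  ext <;> simp [comm, unitI, unitS, unitT]; norm_num

theorem comm_swap (ξ ζ : SplitQuaternion) : comm ζ ξ = (-1 : ℝ) • comm ξ ζ := by
  simp [comm]

theorem comm_smul (r : ℝ) (ξ ζ : SplitQuaternion) : comm (r • ξ) ζ = r • comm ξ ζ := by
  simp [comm, smul_sub]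

/-- The differential of `γ₁`, written on commutators. -/
theorem IsPermutingAction.dOne_altField [FiniteDimensional ℝ E] (h : IsPermutingAction H)
    {ξ ζ : SplitQuaternion} (hξ : ξ.re = 0) (hζ : ζ.re = 0)
    (cξ : IsClosedTwoForm fun x v w => omega H ξ x v w)
    (cζ : IsClosedTwoForm fun x v w => omega H ζ x v w) {x : M}
    {X Y : ∀ x : M, TangentSpace 𝓘(ℝ, E) x} (hX : SmoothFieldAt X x) (hY : SmoothFieldAt Y x) :
    dOne (fun y v => H.g.val y (altField H ξ ζ y) v) X Y x
      = omega H (comm ξ ζ) x (X x) (Y x) := by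
  have hk := fun ξ => h.smooth.smooth_fundamentalField ξ x
  have h1 := dOne_eq_lieForm cξ (omega_antisymm H ξ) (hk ζ) hX hY
  have h2 := dOne_eq_lieForm cζ (omega_antisymm H ζ) (hk ξ) hX hY
  -- Each half of the alternating part contributes `½ ω_[ξ,ζ]`: the minus sign of the alternation is
  -- absorbed by `[ζ, ξ] = -[ξ, ζ]`.
  rw [h.lieForm_omega hξ hζ hX hY] at h1
  rw [h.lieForm_omega hζ hξ hX hY, comm_swap, omega_smul] at h2
  have e : altField H ξ ζ = fun y => (1 / 2 : ℝ) • H.lam ξ y (fundamentalField E ζ y)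
      + (-(1 / 2) : ℝ) • H.lam ζ y (fundamentalField E ξ y) := by
    funext y
    rw [altField]
    module
  rw [e, dOne_metric_add H.g (((hk ζ).lam H ξ).const_smul _) (((hk ξ).lam H ζ).const_smul _) hX hY,
    dOne_metric_smul H.g _ ((hk ζ).lam H ξ) hX hY, dOne_metric_smul H.g _ ((hk ξ).lam H ζ) hX hY]
  simp only [omega_apply] at h1 h2 ⊢
  rw [h1, h2]
  ring

/-- `η` is one of `i`, `s`, `t`. -/
def IsBasisUnit (η : SplitQuaternion) : Prop := η = unitI ∨ η = unitS ∨ η = unitT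

theorem IsBasisUnit.re_eq {η : SplitQuaternion} (hη : IsBasisUnit η) : η.re = 0 := by
  rcases hη with rfl | rfl | rfl <;> rfl

theorem IsBasisUnit.closed_omega {η : SplitQuaternion} (hη : IsBasisUnit η) :
    IsClosedTwoForm fun x v w => omega H η x v w := by
  rcases hη with rfl | rfl | rfl
  · simpa only [omega_apply, lam_unitI] using H.closed_I
  · simpa only [omega_apply, lam_unitS] using H.closed_S
  · simpa only [omega_apply, lam_unitT] using H.closed_T

/-- Transfers results on commutators to the units; the factors `-½, ½, ½` undo `[s, t] = -2i`, `[t,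
i] = 2s`, `[i, s] = 2t`. -/
theorem IsBasisUnit.exists_comm {η : SplitQuaternion} (hη : IsBasisUnit η) :
    ∃ (r : ℝ) (ξ ζ : SplitQuaternion), IsBasisUnit ξ ∧ IsBasisUnit ζ ∧ comm (r • ξ) ζ = η := by
  rcases hη with rfl | rfl | rfl
  · exact ⟨-1 / 2, unitS, unitT, Or.inr (Or.inl rfl), Or.inr (Or.inr rfl), by
      rw [comm_smul, comm_unitS_unitT, smul_smul]; norm_num⟩
  · exact ⟨1 / 2, unitT, unitI, Or.inr (Or.inr rfl), Or.inl rfl, by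
      rw [comm_smul, comm_unitT_unitI, smul_smul]; norm_num⟩
  · exact ⟨1 / 2, unitI, unitS, Or.inl rfl, Or.inr (Or.inl rfl), by
      rw [comm_smul, comm_unitI_unitS, smul_smul]; norm_num⟩

theorem dualField_smul (r : ℝ) (ξ : SplitQuaternion) (x : M) :
    dualField H (r • ξ) x = r • dualField H ξ x := by
  simp only [dualField, QuaternionAlgebra.imI_smul, QuaternionAlgebra.imJ_smul,
    QuaternionAlgebra.imK_smul, smul_eq_mul]
  module

theorem IsPermutingAction.mlieBracket_dualField_unit [FiniteDimensional ℝ E]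
    (h : IsPermutingAction H) {η : SplitQuaternion} (hη : IsBasisUnit η) (x : M) :
    VectorField.mlieBracket 𝓘(ℝ, E) (fundamentalField E η) (dualField H η) x = 0 := by
  obtain ⟨r, ξ, ζ, hξ, hζ, rfl⟩ := hη.exists_comm
  exact h.mlieBracket_dualField (by simp [hξ.re_eq]) hζ.re_eq x

/-- `d γ₁ (η) = ω_η`. -/
theorem IsPermutingAction.dOne_dualField [FiniteDimensional ℝ E] (h : IsPermutingAction H)
    {η : SplitQuaternion} (hη : IsBasisUnit η) {x : M}
    {X Y : ∀ x : M, TangentSpace 𝓘(ℝ, E) x} (hX : SmoothFieldAt X x) (hY : SmoothFieldAt Y x) :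
    dOne (fun y v => H.g.val y (dualField H η y) v) X Y x = omega H η x (X x) (Y x) := by
  obtain ⟨r, ξ, ζ, hξ, hζ, rfl⟩ := hη.exists_comm
  have e : dualField H (comm (r • ξ) ζ) = fun y => r • altField H ξ ζ y := by
    funext y
    rw [comm_smul, dualField_smul, h.altField_eq hξ.re_eq hζ.re_eq]
  rw [e, dOne_metric_smul H.g _ (h.smooth_altField ξ ζ x) hX hY,
    h.dOne_altField hξ.re_eq hζ.re_eq hξ.closed_omega hζ.closed_omega hX hY, comm_smul, omega_smul]

theorem rho_eq (ξ ζ : SplitQuaternion) (x : M) :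
    rho H ξ ζ x = H.g.val x (dualField H ξ x) (fundamentalField E ζ x) :=
  gammaOne_eq H ξ x _

theorem IsPermutingAction.contMDiff_rho (h : IsPermutingAction H) (ξ ζ : SplitQuaternion) :
    ContMDiff 𝓘(ℝ, E) 𝓘(ℝ, ℝ) ∞ (rho H ξ ζ) := fun x => by
  have := (h.smooth_dualField ξ x).contMDiffAt_metric H.g (h.smooth.smooth_fundamentalField ζ x)
  exact this.congr_of_eventuallyEq (Filter.Eventually.of_forall fun y => rho_eq ξ ζ y)

/-- Cartan's formula `d(γ(K)) = L_K γ - dγ(K, ·)` for `γ = γ₁(η)`, `K = K_η`. The Lie derivative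
vanishes because `K_η` preserves both `g` and the dual field of `η`, and `dγ = ω_η`. -/
theorem IsPermutingAction.mvfderiv_rho [FiniteDimensional ℝ E] (h : IsPermutingAction H)
    {η : SplitQuaternion} (hη : IsBasisUnit η) (x : M) (v : TangentSpace 𝓘(ℝ, E) x) :
    mvfderiv 𝓘(ℝ, E) (rho H η η) x v
      = -H.g.val x (H.lam η x (fundamentalField E η x)) v := by
  obtain ⟨X, hX, rfl⟩ := exists_smoothFieldAt v
  have hK := h.smooth.smooth_fundamentalField η x
  have h1 := h.dOne_dualField hη hX hK
  have h2 := h.lieForm_metric η (h.smooth_dualField η x) hX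
  rw [lieForm, h.mlieBracket_dualField_unit hη] at h2
  have h3 : VectorField.mlieBracket 𝓘(ℝ, E) X (fundamentalField E η) x
      = -VectorField.mlieBracket 𝓘(ℝ, E) (fundamentalField E η) X x := by
    rw [VectorField.mlieBracket_swap]
    rfl
  rw [dOne, h3, map_neg] at h1
  have e : rho H η η = fun y => H.g.val y (dualField H η y) (fundamentalField E η y) := by
    funext y
    exact rho_eq η η y
  rw [e, ← omega_apply, omega_antisymm, neg_neg, ← h1]
  simp only [map_zero, zero_apply] at h2
  linarith

end Forms

/-! ### The gradient of `ρ₀` when `ρ₂ = 0` -/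

section Gradient

variable {n : ℕ} {E : Type*} [NormedAddCommGroup E] [NormedSpace ℝ E] [FiniteDimensional ℝ E]
  {M : Type*} [TopologicalSpace M] [ChartedSpace E M] [IsManifold 𝓘(ℝ, E) ∞ M]
  [MulAction Sp1 M] {H : HypersymplecticStructure n E M}

variable (H) in
/-- The trace free symmetric part `ρ₂` vanishes. -/
def RhoTwoVanishes : Prop :=
  ∀ ξ ξ' : SplitQuaternion, ξ.re = 0 → ξ'.re = 0 → ∀ x : M, rhoTwo H ξ ξ' x = 0

theorem RhoTwoVanishes.rho_self (h2 : RhoTwoVanishes H) {η : SplitQuaternion}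
    (hη : η.re = 0) (x : M) : rho H η η x = rhoZero H x * pairing η η := by
  have := h2 η η hη hη x
  rw [rhoTwo] at this
  linarith

theorem PseudoMetric.eq_of_forall (g : PseudoMetric E M) {x : M} {v v' : TangentSpace 𝓘(ℝ, E) x}
    (h : ∀ w, g.val x v w = g.val x v' w) : v = v' := by
  rw [← sub_eq_zero]
  refine g.nondegenerate x _ fun w => ?_
  rw [map_sub, sub_apply, h w, sub_self]

theorem IsPermutingAction.contMDiff_rhoZero (h : IsPermutingAction H) :
    ContMDiff 𝓘(ℝ, E) 𝓘(ℝ, ℝ) ∞ (rhoZero H) :=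
  contMDiff_const.mul (((h.contMDiff_rho unitI unitI).sub (h.contMDiff_rho unitS unitS)).sub
    (h.contMDiff_rho unitT unitT))

/-- When `ρ₂ = 0`, the functions `ρ(η, η)` are the multiples `⟨η, η⟩ ρ₀` of one function, so
`mvfderiv_rho` gives three expressions for the same gradient. -/
theorem IsPermutingAction.gradient_rhoZero (h : IsPermutingAction H) (h2 : RhoTwoVanishes H)
    {η : SplitQuaternion} (hη : IsBasisUnit η) (x : M) :
    pairing η η • gradient H.g (rhoZero H) x = -H.lam η x (fundamentalField E η x) := by
  have hs := h.contMDiff_rhoZero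
  refine H.g.eq_of_forall fun w => ?_
  have e : rho H η η = fun y => pairing η η * rhoZero H y := by
    funext y
    rw [h2.rho_self hη.re_eq, mul_comm]
  have h3 := h.mvfderiv_rho hη x w
  rw [e, mvfderiv_const_mul _ ((hs x).mdifferentiableAt (by simp))] at h3
  rw [map_smul, smul_apply, gradient_spec, smul_eq_mul, h3, map_neg, neg_apply]

end Gradient

end Hypersymplectic
end

noncomputable section

set_option linter.unusedSectionVars false

namespace Hypersymplectic

/-! ### The Euler field -/

section Euler

variable {n : ℕ} {E : Type*} [NormedAddCommGroup E] [NormedSpace ℝ E] [FiniteDimensional ℝ E]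
  {M : Type*} [TopologicalSpace M] [ChartedSpace E M] [IsManifold 𝓘(ℝ, E) ∞ M]
  [MulAction Sp1 M] {H : HypersymplecticStructure n E M}

variable (H) in
/-- The gradient field of `ρ₀`. -/
abbrev euler : ∀ x : M, TangentSpace 𝓘(ℝ, E) x := gradient H.g (rhoZero H)

theorem pairing_unitI : pairing unitI unitI = 1 := by simp [pairing_self, unitI]
theorem pairing_unitS : pairing unitS unitS = -1 := by simp [pairing_self, unitS]
theorem pairing_unitT : pairing unitT unitT = -1 := by simp [pairing_self, unitT]

theorem IsBasisUnit.pairing_ne_zero {η : SplitQuaternion} (hη : IsBasisUnit η) :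
    pairing η η ≠ 0 := by
  rcases hη with rfl | rfl | rfl
  · rw [pairing_unitI]; norm_num
  · rw [pairing_unitS]; norm_num
  · rw [pairing_unitT]; norm_num

theorem IsBasisUnit.lam_lam {η : SplitQuaternion} (hη : IsBasisUnit η) (x : M)
    (v : TangentSpace 𝓘(ℝ, E) x) : H.lam η x (H.lam η x v) = -(pairing η η • v) := by
  rcases hη with rfl | rfl | rfl
  · rw [lam_unitI, lam_unitI, H.I_sq, pairing_unitI, one_smul]
  · rw [lam_unitS, lam_unitS, H.S_sq, pairing_unitS, neg_one_smul, neg_neg]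
  · rw [lam_unitT, lam_unitT, H.T_sq, pairing_unitT, neg_one_smul, neg_neg]

/-- Apply `𝕀_η` to `gradient_rhoZero` and use `𝕀_η² = -⟨η, η⟩`; the common nonzero factor `⟨η, η⟩`
cancels. The single field `𝓔` thus determines the whole infinitesimal action. -/
theorem IsPermutingAction.lam_euler (h : IsPermutingAction H) (h2 : RhoTwoVanishes H)
    {η : SplitQuaternion} (hη : IsBasisUnit η) (x : M) :
    H.lam η x (euler H x) = fundamentalField E η x := by
  have h1 := congrArg (H.lam η x) (h.gradient_rhoZero h2 hη x)
  rw [map_smul, map_neg, hη.lam_lam, neg_neg] at h1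
  exact smul_right_injective _ hη.pairing_ne_zero h1

theorem IsPermutingAction.euler_eq (h : IsPermutingAction H) (h2 : RhoTwoVanishes H) (x : M) :
    euler H x = -H.lam unitI x (fundamentalField E unitI x) := by
  rw [← h.gradient_rhoZero h2 (Or.inl rfl), pairing_unitI, one_smul]

theorem IsPermutingAction.smooth_euler (h : IsPermutingAction H) (h2 : RhoTwoVanishes H) (x : M) :
    SmoothFieldAt (euler H) x := by
  have e : euler H = fun y => -H.lam unitI y (fundamentalField E unitI y) := by
    funext y
    exact h.euler_eq h2 y
  rw [e]
  exact ((h.smooth.smooth_fundamentalField unitI x).lam H unitI).neg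

/-- After substituting `K_η = 𝕀_η 𝓔`, the quaternion relations collapse the products of
endomorphisms; for `η = i` the coefficient is `-½ · ½ (ST - TS) = ½ I`. -/
theorem IsPermutingAction.dualField_eq (h : IsPermutingAction H) (h2 : RhoTwoVanishes H)
    {η : SplitQuaternion} (hη : IsBasisUnit η) (x : M) :
    dualField H η x = (1 / 2 : ℝ) • H.lam η x (euler H x) := by
  have hI : fundamentalField E unitI x = H.I.val x (euler H x) := by
    rw [← h.lam_euler h2 (Or.inl rfl), lam_unitI]
  have hS : fundamentalField E unitS x = H.S.val x (euler H x) := by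
    rw [← h.lam_euler h2 (Or.inr (Or.inl rfl)), lam_unitS]
  have hT : fundamentalField E unitT x = H.T.val x (euler H x) := by
    rw [← h.lam_euler h2 (Or.inr (Or.inr rfl)), lam_unitT]
  rcases hη with rfl | rfl | rfl <;>
  · simp only [dualField, altField, lam_unitI, lam_unitS, lam_unitT, hI, hS, hT, S_T, T_S, I_T, T_I,
      H.I_S, H.S_I]
    simp only [unitI, unitS, unitT]
    module

/-- `ρ₀ = ρ(i, i)` pairs `½ I𝓔` with `K_i = I𝓔`. This turns `dρ₀(𝓔) = g(𝓔, 𝓔)` into `2ρ₀`, which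
governs the growth of `ρ₀` along the flow. -/
theorem IsPermutingAction.rhoZero_eq (h : IsPermutingAction H) (h2 : RhoTwoVanishes H) (x : M) :
    rhoZero H x = (1 / 2 : ℝ) * H.g.val x (euler H x) (euler H x) := by
  have h1 := h2.rho_self (η := unitI) rfl x
  rw [pairing_unitI, mul_one] at h1
  rw [← h1, rho_eq, h.dualField_eq h2 (Or.inl rfl), ← h.lam_euler h2 (Or.inl rfl), lam_unitI,
    map_smul, smul_apply, H.g_I, smul_eq_mul]

theorem IsPermutingAction.dOne_lam_euler (h : IsPermutingAction H) (h2 : RhoTwoVanishes H)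
    {η : SplitQuaternion} (hη : IsBasisUnit η) {x : M}
    {X Y : ∀ x : M, TangentSpace 𝓘(ℝ, E) x} (hX : SmoothFieldAt X x) (hY : SmoothFieldAt Y x) :
    dOne (fun y v => H.g.val y (H.lam η y (euler H y)) v) X Y x
      = 2 * omega H η x (X x) (Y x) := by
  have e : dualField H η = fun y => (1 / 2 : ℝ) • H.lam η y (euler H y) := by
    funext y
    exact h.dualField_eq h2 hη y
  have h1 := h.dOne_dualField hη hX hY
  rw [e, dOne_metric_smul H.g _ ((h.smooth_euler h2 x).lam H η) hX hY] at h1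
  linarith

/-- Skewness of `𝕀_η` gives `𝕀_η dρ₀ = g(𝕀_η 𝓔, ·) = 2 γ₁(η)`, and `dγ₁(η) = ω_η`. -/
theorem IsPermutingAction.half_dOne (h : IsPermutingAction H) (h2 : RhoTwoVanishes H)
    {η : SplitQuaternion} (hη : IsBasisUnit η) {x : M}
    {X Y : ∀ x : M, TangentSpace 𝓘(ℝ, E) x} (hX : SmoothFieldAt X x) (hY : SmoothFieldAt Y x) :
    (1 / 2 : ℝ) * dOne (fun y v => -mvfderiv 𝓘(ℝ, E) (rhoZero H) y (H.lam η y v)) X Y x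
      = H.g.val x (H.lam η x (X x)) (Y x) := by
  have e : (fun (y : M) (v : TangentSpace 𝓘(ℝ, E) y) =>
      -mvfderiv 𝓘(ℝ, E) (rhoZero H) y (H.lam η y v))
      = fun y v => H.g.val y (H.lam η y (euler H y)) v := by
    funext y v
    rw [g_lam_left, gradient_spec]
  rw [e, h.dOne_lam_euler h2 hη hX hY, omega_apply]
  ring

theorem IsPermutingAction.isHypersymplecticPotential (h : IsPermutingAction H)
    (h2 : RhoTwoVanishes H) : IsHypersymplecticPotential H (rhoZero H) := by
  refine ⟨h.contMDiff_rhoZero, fun x X Y hX hY => ?_, fun x X Y hX hY => ?_,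
    fun x X Y hX hY => ?_⟩
  · simpa only [lam_unitI] using h.half_dOne h2 (Or.inl rfl) hX hY
  · simpa only [lam_unitS] using h.half_dOne h2 (Or.inr (Or.inl rfl)) hX hY
  · simpa only [lam_unitT] using h.half_dOne h2 (Or.inr (Or.inr rfl)) hX hY

theorem IsPermutingAction.lieForm_omega_euler (h : IsPermutingAction H) (h2 : RhoTwoVanishes H)
    {η : SplitQuaternion} (hη : IsBasisUnit η) {x : M}
    {X Y : ∀ x : M, TangentSpace 𝓘(ℝ, E) x} (hX : SmoothFieldAt X x) (hY : SmoothFieldAt Y x) :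
    lieForm (omega H η) (euler H) X Y x = 2 * omega H η x (X x) (Y x) := by
  rw [← dOne_eq_lieForm hη.closed_omega (omega_antisymm H η) (h.smooth_euler h2 x) hX hY]
  exact h.dOne_lam_euler h2 hη hX hY

/-- The Euler field preserves `I`. -/
theorem IsPermutingAction.mlieBracket_euler_I (h : IsPermutingAction H) (h2 : RhoTwoVanishes H)
    {x : M} {Y : ∀ x : M, TangentSpace 𝓘(ℝ, E) x} (hY : SmoothFieldAt Y x) :
    VectorField.mlieBracket 𝓘(ℝ, E) (euler H) (fun y => H.I.val y (Y y)) x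
      = H.I.val x (VectorField.mlieBracket 𝓘(ℝ, E) (euler H) Y x) := by
  -- Both sides of `ω_T = -ω_S(·, I ·)` are governed by forms of weight 2 under `𝓔`. Comparing their
  -- Lie derivatives leaves `ω_S(X, [𝓔, IY] - I[𝓔, Y]) = 0`.
  have e : ∀ (y : M) (v w : TangentSpace 𝓘(ℝ, E) y),
      omega H unitT y v w = -omega H unitS y v (H.I.val y w) := fun y v w => by
    have := g_lam_left H unitI y (H.S.val y v) w
    rw [lam_unitI, lam_unitI, H.I_S] at this
    rw [omega_apply, omega_apply, lam_unitT, lam_unitS, this]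
  have key : ∀ v : TangentSpace 𝓘(ℝ, E) x, H.g.val x (H.S.val x v)
      (VectorField.mlieBracket 𝓘(ℝ, E) (euler H) (fun y => H.I.val y (Y y)) x
        - H.I.val x (VectorField.mlieBracket 𝓘(ℝ, E) (euler H) Y x)) = 0 := by
    intro v
    obtain ⟨X, hX, rfl⟩ := exists_smoothFieldAt v
    have hT := h.lieForm_omega_euler h2 (Or.inr (Or.inr rfl)) hX hY
    have hS := h.lieForm_omega_euler h2 (Or.inr (Or.inl rfl)) hX (hY.apply H.I)
    have hm : mvfderiv 𝓘(ℝ, E) (fun y => omega H unitT y (X y) (Y y)) x (euler H x)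
        = -mvfderiv 𝓘(ℝ, E) (fun y => omega H unitS y (X y) (H.I.val y (Y y))) x (euler H x) := by
      simp only [e]
      rw [mvfderiv_fun_neg]
      rfl
    rw [lieForm, hm] at hT
    rw [lieForm] at hS
    simp only [e] at hT
    rw [map_sub]
    simp only [omega_apply, lam_unitS] at hT hS
    linarith
  rw [← sub_eq_zero]
  refine H.g.nondegenerate x _ fun w => ?_
  have := key (H.S.val x w)
  rwa [H.S_sq, H.g.symm] at this

/-- `g = ω_I(·, I ·)`, where `ω_I` has weight 2 under `𝓔` and `I` has weight 0. -/
theorem IsPermutingAction.lieForm_metric_euler (h : IsPermutingAction H) (h2 : RhoTwoVanishes H)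
    {x : M} {X Y : ∀ x : M, TangentSpace 𝓘(ℝ, E) x} (hX : SmoothFieldAt X x)
    (hY : SmoothFieldAt Y x) :
    lieForm H.g.val (euler H) X Y x = 2 * H.g.val x (X x) (Y x) := by
  have e : ∀ (y : M) (v w : TangentSpace 𝓘(ℝ, E) y),
      H.g.val y v w = omega H unitI y v (H.I.val y w) := fun y v w => by
    rw [omega_apply, lam_unitI, H.g_I]
  have hI := h.lieForm_omega_euler h2 (Or.inl rfl) hX (hY.apply H.I)
  rw [lieForm, h.mlieBracket_euler_I h2 hY] at hI
  rw [lieForm]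
  simpa only [← e] using hI

/-! ### The covariant derivative of the Euler field and its zeros -/

variable {nabla : CovariantDerivative 𝓘(ℝ, E) E (TangentSpace 𝓘(ℝ, E) : M → Type _)}

/-- `∇ 𝓔 = id`. -/
theorem IsPermutingAction.nabla_euler (h : IsPermutingAction H) (h2 : RhoTwoVanishes H)
    (hn : IsLeviCivita H.g nabla) (x : M) (v : TangentSpace 𝓘(ℝ, E) x) :
    nabla (euler H) x v = v := by
  have : CompleteSpace E := FiniteDimensional.complete ℝ E
  have hE := h.smooth_euler h2 x
  refine H.g.eq_of_forall fun w => ?_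
  obtain ⟨X, hX, rfl⟩ := exists_smoothFieldAt v
  obtain ⟨Y, hY, rfl⟩ := exists_smoothFieldAt w
  -- `a1` says that `g(∇𝓔, ·)` is symmetric, as `𝓔` is a gradient; `a2` says that its symmetric part
  -- is `g`, by `L_𝓔 g = 2g`.
  have a1 := mvfderiv_mvfderiv_sub (h.contMDiff_rhoZero x) hX hY
  simp only [← gradient_spec H.g (rhoZero H)] at a1
  have a2 := h.lieForm_metric_euler h2 hX hY
  rw [lieForm] at a2
  have m1 := hn.metric x (X x) _ _ hE.mdifferentiableAt hY.mdifferentiableAt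
  have m2 := hn.metric x (Y x) _ _ hE.mdifferentiableAt hX.mdifferentiableAt
  have m3 := hn.metric x (euler H x) _ _ hX.mdifferentiableAt hY.mdifferentiableAt
  have t1 := hn.torsion_free x _ _ hX.mdifferentiableAt hY.mdifferentiableAt
  have t2 := hn.torsion_free x _ _ hE.mdifferentiableAt hX.mdifferentiableAt
  have t3 := hn.torsion_free x _ _ hE.mdifferentiableAt hY.mdifferentiableAt
  rw [m1, m2, ← t1, map_sub] at a1
  rw [m3, ← t2, ← t3, map_sub, map_sub, sub_apply] at a2
  have s1 := H.g.symm x (nabla (euler H) x (Y x)) (X x)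
  linarith

theorem IsPermutingAction.hessian_rhoZero (h : IsPermutingAction H) (h2 : RhoTwoVanishes H)
    (hn : IsLeviCivita H.g nabla) (x : M) (v : TangentSpace 𝓘(ℝ, E) x)
    {Y : ∀ x : M, TangentSpace 𝓘(ℝ, E) x} (hY : SmoothFieldAt Y x) :
    hessian nabla (rhoZero H) x v Y = H.g.val x v (Y x) := by
  have m1 := hn.metric x v _ _ (h.smooth_euler h2 x).mdifferentiableAt hY.mdifferentiableAt
  rw [h.nabla_euler h2 hn] at m1
  simp only [hessian, ← gradient_spec H.g (rhoZero H)]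
  linarith

/-- The rotation by the angle `t` in the plane of `1` and `i`. -/
def circle (t : ℝ) : SplitQuaternion := ⟨Real.cos t, Real.sin t, 0, 0⟩

theorem pairing_circle (t : ℝ) : pairing (circle t) (circle t) = 1 := by
  simp [pairing_self, circle]

theorem circle_mem (t : ℝ) : circle t ∈ unitary SplitQuaternion := by
  rw [Unitary.mem_iff, star_mul_eq, mul_star_eq, pairing_circle]
  exact ⟨rfl, rfl⟩

theorem normalize_circle (t : ℝ) : normalize (circle t) = ⟨circle t, circle_mem t⟩ :=
  normalize_coe ⟨circle t, circle_mem t⟩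

theorem normalize_circle_add (s t : ℝ) :
    normalize (circle (s + t)) = normalize (circle s) * normalize (circle t) := by
  rw [normalize_circle, normalize_circle, normalize_circle]
  ext1
  change circle (s + t) = circle s * circle t
  ext <;> simp [circle, Real.cos_add, Real.sin_add] <;> ring

theorem hasDerivAt_circle : HasDerivAt (fun t => toTuple (circle t)) (toTuple unitI) 0 := by
  rw [hasDerivAt_pi]
  intro i
  fin_cases i
  · simpa [toTuple_apply, circle, unitI] using Real.hasDerivAt_cos 0
  · simpa [toTuple_apply, circle, unitI] using Real.hasDerivAt_sin 0
  · simpa [toTuple_apply, circle, unitI] using hasDerivAt_const (0 : ℝ) (0 : ℝ)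
  · simpa [toTuple_apply, circle, unitI] using hasDerivAt_const (0 : ℝ) (0 : ℝ)

/-- The circle is a one-parameter group, so its velocity at time 0 determines the velocity of the
orbit at every time. -/
theorem IsSmoothAction.isMIntegralCurve_circle (h : IsSmoothAction E M) (x : M) :
    IsMIntegralCurve (fun t => normalize (circle t) • x) (fundamentalField E unitI) := by
  intro t
  -- Time zero is written `t - t` to match the composition with `s ↦ s - t`.
  have h1 := h.hasMFDerivAt_curve (t := t - t) (c := circle) (c' := unitI)
    (by rw [sub_self]; exact hasDerivAt_circle) (by ext <;> simp [circle]) (normalize (circle t) • x)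
  have h2 : HasMFDerivAt 𝓘(ℝ, ℝ) 𝓘(ℝ, ℝ) (fun s : ℝ => s - t) t (ContinuousLinearMap.id ℝ ℝ) :=
    ((hasFDerivAt_id t).sub_const t).hasMFDerivAt
  have h3 := HasMFDerivAt.comp (f := fun s : ℝ => s - t) t h1 h2
  have e : ((fun τ => normalize (circle τ) • normalize (circle t) • x) ∘ fun s : ℝ => s - t)
      = fun s => normalize (circle s) • x := by
    funext s
    simp only [Function.comp]
    rw [smul_smul, ← normalize_circle_add, sub_add_cancel]
  rw [e] at h3
  refine h3.congr_mfderiv ?_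
  exact congrArg (fun v : E => (1 : ℝ →L[ℝ] ℝ).smulRight v)
    (h.fundamentalField_eq unitI (normalize (circle t) • x)).symm

/-- At a zero of `K_i` the circle orbit is constant, by uniqueness of integral curves. At angle `π`
this makes `-1` fix the point, against freeness. -/
theorem IsSmoothAction.fundamentalField_unitI_ne_zero [T2Space M] (h : IsSmoothAction E M)
    (hfree : ∀ (q : Sp1) (x : M), q • x = x → q = 1) (x : M) :
    fundamentalField E unitI x ≠ 0 := by
  intro h0
  have h1 := isMIntegralCurve_Ioo_eq_of_contMDiff_boundaryless (t₀ := 0)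
    (contMDiff_of_smoothFieldAt (h.smooth_fundamentalField unitI))
    (h.isMIntegralCurve_circle x) (isMIntegralCurve_const h0)
    (by
      have : circle 0 = 1 := by ext <;> simp [circle]
      simp [this, normalize_one])
  have h2 := hfree _ x (congrFun h1 Real.pi)
  rw [normalize_circle] at h2
  have h3 := congrArg (fun q : Sp1 => (q : SplitQuaternion).re) h2
  simp [circle] at h3
  norm_num at h3

theorem IsPermutingAction.euler_ne_zero [T2Space M] (h : IsPermutingAction H)
    (h2 : RhoTwoVanishes H) (hfree : ∀ (q : Sp1) (x : M), q • x = x → q = 1) (x : M) :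
    euler H x ≠ 0 := fun h0 => by
  have h1 := h.lam_euler h2 (Or.inl rfl) x
  rw [h0, map_zero] at h1
  exact h.smooth.fundamentalField_unitI_ne_zero hfree x h1.symm

end Euler

end Hypersymplectic
end

noncomputable section

set_option linter.unusedSectionVars false

namespace Hypersymplectic

/-! ### Geodesics along which a field with `∇ Z = id` is tangent -/

section Geodesic

variable {E : Type*} [NormedAddCommGroup E] [NormedSpace ℝ E] [FiniteDimensional ℝ E]
  {M : Type*} [TopologicalSpace M] [ChartedSpace E M] [IsManifold 𝓘(ℝ, E) ∞ M]
  {g : PseudoMetric E M}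
  {nabla : CovariantDerivative 𝓘(ℝ, E) E (TangentSpace 𝓘(ℝ, E) : M → Type _)}

scoped instance normedAddCommGroupForms : NormedAddCommGroup (E →L[ℝ] E →L[ℝ] ℝ) :=
  ContinuousLinearMap.toNormedAddCommGroup

scoped instance normedSpaceForms : NormedSpace ℝ (E →L[ℝ] E →L[ℝ] ℝ) :=
  ContinuousLinearMap.toNormedSpace

theorem coordField_sub (x₀ : M) (v w : E) (y : M) :
    coordField x₀ (v - w) y = coordField x₀ v y - coordField x₀ w y :=
  map_sub (mfderiv 𝓘(ℝ, E) 𝓘(ℝ, E) (extChartAt 𝓘(ℝ, E) x₀).symm (extChartAt 𝓘(ℝ, E) x₀ y)) v w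

theorem coordVec_sub (x₀ y : M) (v w : TangentSpace 𝓘(ℝ, E) y) :
    coordVec x₀ y (v - w) = coordVec x₀ y v - coordVec x₀ y w :=
  map_sub (mfderiv 𝓘(ℝ, E) 𝓘(ℝ, E) (extChartAt 𝓘(ℝ, E) x₀) y) v w

theorem inChart_extChartAt {x₀ y : M} (hy : y ∈ (chartAt E x₀).source)
    (X : ∀ x : M, TangentSpace 𝓘(ℝ, E) x) :
    inChart x₀ X (extChartAt 𝓘(ℝ, E) x₀ y) = coordVec x₀ y (X y) :=
  congrArg (fun z => coordVec x₀ z (X z))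
    ((extChartAt 𝓘(ℝ, E) x₀).left_inv (x := y) (by simpa using hy))

theorem inChart_coordField {x₀ y : M} (hy : y ∈ (chartAt E x₀).source) (w : E) :
    inChart x₀ (coordField x₀ w) =ᶠ[𝓝 (extChartAt 𝓘(ℝ, E) x₀ y)] fun _ => w := by
  have hu : extChartAt 𝓘(ℝ, E) x₀ y ∈ (extChartAt 𝓘(ℝ, E) x₀).target :=
    (extChartAt 𝓘(ℝ, E) x₀).map_source (by simpa using hy)
  filter_upwards [(isOpen_extChartAt_target (I := 𝓘(ℝ, E)) x₀).mem_nhds hu] with u hu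
  exact coordVec_coordField (by simpa using (extChartAt 𝓘(ℝ, E) x₀).map_target hu) w

theorem mlieBracket_coordField {x₀ y : M} (hy : y ∈ (chartAt E x₀).source) (v w : E) :
    VectorField.mlieBracket 𝓘(ℝ, E) (coordField x₀ v) (coordField x₀ w) y = 0 := by
  have : CompleteSpace E := FiniteDimensional.complete ℝ E
  refine coordVec_injective hy ?_
  rw [coordVec_mlieBracket hy (smoothFieldAt_coordField hy v) (smoothFieldAt_coordField hy w),
    VectorField.lieBracket, (inChart_coordField hy v).fderiv_eq,
    (inChart_coordField hy w).fderiv_eq, coordVec_zero]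
  simp

theorem nabla_sub {x : M} {X Y : ∀ x : M, TangentSpace 𝓘(ℝ, E) x} (hX : SmoothFieldAt X x)
    (hY : SmoothFieldAt Y x) (v : TangentSpace 𝓘(ℝ, E) x) :
    nabla (fun y => X y - Y y) x v = nabla X x v - nabla Y x v := by
  have hc := nabla.isCovariantDerivativeOn (s := univ)
  have hY' : SmoothFieldAt (fun y => X y - Y y) x := by
    simp only [sub_eq_add_neg]
    exact hX.add hY.neg
  have h1 := hc.add (x := x) hY'.mdifferentiableAt hY.mdifferentiableAt
  have e : ((fun y => X y - Y y) + Y) = X := by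
    funext y
    simp
  rw [e] at h1
  rw [h1]
  simp

/-- A connection without torsion is determined at the zeros of a field by the differential. -/
theorem coordVec_nabla (hn : IsLeviCivita g nabla) {x₀ y : M} (hy : y ∈ (chartAt E x₀).source)
    {Y : ∀ x : M, TangentSpace 𝓘(ℝ, E) x} (hY : SmoothFieldAt Y y) (v : TangentSpace 𝓘(ℝ, E) y) :
    coordVec x₀ y (nabla Y y v)
      = fderiv ℝ (inChart x₀ Y) (extChartAt 𝓘(ℝ, E) x₀ y) (coordVec x₀ y v)
        + coordVec x₀ y (nabla (coordField x₀ (coordVec x₀ y (Y y))) y v) := by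
  have : CompleteSpace E := FiniteDimensional.complete ℝ E
  set C := coordField x₀ (coordVec x₀ y (Y y)) with hC
  have hCs : SmoothFieldAt C y := smoothFieldAt_coordField hy _
  obtain ⟨V, hV, rfl⟩ := exists_smoothFieldAt v
  have hZ : SmoothFieldAt (fun z => Y z - C z) y := by
    simp only [sub_eq_add_neg]
    exact hY.add hCs.neg
  have hZ0 : Y y - C y = 0 := by
    simp only [hC, coordField_coordVec hy, sub_self]
  have hZ1 : inChart x₀ (fun z => Y z - C z) (extChartAt 𝓘(ℝ, E) x₀ y) = 0 := by
    rw [inChart_extChartAt hy (fun z => Y z - C z), hZ0, coordVec_zero]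
  -- `Y - C` vanishes at `y`, so one term of the torsion identity disappears and `∇_V (Y - C)` is
  -- the bracket, that is, the derivative of the components of `Y`.
  have h1 := hn.torsion_free y V (fun z => Y z - C z) hV.mdifferentiableAt hZ.mdifferentiableAt
  rw [hZ0, map_zero, sub_zero, nabla_sub hY hCs] at h1
  have h2 := congrArg (coordVec x₀ y) h1
  rw [coordVec_sub, coordVec_mlieBracket hy hV hZ, VectorField.lieBracket,
    hZ1, map_zero, sub_zero,
    inChart_extChartAt hy] at h2
  have e : inChart x₀ (fun z => Y z - C z) =ᶠ[𝓝 (extChartAt 𝓘(ℝ, E) x₀ y)]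
      fun u => inChart x₀ Y u - coordVec x₀ y (Y y) := by
    filter_upwards [inChart_coordField hy (coordVec x₀ y (Y y))] with u hu
    rw [← hu]
    exact coordVec_sub _ _ _ _
  rw [e.fderiv_eq, fderiv_sub_const] at h2
  rw [← h2, sub_add_cancel]

theorem mvfderiv_metric_coordField {x₀ y : M} (hy : y ∈ (chartAt E x₀).source) (a b c : E) :
    mvfderiv 𝓘(ℝ, E) (fun z => g.val z (coordField x₀ a z) (coordField x₀ b z)) y
        (coordField x₀ c y)
      = fderiv ℝ (formInChart g.val x₀) (extChartAt 𝓘(ℝ, E) x₀ y) c a b := by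
  have hu : extChartAt 𝓘(ℝ, E) x₀ y ∈ (extChartAt 𝓘(ℝ, E) x₀).target :=
    (extChartAt 𝓘(ℝ, E) x₀).map_source (by simpa using hy)
  have hB := (((contDiffOn_formInChart (isSmoothForm_metric g) x₀).contDiffAt
    ((isOpen_extChartAt_target x₀).mem_nhds hu)).differentiableAt (by simp)).hasFDerivAt
  have e : (fun u => g.val ((extChartAt 𝓘(ℝ, E) x₀).symm u)
      (coordField x₀ a ((extChartAt 𝓘(ℝ, E) x₀).symm u))
      (coordField x₀ b ((extChartAt 𝓘(ℝ, E) x₀).symm u))) =ᶠ[𝓝 (extChartAt 𝓘(ℝ, E) x₀ y)]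
      fun u => formInChart g.val x₀ u a b := by
    filter_upwards [(isOpen_extChartAt_target (I := 𝓘(ℝ, E)) x₀).mem_nhds hu] with u hu
    exact (formInChart_apply g.val hu a b).symm
  rw [mvfderiv_eq_fderiv_extChartAt hy (((smoothFieldAt_coordField hy a).contMDiffAt_metric g
    (smoothFieldAt_coordField hy b)).mdifferentiableAt (by simp)), e.fderiv_eq,
    coordVec_coordField hy,
    ((hB.clm_apply (hasFDerivAt_const a _)).clm_apply (hasFDerivAt_const b _)).fderiv]
  simp

/-- The Koszul formula for coordinate fields. -/
theorem koszul_coordField (hn : IsLeviCivita g nabla) {x₀ y : M}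
    (hy : y ∈ (chartAt E x₀).source) (a b c : E) :
    2 * formInChart g.val x₀ (extChartAt 𝓘(ℝ, E) x₀ y)
        (coordVec x₀ y (nabla (coordField x₀ a) y (coordField x₀ c y))) b
      = fderiv ℝ (formInChart g.val x₀) (extChartAt 𝓘(ℝ, E) x₀ y) c a b
        + fderiv ℝ (formInChart g.val x₀) (extChartAt 𝓘(ℝ, E) x₀ y) a c b
        - fderiv ℝ (formInChart g.val x₀) (extChartAt 𝓘(ℝ, E) x₀ y) b c a := by
  have hd := fun w => (smoothFieldAt_coordField hy w).mdifferentiableAt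
  have t : ∀ v w, nabla (coordField x₀ v) y (coordField x₀ w y)
      = nabla (coordField x₀ w) y (coordField x₀ v y) := fun v w => by
    have := hn.torsion_free y _ _ (hd w) (hd v)
    rwa [mlieBracket_coordField hy, sub_eq_zero] at this
  have m1 := hn.metric y (coordField x₀ c y) _ _ (hd a) (hd b)
  have m2 := hn.metric y (coordField x₀ a y) _ _ (hd c) (hd b)
  have m3 := hn.metric y (coordField x₀ b y) _ _ (hd c) (hd a)
  rw [← mvfderiv_metric_coordField hy, ← mvfderiv_metric_coordField hy,
    ← mvfderiv_metric_coordField hy, m1, m2, m3]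
  have e : formInChart g.val x₀ (extChartAt 𝓘(ℝ, E) x₀ y)
        (coordVec x₀ y (nabla (coordField x₀ a) y (coordField x₀ c y))) b
      = g.val y (nabla (coordField x₀ a) y (coordField x₀ c y)) (coordField x₀ b y) := by
    rw [← formInChart_coordVec g.val hy, coordVec_coordField hy]
  rw [e, t c a, t b c, t b a, g.symm y (coordField x₀ a y)]
  ring

/-- Nondegeneracy makes the form injective at the base point, hence bounded below in finite
dimension, with a constant `K`. A perturbation of norm less than `1 / (2K)` costs only a factor 2.
-/
theorem eventually_norm_le_norm_formInChart (g : PseudoMetric E M) {x₀ y : M}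
    (hy : y ∈ (chartAt E x₀).source) : ∃ κ > 0, ∀ᶠ u in 𝓝 (extChartAt 𝓘(ℝ, E) x₀ y),
      ∀ w : E, ‖w‖ ≤ κ * ‖formInChart g.val x₀ u w‖ := by
  set u₀ := extChartAt 𝓘(ℝ, E) x₀ y with hu₀
  have hu : u₀ ∈ (extChartAt 𝓘(ℝ, E) x₀).target :=
    (extChartAt 𝓘(ℝ, E) x₀).map_source (by simpa using hy)
  have hker : LinearMap.ker (formInChart g.val x₀ u₀).toLinearMap = ⊥ := by
    rw [LinearMap.ker_eq_bot']
    intro w hw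
    have hz : coordField x₀ w y = 0 := by
      refine g.nondegenerate y _ fun v => ?_
      rw [← formInChart_coordVec g.val hy, coordVec_coordField hy]
      exact congrArg (fun L : E →L[ℝ] ℝ => L (coordVec x₀ y v)) hw
    rw [← coordVec_coordField hy w, hz, coordVec_zero]
  obtain ⟨K, hK, hanti⟩ := LinearMap.exists_antilipschitzWith _ hker
  have hcont : ContinuousAt (formInChart g.val x₀) u₀ :=
    ((contDiffOn_formInChart (isSmoothForm_metric g) x₀).contDiffAt
      ((isOpen_extChartAt_target x₀).mem_nhds hu)).continuousAt
  have hK' : (0 : ℝ) < K := hK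
  refine ⟨2 * K, by positivity, ?_⟩
  filter_upwards [Metric.continuousAt_iff'.1 hcont (1 / (2 * K)) (by positivity)] with u hu w
  have h1 : ‖w‖ ≤ K * ‖formInChart g.val x₀ u₀ w‖ := by
    simpa using hanti.le_mul_dist w 0
  rw [dist_eq_norm] at hu
  have h2 : ‖(formInChart g.val x₀ u - formInChart g.val x₀ u₀) w‖ ≤ 1 / (2 * K) * ‖w‖ :=
    ContinuousLinearMap.le_of_opNorm_le _ hu.le w
  have h3 : ‖formInChart g.val x₀ u₀ w‖
      ≤ ‖formInChart g.val x₀ u w‖ + 1 / (2 * K) * ‖w‖ := by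
    have : formInChart g.val x₀ u₀ w = formInChart g.val x₀ u w
        - (formInChart g.val x₀ u - formInChart g.val x₀ u₀) w := by simp
    rw [this]
    exact (norm_sub_le _ _).trans (add_le_add_right h2 _)
  have h4 : (K : ℝ) * (1 / (2 * K) * ‖w‖) = ‖w‖ / 2 := by field_simp
  nlinarith [mul_le_mul_of_nonneg_left h3 hK'.le]

/-- The Christoffel symbols are locally bounded. -/
theorem exists_christoffel_bound (hn : IsLeviCivita g nabla) {x₀ y : M}
    (hy : y ∈ (chartAt E x₀).source) : ∃ C : ℝ, ∀ᶠ z in 𝓝 y, ∀ (a : E)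
      (v : TangentSpace 𝓘(ℝ, E) z),
      ‖coordVec x₀ z (nabla (coordField x₀ a) z v)‖ ≤ C * ‖coordVec x₀ z v‖ * ‖a‖ := by
  obtain ⟨κ, hκ, h1⟩ := eventually_norm_le_norm_formInChart g hy
  have hu : extChartAt 𝓘(ℝ, E) x₀ y ∈ (extChartAt 𝓘(ℝ, E) x₀).target :=
    (extChartAt 𝓘(ℝ, E) x₀).map_source (by simpa using hy)
  have hcont : ContinuousAt (fderiv ℝ (formInChart g.val x₀)) (extChartAt 𝓘(ℝ, E) x₀ y) :=
    (((contDiffOn_formInChart (isSmoothForm_metric g) x₀).contDiffAt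
      ((isOpen_extChartAt_target x₀).mem_nhds hu)).fderiv_right (m := 0) (by simp)).continuousAt
  set D := ‖fderiv ℝ (formInChart g.val x₀) (extChartAt 𝓘(ℝ, E) x₀ y)‖ + 1
  have h2 : ∀ᶠ u in 𝓝 (extChartAt 𝓘(ℝ, E) x₀ y), ‖fderiv ℝ (formInChart g.val x₀) u‖ < D :=
    hcont.norm.eventually (gt_mem_nhds (lt_add_one _))
  have hφ : ContinuousAt (extChartAt 𝓘(ℝ, E) x₀) y := continuousAt_extChartAt' (by simpa using hy)
  -- The Koszul formula has three terms bounded through `D` and a factor 2 on the left; `κ` recovers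
  -- a vector from its metric dual. The bound uses smoothness of the metric alone.
  refine ⟨κ * (3 / 2 * D), ?_⟩
  filter_upwards [hφ.eventually (h1.and h2), (chartAt E x₀).open_source.mem_nhds hy]
    with z ⟨hz1, hz2⟩ hz a v
  have hb : ∀ p q r : E, |fderiv ℝ (formInChart g.val x₀) (extChartAt 𝓘(ℝ, E) x₀ z) p q r|
      ≤ D * ‖p‖ * ‖q‖ * ‖r‖ := fun p q r => by
    have k1 := ContinuousLinearMap.le_of_opNorm_le _ hz2.le p
    have k2 := ContinuousLinearMap.le_of_opNorm_le _ k1 q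
    exact ContinuousLinearMap.le_of_opNorm_le _ k2 r
  refine (hz1 _).trans ?_
  rw [mul_assoc κ, mul_assoc κ]
  refine mul_le_mul_of_nonneg_left ?_ hκ.le
  refine ContinuousLinearMap.opNorm_le_bound _ (by positivity) fun b => ?_
  have hk := koszul_coordField hn hz a b (coordVec x₀ z v)
  rw [coordField_coordVec hz] at hk
  rw [Real.norm_eq_abs]
  have a1 := hb (coordVec x₀ z v) a b
  have a2 := hb a (coordVec x₀ z v) b
  have a3 := hb b (coordVec x₀ z v) a
  rw [abs_le] at a1 a2 a3 ⊢
  constructor <;> nlinarith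

theorem coordField_smul (x₀ : M) (r : ℝ) (v : E) (y : M) :
    coordField x₀ (r • v) y = r • coordField x₀ v y :=
  map_smul (mfderiv 𝓘(ℝ, E) 𝓘(ℝ, E) (extChartAt 𝓘(ℝ, E) x₀).symm (extChartAt 𝓘(ℝ, E) x₀ y)) r v

theorem christoffel_sub {x₀ y : M} (hy : y ∈ (chartAt E x₀).source) (a b : E)
    (v : TangentSpace 𝓘(ℝ, E) y) :
    coordVec x₀ y (nabla (coordField x₀ (a - b)) y v)
      = coordVec x₀ y (nabla (coordField x₀ a) y v)
        - coordVec x₀ y (nabla (coordField x₀ b) y v) := by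
  have e : coordField x₀ (a - b) = fun z : M => coordField x₀ a z - coordField x₀ b z := by
    funext z
    exact coordField_sub x₀ a b z
  rw [e, nabla_sub (smoothFieldAt_coordField hy a) (smoothFieldAt_coordField hy b), coordVec_sub]

theorem christoffel_smul {x₀ y : M} (hy : y ∈ (chartAt E x₀).source) (r : ℝ) (a : E)
    (v : TangentSpace 𝓘(ℝ, E) y) :
    coordVec x₀ y (nabla (coordField x₀ (r • a)) y v)
      = r • coordVec x₀ y (nabla (coordField x₀ a) y v) := by
  have hc := nabla.isCovariantDerivativeOn (s := univ)
  have e : coordField x₀ (r • a) = r • (coordField x₀ a : ∀ y : M, TangentSpace 𝓘(ℝ, E) y) := by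
    funext z
    exact coordField_smul x₀ r a z
  rw [e, hc.smul_const r (smoothFieldAt_coordField hy a).mdifferentiableAt, ← coordVec_smul]
  rfl

/-- The velocity of a curve. -/
def velocity (γ : ℝ → M) (s : ℝ) : TangentSpace 𝓘(ℝ, E) (γ s) :=
  mfderiv 𝓘(ℝ, ℝ) 𝓘(ℝ, E) γ s (1 : ℝ)

theorem coordVec_velocity {γ : ℝ → M} {x₀ : M} {s : ℝ}
    (hγ : MDifferentiableAt 𝓘(ℝ, ℝ) 𝓘(ℝ, E) γ s) (hs : γ s ∈ (chartAt E x₀).source) :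
    coordVec x₀ (γ s) (velocity γ s) = deriv (fun τ => extChartAt 𝓘(ℝ, E) x₀ (γ τ)) s := by
  refine (coordVec_mfderiv hγ hs (1 : ℝ)).trans ?_
  rw [mvfderiv_eq_fderiv]
  exact fderiv_apply_one_eq_deriv (𝕜 := ℝ) (F := E)

/-- Along the geodesic, `W = X - (1 + s) γ'` has covariant derivative `γ' - γ' = 0`. In a chart this
is the linear equation `W' = -Γ(γ', W)` with locally bounded coefficients, so a zero at one time of
the interval forces `W = 0` on all of it. -/
theorem IsGeodesic.exists_nhds (hn : IsLeviCivita g nabla)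
    {X : ∀ x : M, TangentSpace 𝓘(ℝ, E) x} (hX : ∀ x, SmoothFieldAt X x)
    (hid : ∀ (x : M) (v : TangentSpace 𝓘(ℝ, E) x), nabla X x v = v) {γ : ℝ → M}
    (hγ : IsGeodesic nabla γ) (s₀ : ℝ) : ∃ ε > 0, ∀ s₁ ∈ Ioo (s₀ - ε) (s₀ + ε),
      X (γ s₁) = (1 + s₁) • velocity γ s₁ →
      ∀ s ∈ Ioo (s₀ - ε) (s₀ + ε), X (γ s) = (1 + s) • velocity γ s := by
  set x₀ := γ s₀ with hx₀
  have hx := mem_chart_source E x₀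
  set u : ℝ → E := fun τ => extChartAt 𝓘(ℝ, E) x₀ (γ τ) with hu
  have hu_smooth : ∀ s, γ s ∈ (chartAt E x₀).source → ContDiffAt ℝ ∞ u s := fun s hs =>
    ((contMDiffAt_extChartAt' (I := 𝓘(ℝ, E)) (n := ∞) hs).comp s (hγ.1 s)).contDiffAt
  have hdu_smooth : ∀ s, γ s ∈ (chartAt E x₀).source → ContDiffAt ℝ ∞ (deriv u) s := fun s hs => by
    have h1 : ContDiffAt ℝ ∞ (fun s => fderiv ℝ u s 1) s :=
      ((hu_smooth s hs).fderiv_right (by simp)).clm_apply contDiffAt_const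
    simpa only [fderiv_apply_one_eq_deriv] using h1
  have hvel : ∀ s, γ s ∈ (chartAt E x₀).source →
      coordVec x₀ (γ s) (velocity γ s) = deriv u s := fun s hs =>
    coordVec_velocity ((hγ.1 s).mdifferentiableAt (by simp)) hs
  obtain ⟨C, hC⟩ := exists_christoffel_bound hn hx
  have hγc : ContinuousAt γ s₀ := (hγ.1 s₀).continuousAt
  have hev : ∀ᶠ s in 𝓝 s₀, γ s ∈ (chartAt E x₀).source ∧ ‖deriv u s‖ < ‖deriv u s₀‖ + 1 ∧
      ∀ (a : E) (v : TangentSpace 𝓘(ℝ, E) (γ s)),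
        ‖coordVec x₀ (γ s) (nabla (coordField x₀ a) (γ s) v)‖
          ≤ C * ‖coordVec x₀ (γ s) v‖ * ‖a‖ := by
    filter_upwards [hγc.eventually ((chartAt E x₀).open_source.mem_nhds hx), hγc.eventually hC,
      (hdu_smooth s₀ hx).continuousAt.norm.eventually (gt_mem_nhds (lt_add_one _))]
      with s h1 h2 h3
    exact ⟨h1, h3, h2⟩
  obtain ⟨ε, hε, hball⟩ := Metric.eventually_nhds_iff.1 hev
  have hmem : ∀ s ∈ Ioo (s₀ - ε) (s₀ + ε), dist s s₀ < ε := fun s hs => by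
    rw [Real.dist_eq, abs_lt]
    exact ⟨by linarith [hs.1], by linarith [hs.2]⟩
  refine ⟨ε, hε, fun s₁ hs₁ heq => ?_⟩
  set Γ : ℝ → E → E := fun s w =>
    coordVec x₀ (γ s) (nabla (coordField x₀ w) (γ s) (velocity γ s)) with hΓ
  set W : ℝ → E := fun s => inChart x₀ X (u s) - (1 + s) • deriv u s with hW
  have hWc : ∀ s, γ s ∈ (chartAt E x₀).source →
      W s = coordVec x₀ (γ s) (X (γ s) - (1 + s) • velocity γ s) := fun s hs => by
    rw [coordVec_sub, coordVec_smul, hvel s hs, ← inChart_extChartAt hs]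
  have hWd : ∀ s ∈ Ioo (s₀ - ε) (s₀ + ε), HasDerivAt W (-Γ s (W s)) s := by
    intro s hs
    have hsrc := (hball (hmem s hs)).1
    have d1 : HasDerivAt u (deriv u s) s := ((hu_smooth s hsrc).differentiableAt (by simp)).hasDerivAt
    have d2 : HasDerivAt (deriv u) (deriv (deriv u) s) s :=
      ((hdu_smooth s hsrc).differentiableAt (by simp)).hasDerivAt
    have d3 : HasFDerivAt (inChart x₀ X) (fderiv ℝ (inChart x₀ X) (u s)) (u s) :=
      ((contDiffAt_inChart hsrc (hX _)).differentiableAt (by simp)).hasFDerivAt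
    have d4 := (d3.comp_hasDerivAt s d1).fun_sub (((hasDerivAt_id' s).const_add 1).fun_smul d2)
    refine d4.congr_deriv ?_
    have k1 := coordVec_nabla hn hsrc (hX (γ s)) (velocity γ s)
    rw [hid, hvel s hsrc, ← inChart_extChartAt hsrc] at k1
    have k2 : deriv (deriv u) s + Γ s (deriv u s) = 0 := hγ.2 x₀ s hsrc
    have k3 : Γ s (W s) = Γ s (inChart x₀ X (u s)) - (1 + s) • Γ s (deriv u s) := by
      simp only [hΓ, hW]
      rw [christoffel_sub hsrc, christoffel_smul hsrc]
    have k4 : fderiv ℝ (inChart x₀ X) (u s) (deriv u s)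
        = deriv u s - Γ s (inChart x₀ X (u s)) := eq_sub_of_add_eq k1.symm
    rw [k3, k4, eq_neg_of_add_eq_zero_left k2]
    module
  have hlip : ∀ s ∈ Ioo (s₀ - ε) (s₀ + ε),
      LipschitzOnWith (Real.toNNReal (|C| * (‖deriv u s₀‖ + 1))) (fun w => -Γ s w) univ := by
    intro s hs
    obtain ⟨hsrc, hb1, hb2⟩ := hball (hmem s hs)
    refine LipschitzOnWith.of_dist_le_mul fun a _ b _ => ?_
    rw [dist_neg_neg, dist_eq_norm, dist_eq_norm, Real.coe_toNNReal _ (by positivity)]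
    have e : Γ s a - Γ s b = Γ s (a - b) := (christoffel_sub hsrc a b _).symm
    rw [e]
    refine (hb2 (a - b) _).trans ?_
    rw [hvel s hsrc]
    gcongr
    exact le_abs_self C
  have hzero : ∀ s ∈ Ioo (s₀ - ε) (s₀ + ε), HasDerivAt (fun _ : ℝ => (0 : E)) (-Γ s 0) s := by
    intro s hs
    have hsrc := (hball (hmem s hs)).1
    have : Γ s 0 = 0 := by
      have := christoffel_smul (nabla := nabla) hsrc 0 (0 : E) (velocity γ s)
      simpa using this
    rw [this, neg_zero]
    exact hasDerivAt_const s 0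
  have h1 : W s₁ = 0 := by
    rw [hWc s₁ (hball (hmem s₁ hs₁)).1, heq, sub_self, coordVec_zero]
  have key := ODE_solution_unique_of_mem_Ioo (v := fun s w => -Γ s w) (s := fun _ => univ) hlip hs₁
    (fun s hs => ⟨hWd s hs, mem_univ _⟩) (fun s hs => ⟨hzero s hs, mem_univ _⟩) h1
  intro s hs
  have hsrc := (hball (hmem s hs)).1
  have h2 := key hs
  rw [hWc s hsrc] at h2
  rw [← sub_eq_zero]
  exact coordVec_injective hsrc (h2.trans (coordVec_zero x₀ (γ s)).symm)

/-- The local propagation works in both directions of time, so connectedness of `ℝ` carries the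
identity from `s = 0` to all `s`. For `s > -1` it exhibits `γ` as an integral curve of `X`
reparametrized by `log (1 + s)`. -/
theorem IsGeodesic.eq_smul_velocity (hn : IsLeviCivita g nabla)
    {X : ∀ x : M, TangentSpace 𝓘(ℝ, E) x} (hX : ∀ x, SmoothFieldAt X x)
    (hid : ∀ (x : M) (v : TangentSpace 𝓘(ℝ, E) x), nabla X x v = v) {γ : ℝ → M}
    (hγ : IsGeodesic nabla γ) (h0 : X (γ 0) = velocity γ 0) (s : ℝ) :
    X (γ s) = (1 + s) • velocity γ s := by
  refine PreconnectedSpace.induction₂'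
    (fun s t : ℝ => X (γ s) = (1 + s) • velocity γ s → X (γ t) = (1 + t) • velocity γ t)
    (fun t => ?_) ⟨fun _ _ _ h h' => h' ∘ h⟩ 0 s (by simpa using h0)
  obtain ⟨ε, hε, h⟩ := hγ.exists_nhds hn hX hid t
  have ht : t ∈ Ioo (t - ε) (t + ε) := ⟨by linarith, by linarith⟩
  filter_upwards [Ioo_mem_nhds ht.1 ht.2] with r hr
  exact ⟨fun h1 => h t ht h1 r hr, fun h1 => h r hr h1 t ht⟩

/-- A manifold with a nowhere zero field `X` with `∇ X = id` is incomplete. -/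
theorem not_isGeodesicallyComplete [Nonempty M] (hn : IsLeviCivita g nabla)
    {X : ∀ x : M, TangentSpace 𝓘(ℝ, E) x} (hX : ∀ x, SmoothFieldAt X x)
    (hid : ∀ (x : M) (v : TangentSpace 𝓘(ℝ, E) x), nabla X x v = v) (hne : ∀ x, X x ≠ 0) :
    ¬ IsGeodesicallyComplete nabla := fun hc => by
  obtain ⟨x⟩ := ‹Nonempty M›
  obtain ⟨γ, hγ, rfl, h0⟩ := hc x (X x)
  -- At `s = -1` the factor `1 + s` vanishes while the velocity of `γ` still exists.
  have h1 := hγ.eq_smul_velocity hn hX hid h0.symm (-1)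
  rw [add_neg_cancel, zero_smul] at h1
  exact hne _ h1

end Geodesic

end Hypersymplectic
end

noncomputable section

set_option linter.unusedSectionVars false

namespace Hypersymplectic

/-! ### The flow of the Euler field -/

section EulerFlow

theorem eq_exp_mul_of_hasDerivAt {q : ℝ → ℝ} {t r : ℝ}
    (h : ∀ s ∈ uIcc 0 t, HasDerivAt q (r * q s) s) : q t = Real.exp (r * t) * q 0 := by
  have hd : ∀ s ∈ uIcc 0 t, HasDerivWithinAt (fun s => Real.exp (-(r * s)) * q s) 0 (uIcc 0 t) s := by
    intro s hs
    have h1 : HasDerivAt (fun s => Real.exp (-(r * s))) (Real.exp (-(r * s)) * -(r * 1)) s :=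
      (((hasDerivAt_id' s).const_mul r).fun_neg).exp
    exact ((h1.fun_mul (h s hs)).congr_deriv (by ring)).hasDerivWithinAt
  have h2 := (convex_uIcc 0 t).norm_image_sub_le_of_norm_hasDerivWithin_le (C := 0) hd
    (fun s _ => by simp) (left_mem_uIcc (a := (0 : ℝ)) (b := t)) right_mem_uIcc
  rw [zero_mul, norm_le_zero_iff, sub_eq_zero] at h2
  simp only [mul_zero, neg_zero, Real.exp_zero, one_mul] at h2
  rw [← h2, ← mul_assoc, ← Real.exp_add]
  simp

variable {n : ℕ} {E : Type*} [NormedAddCommGroup E] [NormedSpace ℝ E] [FiniteDimensional ℝ E]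
  {M : Type*} [TopologicalSpace M] [T2Space M] [ChartedSpace E M] [IsManifold 𝓘(ℝ, E) ∞ M]

/-- If `L_X β = r β` then the time `t` flow of `X` multiplies `β` by `exp (r t)`. -/
theorem pullback_flowMap {X : ∀ x : M, TangentSpace 𝓘(ℝ, E) x} (hX : ∀ x, SmoothFieldAt X x)
    {β : ∀ x : M, TangentSpace 𝓘(ℝ, E) x →L[ℝ] TangentSpace 𝓘(ℝ, E) x →L[ℝ] ℝ}
    (hβ : IsSmoothForm β) {r : ℝ}
    (hr : ∀ (x : M) (Y Z : ∀ x : M, TangentSpace 𝓘(ℝ, E) x), SmoothFieldAt Y x →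
      SmoothFieldAt Z x → lieForm β X Y Z x = r * β x (Y x) (Z x))
    {t : ℝ} {x : M} (hx : x ∈ flowDomain X t) (v w : TangentSpace 𝓘(ℝ, E) x) :
    β (flowMap X t x) (mfderiv 𝓘(ℝ, E) 𝓘(ℝ, E) (flowMap X t) x v)
        (mfderiv 𝓘(ℝ, E) 𝓘(ℝ, E) (flowMap X t) x w) = Real.exp (r * t) * β x v w := by
  rw [eq_exp_mul_of_hasDerivAt (q := fun s => β (flowMap X s x)
      (mfderiv 𝓘(ℝ, E) 𝓘(ℝ, E) (flowMap X s) x v) (mfderiv 𝓘(ℝ, E) 𝓘(ℝ, E) (flowMap X s) x w))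
    fun s hs => hasDerivAt_pullback_flowMap hX hβ hr (mem_flowDomain_of_mem_uIcc hx hs) v w]
  have e : flowMap X 0 = (id : M → M) := by
    funext y
    exact (flowsTo_zero hX y).flowMap_eq hX
  have gen : ∀ f : M → M, f = id → β (f x) (mfderiv 𝓘(ℝ, E) 𝓘(ℝ, E) f x v)
      (mfderiv 𝓘(ℝ, E) 𝓘(ℝ, E) f x w) = β x v w := by
    rintro f rfl
    rw [mfderiv_id]
    rfl
  congr 1
  exact gen _ e

variable [MulAction Sp1 M] {H : HypersymplecticStructure n E M}

/-- Along an integral curve the derivative of `ρ₀` is `dρ₀(𝓔) = g(𝓔, 𝓔) = 2ρ₀`. -/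
theorem IsPermutingAction.rhoZero_flow (h : IsPermutingAction H) (h2 : RhoTwoVanishes H) {t : ℝ}
    {x y : M} (hf : FlowsTo (euler H) t x y) :
    rhoZero H y = Real.exp (2 * t) * rhoZero H x := by
  obtain ⟨a, b, h0, ht, γ, rfl, rfl, hγ⟩ := hf.exists_Ioo (h.smooth_euler h2)
  refine eq_exp_mul_of_hasDerivAt (q := fun s => rhoZero H (γ s)) fun s hs => ?_
  have hs' : s ∈ Ioo a b := ordConnected_Ioo.uIcc_subset h0 ht hs
  have d1 := (hγ s hs').hasMFDerivAt (Ioo_mem_nhds hs'.1 hs'.2)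
  have d2 := ((h.contMDiff_rhoZero (γ s)).mdifferentiableAt (by simp)).hasMFDerivAt
  let L : E →L[ℝ] ℝ := mfderiv 𝓘(ℝ, E) 𝓘(ℝ, ℝ) (rhoZero H) (γ s)
  let V : E := euler H (γ s)
  have d3 : HasFDerivAt (𝕜 := ℝ) (F := ℝ) (fun s => rhoZero H (γ s))
      (L.comp ((1 : ℝ →L[ℝ] ℝ).smulRight V)) s := (HasMFDerivAt.comp s d2 d1).hasFDerivAt
  refine (HasFDerivAt.hasDerivAt (F := ℝ) d3).congr_deriv ?_
  have e : mvfderiv 𝓘(ℝ, E) (rhoZero H) (γ s) (euler H (γ s)) = 2 * rhoZero H (γ s) := by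
    rw [← gradient_spec H.g (rhoZero H), h.rhoZero_eq h2]
    ring
  rw [← e]
  refine Eq.trans ?_ (congrArg (mvfderiv 𝓘(ℝ, E) (rhoZero H) (γ s)) (one_smul ℝ (euler H (γ s))))
  rfl

/-- The inverse is the time `-t` map. The scaling of `g` holds for all tangent vectors, so in
particular for those tangent to the level sets. -/
theorem IsPermutingAction.isHomothety_flowMap (h : IsPermutingAction H) (h2 : RhoTwoVanishes H)
    (t c : ℝ) : IsHomothety H.g (rhoZero H)
      ({x | rhoZero H x = c} ∩ flowDomain (euler H) t)
      ({x | rhoZero H x = Real.exp (2 * t) * c} ∩ flowDomain (euler H) (-t))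
      (Real.exp (2 * t)) (flowMap (euler H) t) := by
  have hX := h.smooth_euler h2
  refine ⟨flowMap (euler H) (-t), flowDomain (euler H) t, flowDomain (euler H) (-t),
    isOpen_flowDomain hX t, isOpen_flowDomain hX (-t), inter_subset_right, inter_subset_right,
    fun x hx => (contMDiffAt_flowMap hX hx).contMDiffWithinAt,
    fun x hx => (contMDiffAt_flowMap hX hx).contMDiffWithinAt, ?_, ?_, ?_, ?_, ?_⟩
  · rintro x ⟨hc, hx⟩
    refine ⟨?_, flowMap_mem_flowDomain_neg hx⟩
    rw [mem_ofPred_eq] at hc ⊢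
    rw [h.rhoZero_flow h2 (flowMap_spec hx), hc]
  · rintro x ⟨hc, hx⟩
    refine ⟨?_, ?_⟩
    · rw [mem_ofPred_eq] at hc ⊢
      rw [h.rhoZero_flow h2 (flowMap_spec hx), hc, ← mul_assoc, ← Real.exp_add]
      simp
    · simpa using flowMap_mem_flowDomain_neg hx
  · rintro x ⟨-, hx⟩
    exact flowMap_neg_flowMap hX hx
  · rintro x ⟨-, hx⟩
    simpa using flowMap_neg_flowMap hX hx
  · rintro x ⟨-, hx⟩ v w - -
    exact pullback_flowMap hX (isSmoothForm_metric H.g)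
      (fun x Y Z hY hZ => h.lieForm_metric_euler h2 hY hZ) hx v w

end EulerFlow

end Hypersymplectic
end

theorem mainTheorem4 (n : ℕ)
    {E : Type*} [NormedAddCommGroup E] [NormedSpace ℝ E] [FiniteDimensional ℝ E]
    {M : Type*} [TopologicalSpace M] [T2Space M] [Nonempty M] [ChartedSpace E M]
    [IsManifold 𝓘(ℝ, E) ∞ M] [MulAction Hypersymplectic.Sp1 M]
    (H : Hypersymplectic.HypersymplecticStructure n E M)
    (hperm : Hypersymplectic.IsPermutingAction H)
    (hfree : ∀ (q : Hypersymplectic.Sp1) (x : M), q • x = x → q = 1)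
    (hrho : ∀ ξ ξ' : Hypersymplectic.SplitQuaternion, ξ.re = 0 → ξ'.re = 0 →
      ∀ x : M, Hypersymplectic.rhoTwo H ξ ξ' x = 0)
    (nabla : CovariantDerivative 𝓘(ℝ, E) E (TangentSpace 𝓘(ℝ, E) : M → Type _))
    (hnabla : Hypersymplectic.IsLeviCivita H.g nabla) :
    -- `ρ₀` is a hypersymplectic potential, with smooth and nowhere zero gradient `Eu`
    Hypersymplectic.IsHypersymplecticPotential H (Hypersymplectic.rhoZero H) ∧
    ∃ Eu : ∀ x : M, TangentSpace 𝓘(ℝ, E) x,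
      Eu = Hypersymplectic.gradient H.g (Hypersymplectic.rhoZero H) ∧
      (∀ x, Hypersymplectic.SmoothFieldAt Eu x) ∧ (∀ x, Eu x ≠ 0) ∧
      -- `∇ Eu = id`
      (∀ (x : M) (v : TangentSpace 𝓘(ℝ, E) x), nabla Eu x v = v) ∧
      -- `∇² ρ₀ = g`
      (∀ (x : M) (v : TangentSpace 𝓘(ℝ, E) x) (Y : ∀ x : M, TangentSpace 𝓘(ℝ, E) x),
        Hypersymplectic.SmoothFieldAt Y x →
        Hypersymplectic.hessian nabla (Hypersymplectic.rhoZero H) x v Y = H.g.val x v (Y x)) ∧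
      -- the metric is incomplete
      ¬ Hypersymplectic.IsGeodesicallyComplete nabla ∧
      -- the flow of `Eu` maps level sets to level sets homothetically, wherever it is defined
      (∀ x : M, ∀ᶠ t in 𝓝 (0 : ℝ), x ∈ Hypersymplectic.flowDomain Eu t) ∧
      (∀ t : ℝ, IsOpen (Hypersymplectic.flowDomain Eu t) ∧
        ∃ φ : M → M, (∀ x ∈ Hypersymplectic.flowDomain Eu t, Hypersymplectic.FlowsTo Eu t x (φ x)) ∧
          ∀ c : ℝ, Hypersymplectic.IsHomothety H.g (Hypersymplectic.rhoZero H)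
            ({x | Hypersymplectic.rhoZero H x = c} ∩ Hypersymplectic.flowDomain Eu t)
            ({x | Hypersymplectic.rhoZero H x = Real.exp (2 * t) * c}
              ∩ Hypersymplectic.flowDomain Eu (-t))
            (Real.exp (2 * t)) φ) ∧
      -- if this flow is complete, level sets of the same sign are globally homothetic
      ((∀ t : ℝ, Hypersymplectic.flowDomain Eu t = univ) →
        ∀ c c' : ℝ, 0 < c * c' →
          ∃ φ : M → M, Hypersymplectic.IsHomothety H.g (Hypersymplectic.rhoZero H)
            {x | Hypersymplectic.rhoZero H x = c} {x | Hypersymplectic.rhoZero H x = c'}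
            (c' / c) φ) := by
  have hX := hperm.smooth_euler hrho
  refine ⟨hperm.isHypersymplecticPotential hrho, Hypersymplectic.euler H, rfl, hX,
    hperm.euler_ne_zero hrho hfree, hperm.nabla_euler hrho hnabla,
    fun x v Y hY => hperm.hessian_rhoZero hrho hnabla x v hY,
    Hypersymplectic.not_isGeodesicallyComplete hnabla hX (hperm.nabla_euler hrho hnabla)
      (hperm.euler_ne_zero hrho hfree),
    Hypersymplectic.eventually_mem_flowDomain hX,
    fun t => ⟨Hypersymplectic.isOpen_flowDomain hX t,
      Hypersymplectic.flowMap (Hypersymplectic.euler H) t,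
      fun x hx => Hypersymplectic.flowMap_spec hx, fun c => hperm.isHomothety_flowMap hrho t c⟩,
    fun hcomplete c c' hcc => ?_⟩
  have hc : c ≠ 0 := left_ne_zero_of_mul hcc.ne'
  have hpos : 0 < c' / c := by
    have : c' / c = c * c' / (c * c) := by field_simp
    rw [this]
    exact div_pos hcc (mul_self_pos.2 hc)
  -- The time is chosen so that `e^{2t} = c' / c`, which is positive because `c` and `c'` have the
  -- same sign.
  have h1 := hperm.isHomothety_flowMap hrho (Real.log (c' / c) / 2) c
  rw [mul_div_cancel₀ _ (two_ne_zero' ℝ), Real.exp_log hpos, div_mul_cancel₀ _ hc, hcomplete,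
    hcomplete, inter_univ, inter_univ] at h1
  exact ⟨_, h1⟩
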